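/- Let $\beta>0$ and $H_\beta=(-i\nabla+\beta\,{\bf a})^2$ on $L^2(\mathbb R^3)$ with ${\bf a}({\bf x})=\frac12(0,0,1)\times{\bf x}$. For a non-negative trace class operator $\Gamma$ on $L^2(\mathbb R^3)$ with ${\rm Tr}[H_\beta\Gamma]<\infty$ and density $\rho_\Gamma$ (that is, $\rho_\Gamma=\sum_k w_k|\psi_k|^2$ if $\Gamma=\sum_k w_k|\psi_k\rangle\langle\psi_k|$), the magnetic Hartree functional is $$\mathcal E^{\rm MH}_\beta[\Gamma]={\rm Tr}[(H_\beta-\beta)\Gamma]-\int\frac{\rho_\Gamma({\bf x})}{|{\bf x}|}\,d^3{\bf x}+\frac12\iint\frac{\rho_\Gamma({\bf x})\rho_\Gamma({\bf y})}{|{\bf x}-{\bf y}|}\,d^3{\bf x}\,d^3{\bf y}.$$ Let $\Pi_0$ be the orthogonal projection onto the lowest Landau band, i.e. onto the eigenspace of the perpendicular part $\pi_1^2+\pi_2^2$ of $H_\beta$ (where $\pi_j=-i\partial_j+\beta a_j$) to its lowest eigenvalue $\beta$, and let $\Pi_>=1-\Pi_0$. For $\lambda>0$ put $$E^{\rm MH}(\lambda,\beta)=\inf_{{\rm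 Tr}[\Gamma]=\lambda}\mathcal E^{\rm MH}_\beta[\Gamma],\qquad E^{\rm MH}_{\rm conf}(\lambda,\beta)=\inf_{{\rm Tr}[\Pi_0\Gamma]\le\lambda}\mathcal E^{\rm MH}_\beta[\Pi_0\Gamma\Pi_0],$$ the infima being over all $\Gamma$ as above. (i) There is a universal constant $C>0$ such that for all $\lambda>0$ and $\beta>0$ $$E^{\rm MH}_{\rm conf}(\lambda,\beta)\le E^{\rm MH}(\lambda,\beta)\left(1-C(1+\lambda)^2\beta^{-1/2}\right).$$ (ii) There is a universal constant $C'>0$ such that for all $\lambda>0$ and $\beta>0$, every minimizer $\Gamma^{\rm H}$ of $\mathcal E^{\rm MH}_\beta$ under the constraint ${\rm Tr}[\Gamma]\le\lambda$ (that is, ${\rm Tr}[\Gamma^{\rm H}]\le\lambda$ and $\mathcal E^{\rm MH}_\beta[\Gamma^{\rm H}]=E^{\rm MH}(\lambda,\beta)$) satisfies $${\rm Tr}[\Pi_>\Gamma^{\rm H}]\le C'(1+\lambda)^3\beta^{-1/2}.$$ -/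

import Mathlib

open MeasureTheory
open scoped ENNReal InnerProductSpace

noncomputable section

namespace MagneticHartree

/-- Physical space `ℝ³`; the coordinates `0, 1` are perpendicular and the coordinate `2` is
parallel to the magnetic field. -/
abbrev Space : Type := EuclideanSpace ℝ (Fin 3)

/-- The one-particle Hilbert space `L²(ℝ³; ℂ)`. -/
abbrev L2 : Type := Lp ℂ 2 (volume : Measure Space)

/-! ### Operators on the one-particle space -/

/-- A fixed orthonormal basis of `L²(ℝ³)`. The trace, the magnetic-kinetic energy and the density
(up to null sets) defined below do not depend on which orthonormal basis is used. -/
def basisIndex : Set L2 := (exists_hilbertBasis ℂ L2).choose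

def onb : HilbertBasis basisIndex ℂ L2 := (exists_hilbertBasis ℂ L2).choose_spec.choose

/-- The trace `Tr[T] = ∑ᵢ ⟨eᵢ, T eᵢ⟩` of a trace class operator. -/
def trace (T : L2 →L[ℂ] L2) : ℂ := ∑' i, ⟪onb i, T (onb i)⟫_ℂ

/-- Density matrices: non-negative trace class operators on `L²(ℝ³)`. (A non-negative operator is
trace class if and only if `∑ᵢ ⟨eᵢ, Γ eᵢ⟩` converges for one orthonormal basis.) -/
structure IsDensityMatrix (Γ : L2 →L[ℂ] L2) : Prop where
  nonneg : Γ.IsPositive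
  traceClass : Summable fun i => ⟪onb i, Γ (onb i)⟫_ℂ

/-- The non-negative square root `T^{1/2}` of a non-negative bounded operator. -/
def opSqrt {H : Type*} [NormedAddCommGroup H] [InnerProductSpace ℂ H] [CompleteSpace H]
    (T : H →L[ℂ] H) : H →L[ℂ] H := CFC.sqrt T

/-- The non-normalized vectors `ψᵢ = Γ^{1/2} eᵢ`, for which `Γ = ∑ᵢ |ψᵢ⟩⟨ψᵢ|`. If `eᵢ` is an
eigenbasis of `Γ` with eigenvalues `wᵢ`, then `ψᵢ = wᵢ^{1/2} eᵢ`. -/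
def orbital (Γ : L2 →L[ℂ] L2) (i : basisIndex) : L2 := opSqrt Γ (onb i)

/-- The density `ρ_Γ(x) = ∑ᵢ |ψᵢ(x)|²`. -/
def density (Γ : L2 →L[ℂ] L2) (x : Space) : ℝ≥0∞ := ∑' i, ‖orbital Γ i x‖ₑ ^ 2

/-! ### The magnetic field -/

/-- The vector potential `a(x) = e × x / 2` with `e = (0, 0, 1)`. -/
def vectorPotential (x : Space) : Fin 3 → ℝ := ![-(x 1) / 2, x 0 / 2, 0]

/-- Smooth compactly supported complex test functions on `ℝ³`. -/
def IsTestFunction (φ : Space → ℂ) : Prop := ContDiff ℝ (⊤ : ℕ∞) φ ∧ HasCompactSupport φ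

/-- The transpose `i ∂ⱼ + β aⱼ` of `πⱼ = -i ∂ⱼ + β aⱼ`, acting on a test function. -/
def momentumTranspose (β : ℝ) (j : Fin 3) (φ : Space → ℂ) (x : Space) : ℂ :=
  Complex.I * fderiv ℝ φ x (EuclideanSpace.single j 1) + (β * vectorPotential x j : ℝ) * φ x

/-- `πⱼ ψ = (-i ∂ⱼ + β aⱼ) ψ = g` in the sense of distributions. -/
def IsWeakMomentum (β : ℝ) (j : Fin 3) (ψ g : L2) : Prop :=
  ∀ φ : Space → ℂ, IsTestFunction φ →
    ∫ x, g x * φ x = ∫ x, ψ x * momentumTranspose β j φ x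

/-- `‖πⱼ ψ‖²`, which is `∞` if the distribution `πⱼ ψ` is not in `L²`. -/
def momentumSq (β : ℝ) (j : Fin 3) (ψ : L2) : ℝ≥0∞ :=
  ⨅ (g : L2) (_ : IsWeakMomentum β j ψ g), ‖g‖ₑ ^ 2

/-- The quadratic form `⟨ψ, H_β ψ⟩ = ‖(-i∇ + β a) ψ‖²` of `H_β = (-i∇ + β a)²`. -/
def magneticForm (β : ℝ) (ψ : L2) : ℝ≥0∞ := ∑ j, momentumSq β j ψ

/-- The magnetic-kinetic energy `Tr[H_β Γ] = ∑ᵢ ⟨ψᵢ, H_β ψᵢ⟩`, `Γ = ∑ᵢ |ψᵢ⟩⟨ψᵢ|`. -/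
def magneticKinetic (β : ℝ) (Γ : L2 →L[ℂ] L2) : ℝ≥0∞ := ∑' i, magneticForm β (orbital Γ i)

/-! ### The magnetic Hartree functional -/

/-- The domain of the functional: density matrices with finite magnetic-kinetic energy. -/
structure IsAdmissible (β : ℝ) (Γ : L2 →L[ℂ] L2) : Prop where
  densityMatrix : IsDensityMatrix Γ
  finiteKinetic : magneticKinetic β Γ < ∞

/-- The attraction `∫ ρ(x) / |x| dx`. -/
def attraction (ρ : Space → ℝ≥0∞) : ℝ≥0∞ := ∫⁻ x, ρ x * ‖x‖ₑ⁻¹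

/-- The repulsion `D[ρ, ρ] = (1/2) ∫∫ ρ(x) ρ(y) / |x - y| dx dy`. -/
def repulsion (ρ : Space → ℝ≥0∞) : ℝ≥0∞ :=
  2⁻¹ * ∫⁻ x, ∫⁻ y, ρ x * ρ y * ‖x - y‖ₑ⁻¹

/-- The magnetic Hartree functional
`Tr[(H_β - β) Γ] - ∫ ρ_Γ(x) / |x| dx + D[ρ_Γ, ρ_Γ]`; for `β > 0` all of its terms are finite on
its domain `IsAdmissible β`. -/
def energy (β : ℝ) (Γ : L2 →L[ℂ] L2) : ℝ :=
  ((magneticKinetic β Γ).toReal - β * (trace Γ).re)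
    - (attraction (density Γ)).toReal + (repulsion (density Γ)).toReal

/-- The Hartree energy `E^MH(lam, β)`. -/
def hartreeEnergy (lam β : ℝ) : ℝ :=
  sInf {e | ∃ Γ, IsAdmissible β Γ ∧ trace Γ = (lam : ℂ) ∧ energy β Γ = e}

/-- `Γ` minimizes the Hartree functional under the constraint `Tr[Γ] ≤ lam`. -/
structure IsHartreeMinimizer (lam β : ℝ) (Γ : L2 →L[ℂ] L2) : Prop where
  admissible : IsAdmissible β Γ
  trace_le : (trace Γ).re ≤ lam
  energy_eq : energy β Γ = hartreeEnergy lam β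

/-! ### The lowest Landau band -/

/-- The transpose of `π₀ - i π₁`, acting on a test function. -/
def landauTranspose (β : ℝ) (φ : Space → ℂ) (x : Space) : ℂ :=
  momentumTranspose β 0 φ x - Complex.I * momentumTranspose β 1 φ x

theorem landauTranspose_memLp (β : ℝ) {φ : Space → ℂ} (hφ : IsTestFunction φ) :
    MemLp (landauTranspose β φ) 2 (volume : Measure Space) := by
  obtain ⟨h1, h2⟩ := hφ
  have hd : Continuous (fderiv ℝ φ) := h1.continuous_fderiv (by simp)
  have hc : Continuous φ := h1.continuous
  refine Continuous.memLp_of_hasCompactSupport ?_ ?_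
  · unfold landauTranspose momentumTranspose vectorPotential
    simp only [Matrix.cons_val_zero, Matrix.cons_val_one]
    fun_prop
  · refine h2.mono' ?_
    intro x hx
    by_contra hx'
    apply hx
    have e1 : φ x = 0 := image_eq_zero_of_notMem_tsupport hx'
    have e2 : fderiv ℝ φ x = 0 := by
      by_contra h
      exact hx' (support_fderiv_subset ℝ h)
    simp [landauTranspose, momentumTranspose, e1, e2]

theorem integral_landauTranspose (β : ℝ) {φ : Space → ℂ} (hφ : IsTestFunction φ) (ψ : L2) :
    ∫ x, ψ x * landauTranspose β φ x
      = ⟪(landauTranspose_memLp β hφ).star.toLp _, ψ⟫_ℂ := by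
  rw [L2.inner_def]
  refine integral_congr_ae ?_
  filter_upwards [(landauTranspose_memLp β hφ).star.coeFn_toLp] with x hx
  rw [hx]
  simp

/-- The lowest Landau band: the functions `ψ ∈ L²(ℝ³)` with `(π₀ - i π₁) ψ = 0` in the sense of
distributions. Since `[π₀, π₁] = -i β` and hence `π₀² + π₁² - β = (π₀ + i π₁) (π₀ - i π₁)`, this
is, for `β > 0`, the eigenspace of the perpendicular part `π₀² + π₁²` of `H_β` to its lowest
eigenvalue `β`. -/
def lowestLandauBand (β : ℝ) : Submodule ℂ L2 where
  carrier := {ψ | ∀ φ : Space → ℂ, IsTestFunction φ → ∫ x, ψ x * landauTranspose β φ x = 0}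
  zero_mem' := fun φ hφ => by
    rw [integral_landauTranspose β hφ, inner_zero_right]
  add_mem' := fun {a b} ha hb φ hφ => by
    have h1 := ha φ hφ
    have h2 := hb φ hφ
    rw [integral_landauTranspose β hφ] at h1 h2 ⊢
    rw [inner_add_right, h1, h2, add_zero]
  smul_mem' := fun c a ha φ hφ => by
    have h1 := ha φ hφ
    rw [integral_landauTranspose β hφ] at h1 ⊢
    rw [inner_smul_right, h1, mul_zero]

theorem isClosed_lowestLandauBand (β : ℝ) : IsClosed (lowestLandauBand β : Set L2) := by
  have h : (lowestLandauBand β : Set L2) = ⋂ (φ : Space → ℂ) (hφ : IsTestFunction φ),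
      {ψ : L2 | ⟪(landauTranspose_memLp β hφ).star.toLp _, ψ⟫_ℂ = 0} := by
    ext ψ
    simp only [Set.mem_iInter, Set.mem_ofPred_eq]
    exact forall₂_congr fun φ hφ => by rw [← integral_landauTranspose β hφ]
  rw [h]
  exact isClosed_iInter fun φ => isClosed_iInter fun hφ =>
    isClosed_eq (by fun_prop) continuous_const

instance (β : ℝ) : CompleteSpace (lowestLandauBand β) :=
  (isClosed_lowestLandauBand β).completeSpace_coe

/-- The orthogonal projection `Π₀` onto the lowest Landau band. -/
def projLow (β : ℝ) : L2 →L[ℂ] L2 := (lowestLandauBand β).starProjection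

/-- The projection `Π_> = 1 - Π₀` onto the higher Landau bands. -/
def projHigh (β : ℝ) : L2 →L[ℂ] L2 := ContinuousLinearMap.id ℂ L2 - projLow β

/-- The confined Hartree energy: the infimum of the Hartree functional at `Π₀ Γ Π₀` over all `Γ`
in its domain with `Tr[Π₀ Γ] ≤ lam`. -/
def confinedEnergy (lam β : ℝ) : ℝ :=
  sInf {e | ∃ Γ, IsAdmissible β Γ ∧ (trace (projLow β ∘L Γ)).re ≤ lam ∧
    energy β (projLow β ∘L Γ ∘L projLow β) = e}

end MagneticHartree

end

/-! Every density matrix is written as `Γ = T T*` with a Hilbert–Schmidt `T`, and all energies are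
computed from the vectors `T eᵢ`. The result does not depend on `T` (`kinetic_eq`,
`frameDensity_ae_eq`), so `Π₀ Γ Π₀` may be treated through `Π₀ T` without taking its square root.

Write `T = S + R` with `S = Π₀ T` and `R = Π_> T`, and let `δ = β^(-1/2)`. The kinetic energy splits
without cross terms, and above the lowest band it is at least `3β` per unit mass
(`magneticForm_eq_projLow_add_projHigh`, `le_magneticForm_projHigh`). The Coulomb potential with any
centre is form bounded by `δ H_β + δ⁻¹` (`lintegral_coulomb_le`). Hence the potential generated by
the density of `R` is everywhere at most a constant times `δ K(R)`, where `K` is the kinetic energy.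
The pointwise inequality `|u + v|² ≤ (1 + ε)|u|² + (1 + ε⁻¹)|v|²` with `ε ~ (1 + λ) δ` then removes
`R` from both Coulomb terms. Its cost is a fraction of `K(R)`, which the surplus `K(R) - β M(R) ≥
(2/3) K(R)` pays, where `M` is the mass. What remains is the confined energy of `S` with the
attraction multiplied by `1 + ε` and the repulsion by `1 - 2ε` (`le_frameEnergy`).

The error `ε (A + 2D)`, with `A` the attraction and `D` the repulsion of `S`, must be a multiple of
`-E_conf`. If the energy is negative, the parallel kinetic energy and `D` are bounded by `A`.
Dilating `S` along the field and lowering its mass keeps it in the band and favours the attraction,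
so that `A ≤ -200 E_conf` (`attraction_le_confinedEnergy`). Together with `E ≤ 0`, obtained by
spreading a state of the band along the field (`hartreeEnergy_nonpos`), this gives (i).

For (ii) only `E ≤ 0` is used: the kinetic energy in excess of `β M` is at least `2β M(R)`, is at
most the attraction, and the form bound makes the attraction `O(λ β^(1/2))` (`mass_projHigh_le`). -/

noncomputable section

namespace MagneticHartree

open scoped ComplexConjugate

/-! ### Sums of squares over orthonormal bases -/

section HilbertSchmidt

variable {H K : Type*} [NormedAddCommGroup H] [InnerProductSpace ℂ H] [CompleteSpace H]
  [NormedAddCommGroup K] [InnerProductSpace ℂ K] [CompleteSpace K] {ι κ : Type*}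

theorem enorm_sq_eq_ofReal {E : Type*} [SeminormedAddCommGroup E] (x : E) :
    ‖x‖ₑ ^ 2 = ENNReal.ofReal (‖x‖ ^ 2) := by
  rw [← ofReal_norm, ENNReal.ofReal_pow (norm_nonneg _)]

omit [CompleteSpace H] in
theorem enorm_inner_symm (x y : H) : ‖⟪x, y⟫_ℂ‖ₑ = ‖⟪y, x⟫_ℂ‖ₑ := by
  rw [← ofReal_norm, norm_inner_symm, ofReal_norm]

omit [CompleteSpace H] in
theorem HilbertBasis.hasSum_norm_inner_sq (b : HilbertBasis ι ℂ H) (x : H) :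
    HasSum (fun i => ‖⟪b i, x⟫_ℂ‖ ^ 2) (‖x‖ ^ 2) := by
  have h := (b.hasSum_inner_mul_inner x x).mapL Complex.reCLM
  simp only [Complex.reCLM_apply] at h
  rw [← RCLike.re_eq_complex_re, ← norm_sq_eq_re_inner] at h
  convert h using 1
  ext i
  rw [← inner_conj_symm x (b i), RCLike.re_eq_complex_re, ← Complex.normSq_eq_conj_mul_self,
    Complex.ofReal_re, Complex.normSq_eq_norm_sq]

omit [CompleteSpace H] in
theorem HilbertBasis.tsum_enorm_inner_sq (b : HilbertBasis ι ℂ H) (x : H) :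
    ∑' i, ‖⟪b i, x⟫_ℂ‖ₑ ^ 2 = ‖x‖ₑ ^ 2 := by
  simp_rw [enorm_sq_eq_ofReal]
  rw [← ENNReal.ofReal_tsum_of_nonneg (fun _ => by positivity)
    (HilbertBasis.hasSum_norm_inner_sq b x).summable, (HilbertBasis.hasSum_norm_inner_sq b x).tsum_eq]

omit [CompleteSpace H] in
theorem Orthonormal.tsum_enorm_inner_sq_le {v : ι → H} (hv : Orthonormal ℂ v) (x : H) :
    ∑' i, ‖⟪v i, x⟫_ℂ‖ₑ ^ 2 ≤ ‖x‖ₑ ^ 2 := by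
  simp_rw [enorm_sq_eq_ofReal]
  rw [← ENNReal.ofReal_tsum_of_nonneg (fun _ => by positivity) (hv.inner_products_summable x)]
  exact ENNReal.ofReal_le_ofReal (hv.tsum_inner_products_le x)

/-- Parseval in the second basis, Tonelli, and Parseval in the first. All invariance statements for
traces and kinetic energies reduce to this exchange of sums. -/
theorem tsum_enorm_sq_adjoint (b : HilbertBasis ι ℂ H) (c : HilbertBasis κ ℂ K) (T : H →L[ℂ] K) :
    ∑' k, ‖T.adjoint (c k)‖ₑ ^ 2 = ∑' i, ‖T (b i)‖ₑ ^ 2 := by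
  calc ∑' k, ‖T.adjoint (c k)‖ₑ ^ 2 = ∑' k, ∑' i, ‖⟪b i, T.adjoint (c k)⟫_ℂ‖ₑ ^ 2 := by
        simp_rw [HilbertBasis.tsum_enorm_inner_sq b]
    _ = ∑' i, ∑' k, ‖⟪b i, T.adjoint (c k)⟫_ℂ‖ₑ ^ 2 := ENNReal.tsum_comm
    _ = ∑' i, ∑' k, ‖⟪c k, T (b i)⟫_ℂ‖ₑ ^ 2 := by
        refine tsum_congr fun i => tsum_congr fun k => ?_
        rw [ContinuousLinearMap.adjoint_inner_right, enorm_inner_symm]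
    _ = _ := by simp_rw [HilbertBasis.tsum_enorm_inner_sq c]

theorem enorm_sq_adjoint_eq_of_mul_adjoint_eq {S T : H →L[ℂ] H}
    (h : S ∘L S.adjoint = T ∘L T.adjoint) (x : H) :
    ‖S.adjoint x‖ₑ ^ 2 = ‖T.adjoint x‖ₑ ^ 2 := by
  have key : ∀ R : H →L[ℂ] H, ((‖R.adjoint x‖ ^ 2 : ℝ) : ℂ) = ⟪x, (R ∘L R.adjoint) x⟫_ℂ := by
    intro R
    rw [ContinuousLinearMap.comp_apply, ← ContinuousLinearMap.adjoint_inner_left,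
      inner_self_eq_norm_sq_to_K]
    simp
  have := (key S).trans ((congrArg (fun R : H →L[ℂ] H => ⟪x, R x⟫_ℂ) h).trans (key T).symm)
  rw [enorm_sq_eq_ofReal, enorm_sq_eq_ofReal, Complex.ofReal_injective this]

/-- Sums of `‖M T eᵢ‖²` only depend on `T T*`. -/
theorem tsum_enorm_sq_comp_eq (b : HilbertBasis ι ℂ H) (M : H →L[ℂ] H) {S T : H →L[ℂ] H}
    (h : S ∘L S.adjoint = T ∘L T.adjoint) :
    ∑' i, ‖M (S (b i))‖ₑ ^ 2 = ∑' i, ‖M (T (b i))‖ₑ ^ 2 := by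
  have key : ∀ R : H →L[ℂ] H, ∑' i, ‖M (R (b i))‖ₑ ^ 2 = ∑' i, ‖R.adjoint (M.adjoint (b i))‖ₑ ^ 2 := by
    intro R
    have := tsum_enorm_sq_adjoint b b (M ∘L R)
    rw [ContinuousLinearMap.adjoint_comp] at this
    exact this.symm
  rw [key, key]
  exact tsum_congr fun i => enorm_sq_adjoint_eq_of_mul_adjoint_eq h _

/-- Both sums are Parseval expansions, of `‖S* w‖²` and `‖T* w‖²`. This is the form suited to
unbounded operators, whose quadratic form is a sum of squared functionals. -/
theorem tsum_enorm_sq_inner_eq (b : HilbertBasis ι ℂ H) (w : H) {S T : H →L[ℂ] H}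
    (h : S ∘L S.adjoint = T ∘L T.adjoint) :
    ∑' i, ‖⟪w, S (b i)⟫_ℂ‖ₑ ^ 2 = ∑' i, ‖⟪w, T (b i)⟫_ℂ‖ₑ ^ 2 := by
  have key : ∀ R : H →L[ℂ] H, ∑' i, ‖⟪w, R (b i)⟫_ℂ‖ₑ ^ 2 = ‖R.adjoint w‖ₑ ^ 2 := by
    intro R
    rw [← HilbertBasis.tsum_enorm_inner_sq b]
    refine tsum_congr fun i => ?_
    rw [ContinuousLinearMap.adjoint_inner_right, enorm_inner_symm]
  rw [key, key, enorm_sq_adjoint_eq_of_mul_adjoint_eq h]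

-- Distinct basis vectors have distance `√2`, so the balls of radius `1/2` around them are disjoint.
-- Countability lets almost everywhere statements hold for all `i` at once.
omit [CompleteSpace H] in
theorem HilbertBasis.countable [TopologicalSpace.SeparableSpace H] (b : HilbertBasis ι ℂ H) :
    Countable ι := by
  refine Pairwise.countable_of_isOpen_disjoint (s := fun i => Metric.ball (b i) (1 / 2)) ?_
    (fun i => Metric.isOpen_ball) (fun i => ⟨b i, by simp⟩)
  intro i j hij
  refine Metric.ball_disjoint_ball ?_
  have h : dist (b i) (b j) ^ 2 = 2 := by
    rw [dist_eq_norm, @norm_sub_sq ℂ, b.orthonormal.1 i, b.orthonormal.1 j, b.orthonormal.2 hij]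
    norm_num
  nlinarith [dist_nonneg (x := b i) (y := b j)]

/-- The squared norm of the adjoint of a densely or non-densely defined operator with graph `S`
is a sum of squares of bounded functionals. -/
theorem exists_tsum_enorm_inner_sq_eq_iInf [TopologicalSpace.SeparableSpace H]
    (S : Submodule ℂ (H × H)) (hS : ∀ p ∈ S, p.1 = 0 → p.2 = 0) :
    ∃ (s : Set H) (w : s → H), ∀ ψ : H,
      ⨅ (g : H) (_ : ∀ p ∈ S, ⟪p.1, g⟫_ℂ = ⟪p.2, ψ⟫_ℂ), ‖g‖ₑ ^ 2 = ∑' k, ‖⟪w k, ψ⟫_ℂ‖ₑ ^ 2 := by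
  classical
  obtain ⟨D, hDS, hDc, hD⟩ := TopologicalSpace.IsSeparable.exists_countable_dense_subset
    (TopologicalSpace.IsSeparable.of_separableSpace (S : Set (H × H)))
  -- Adding `0` makes the dense set nonempty, hence the range of a sequence.
  have hne : (insert (0 : H × H) D).Nonempty := ⟨0, by simp⟩
  obtain ⟨d, hd⟩ := (hDc.insert (0 : H × H)).exists_eq_range hne
  have hdS : ∀ n, d n ∈ S := fun n => by
    have : d n ∈ insert (0 : H × H) D := hd ▸ Set.mem_range_self n
    rcases this with h | h
    · rw [h]; exact S.zero_mem
    · exact hDS h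
  -- Gram–Schmidt preserves the algebraic span, so each `e n` stays in the domain of the operator
  -- with graph `S`, which an abstract orthonormal basis need not do.
  set e : ℕ → H := InnerProductSpace.gramSchmidtNormed ℂ fun n => (d n).1 with he
  have hspan : Submodule.span ℂ (Set.range e) = Submodule.span ℂ (Set.range fun n => (d n).1) :=
    (InnerProductSpace.span_gramSchmidtNormed_range _).trans
      (InnerProductSpace.span_gramSchmidt ℂ _)
  have hle : Submodule.span ℂ (Set.range e) ≤ S.map (LinearMap.fst ℂ H H) := by
    rw [hspan, Submodule.span_le]
    rintro _ ⟨n, rfl⟩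
    exact ⟨d n, hdS n, rfl⟩
  -- Linearly dependent entries produce zero vectors, which are discarded.
  set s : Set H := Set.range e \ {0}
  have horth : Orthonormal ℂ ((↑) : s → H) := by
    have h := InnerProductSpace.gramSchmidtNormed_orthonormal' (𝕜 := ℂ) fun n => (d n).1
    have := h.toSubtypeRange
    have hs : s = Set.range (fun i : {i | e i ≠ 0} => e i) := by
      ext x
      constructor
      · rintro ⟨⟨n, rfl⟩, hn⟩
        exact ⟨⟨n, hn⟩, rfl⟩
      · rintro ⟨⟨n, hn⟩, rfl⟩
        exact ⟨⟨n, rfl⟩, hn⟩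
    rw [hs]
    exact this
  have hex : ∀ x : s, ∃ v, ((x : H), v) ∈ S := by
    rintro ⟨x, hx, -⟩
    obtain ⟨p, hp, hp'⟩ := hle (Submodule.subset_span hx)
    refine ⟨p.2, ?_⟩
    have hpe : p = (x, p.2) := Prod.ext hp' rfl
    exact hpe ▸ hp
  -- `w k` is the image of the `k`-th basis vector. Any admissible `g` must have coefficient `⟪w k,
  -- ψ⟫` along it, so the identity is Parseval for the `g` of smallest norm.
  choose w hw using hex
  refine ⟨s, w, fun ψ => le_antisymm ?_ ?_⟩
  · by_cases htop : ∑' k, ‖⟪w k, ψ⟫_ℂ‖ₑ ^ 2 = ∞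
    · rw [htop]; exact le_top
    obtain ⟨W, b, hsW, hb⟩ := horth.exists_hilbertBasis_extension
    -- Zero coefficients outside `s` make `g` the solution of smallest norm.
    set c : W → ℂ := fun x => if h : (x : H) ∈ s then ⟪w ⟨x, h⟩, ψ⟫_ℂ else 0
    have hcs : ∑' x, ‖c x‖ₑ ^ 2 = ∑' k, ‖⟪w k, ψ⟫_ℂ‖ₑ ^ 2 := by
      have hinj : Function.Injective (Set.inclusion hsW) := Set.inclusion_injective hsW
      rw [← hinj.tsum_eq (f := fun x => ‖c x‖ₑ ^ 2)]
      · refine tsum_congr fun k => ?_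
        simp [c]
      · intro x hx
        by_cases h : (x : H) ∈ s
        · exact ⟨⟨x, h⟩, rfl⟩
        · simp [c, h] at hx
    have hsum : Summable fun x => ‖c x‖ ^ 2 := by
      rw [← hcs] at htop
      have := ENNReal.summable_toReal htop
      simpa using this
    have hmem : Memℓp c 2 := by
      rw [memℓp_gen_iff (by norm_num)]
      simpa using hsum
    set g : H := b.repr.symm ⟨c, hmem⟩
    have hinner : ∀ x : W, ⟪(x : H), g⟫_ℂ = c x := by
      intro x
      have h1 := b.repr_apply_apply g x
      rw [hb] at h1
      rw [← h1]
      simp [g]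
    have hnorm : ‖g‖ₑ ^ 2 = ∑' k, ‖⟪w k, ψ⟫_ℂ‖ₑ ^ 2 := by
      rw [← hcs, ← HilbertBasis.tsum_enorm_inner_sq b]
      refine tsum_congr fun x => ?_
      rw [hb, hinner]
    rw [← hnorm]
    refine iInf₂_le g ?_
    have h1 : ∀ u ∈ Submodule.span ℂ (Set.range e), ∃ v, (u, v) ∈ S ∧ ⟪u, g⟫_ℂ = ⟪v, ψ⟫_ℂ := by
      intro u hu
      induction hu using Submodule.span_induction with
      | mem x hx =>
        by_cases h0 : x = 0
        · exact ⟨0, by rw [h0]; exact S.zero_mem, by simp [h0]⟩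
        · refine ⟨w ⟨x, hx, h0⟩, hw ⟨x, hx, h0⟩, ?_⟩
          have := hinner ⟨x, hsW ⟨hx, h0⟩⟩
          rw [this]
          have hxs : x ∈ s := ⟨hx, h0⟩
          simp [c, hxs]
      | zero => exact ⟨0, S.zero_mem, by simp⟩
      | add x y _ _ hx hy =>
        obtain ⟨v, hv, hv'⟩ := hx
        obtain ⟨v', hv1, hv2⟩ := hy
        exact ⟨v + v', S.add_mem hv hv1, by rw [inner_add_left, inner_add_left, hv', hv2]⟩
      | smul a x _ hx =>
        obtain ⟨v, hv, hv'⟩ := hx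
        exact ⟨a • v, S.smul_mem a hv, by rw [inner_smul_left, inner_smul_left, hv']⟩
    -- The relation holds for some partner `v` of the first component. As `S` is a graph, `v` is the
    -- second component; the closed relation then passes from `D` to its closure.
    have h2 : D ⊆ {p : H × H | ⟪p.1, g⟫_ℂ = ⟪p.2, ψ⟫_ℂ} := by
      intro p hp
      have hpd : p ∈ insert (0 : H × H) D := Set.mem_insert_of_mem _ hp
      rw [hd] at hpd
      obtain ⟨n, rfl⟩ := hpd
      obtain ⟨v, hv, hv'⟩ := h1 (d n).1 (by rw [hspan]; exact Submodule.subset_span ⟨n, rfl⟩)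
      have := hS ((d n) - ((d n).1, v)) (S.sub_mem (hdS n) hv) (by simp)
      have hv3 : (d n).2 = v := sub_eq_zero.1 this
      simp only [Set.mem_ofPred_eq, hv', hv3]
    have hclosed : IsClosed {p : H × H | ⟪p.1, g⟫_ℂ = ⟪p.2, ψ⟫_ℂ} :=
      isClosed_eq (by fun_prop) (by fun_prop)
    intro p hp
    exact closure_minimal h2 hclosed (hD hp)
  -- Bessel's inequality gives the lower bound for every admissible `g`.
  · refine le_iInf₂ fun g hg => ?_
    refine le_trans (le_of_eq ?_) (Orthonormal.tsum_enorm_inner_sq_le horth g)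
    refine tsum_congr fun k => ?_
    rw [hg _ (hw k)]

end HilbertSchmidt

/-! ### Test functions -/

abbrev unitVec (j : Fin 3) : Space := EuclideanSpace.single j 1

/-- The components of the vector potential as continuous linear functionals. -/
def potential (j : Fin 3) : Space →L[ℝ] ℝ :=
  ![-(2⁻¹ : ℝ) • EuclideanSpace.proj 1, (2⁻¹ : ℝ) • EuclideanSpace.proj 0, 0] j

theorem vectorPotential_eq (x : Space) (j : Fin 3) : vectorPotential x j = potential j x := by
  fin_cases j <;> simp [vectorPotential, potential] <;> ring

/-- `πⱼ f = -i ∂ⱼ f + β aⱼ f`. -/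
def momentumFun (β : ℝ) (j : Fin 3) (f : Space → ℂ) (x : Space) : ℂ :=
  -Complex.I * fderiv ℝ f x (unitVec j) + (β * potential j x : ℝ) * f x

theorem fderiv_conj_apply (f : Space → ℂ) (x v : Space) :
    fderiv ℝ (fun y => conj (f y)) x v = conj (fderiv ℝ f x v) := by
  have h : (fun y => conj (f y)) = Complex.conjCLE ∘ f := by ext; simp
  rw [h, ContinuousLinearEquiv.comp_fderiv]
  simp

/-- The distributional definitions pair with `∫ ψ φ`, without conjugation. Conjugating the test
function turns transposes into `πⱼ` itself, so weak identities become relations between inner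
products. -/
theorem momentumTranspose_conj (β : ℝ) (j : Fin 3) (f : Space → ℂ) (x : Space) :
    momentumTranspose β j (fun y => conj (f y)) x = conj (momentumFun β j f x) := by
  simp only [momentumTranspose, momentumFun, fderiv_conj_apply, vectorPotential_eq, map_add,
    map_mul, map_neg, Complex.conj_I, Complex.conj_ofReal, neg_neg]

theorem landauTranspose_conj (β : ℝ) (f : Space → ℂ) (x : Space) :
    landauTranspose β (fun y => conj (f y)) x
      = conj (momentumFun β 0 f x + Complex.I * momentumFun β 1 f x) := by
  simp only [landauTranspose, momentumTranspose_conj, map_add, map_mul, Complex.conj_I]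
  ring

theorem IsTestFunction.conj {f : Space → ℂ} (hf : IsTestFunction f) :
    IsTestFunction fun y => conj (f y) := by
  refine ⟨Complex.conjCLE.contDiff.comp hf.1, ?_⟩
  exact hf.2.comp_left (g := fun z : ℂ => conj z) (by simp)

theorem IsTestFunction.memLp {f : Space → ℂ} (hf : IsTestFunction f) :
    MemLp f 2 (volume : Measure Space) :=
  hf.1.continuous.memLp_of_hasCompactSupport hf.2

theorem IsTestFunction.differentiable {f : Space → ℂ} (hf : IsTestFunction f) :
    Differentiable ℝ f := hf.1.differentiable (by simp)

/-- The space of test functions. -/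
def testFunctions : Submodule ℂ (Space → ℂ) where
  carrier := {f | IsTestFunction f}
  zero_mem' := ⟨contDiff_const, HasCompactSupport.zero⟩
  add_mem' := fun ha hb => ⟨ha.1.add hb.1, ha.2.add hb.2⟩
  smul_mem' := fun _ _ ha => ⟨contDiff_const.smul ha.1, ha.2.smul_left⟩

instance : CoeFun testFunctions fun _ => Space → ℂ := ⟨Subtype.val⟩

/-- The inclusion of the test functions into `L²`. -/
def toL2 : testFunctions →ₗ[ℂ] L2 where
  toFun f := (f.2.memLp).toLp f
  map_add' _ _ := rfl
  map_smul' _ _ := rfl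

theorem coeFn_toL2 (f : testFunctions) : toL2 f =ᵐ[volume] f := f.2.memLp.coeFn_toLp

theorem inner_toL2_left (f : testFunctions) (ψ : L2) :
    ⟪toL2 f, ψ⟫_ℂ = ∫ x, ψ x * conj (f x) := by
  rw [L2.inner_def]
  refine integral_congr_ae ?_
  filter_upwards [coeFn_toL2 f] with x hx
  rw [hx]
  rfl

theorem norm_toL2_sq (f : testFunctions) : ‖toL2 f‖ ^ 2 = ∫ x, ‖f x‖ ^ 2 := by
  have h : ((‖toL2 f‖ ^ 2 : ℝ) : ℂ) = ((∫ x, ‖f x‖ ^ 2 : ℝ) : ℂ) := by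
    rw [Complex.ofReal_pow, ← Complex.coe_algebraMap, ← inner_self_eq_norm_sq_to_K (𝕜 := ℂ),
      inner_toL2_left, Complex.coe_algebraMap, ← integral_complex_ofReal]
    refine integral_congr_ae ?_
    filter_upwards [coeFn_toL2 f] with x hx
    rw [hx, Complex.mul_conj, Complex.normSq_eq_norm_sq]
  exact_mod_cast h

theorem isTestFunction_momentumFun (β : ℝ) (j : Fin 3) {f : Space → ℂ} (hf : IsTestFunction f) :
    IsTestFunction (momentumFun β j f) := by
  constructor
  · have h1 : ContDiff ℝ (⊤ : ℕ∞) fun x => fderiv ℝ f x (unitVec j) :=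
      (hf.1.fderiv_right (m := (⊤ : ℕ∞)) (by simp)).clm_apply contDiff_const
    have h2 : ContDiff ℝ (⊤ : ℕ∞) fun x => ((β * potential j x : ℝ) : ℂ) :=
      Complex.ofRealCLM.contDiff.comp (contDiff_const.mul (potential j).contDiff)
    exact (contDiff_const.mul h1).add (h2.mul hf.1)
  · refine HasCompactSupport.add ?_ hf.2.mul_left
    exact (hf.2.fderiv_apply (𝕜 := ℝ) (unitVec j)).mul_left

theorem momentumFun_add (β : ℝ) (j : Fin 3) {f g : Space → ℂ} {x : Space}
    (hf : DifferentiableAt ℝ f x) (hg : DifferentiableAt ℝ g x) :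
    momentumFun β j (f + g) x = momentumFun β j f x + momentumFun β j g x := by
  simp only [momentumFun, fderiv_add hf hg, Pi.add_apply, add_apply]
  ring

theorem momentumFun_smul (β : ℝ) (j : Fin 3) (c : ℂ) {f : Space → ℂ} {x : Space}
    (hf : DifferentiableAt ℝ f x) :
    momentumFun β j (c • f) x = c * momentumFun β j f x := by
  simp only [momentumFun, fderiv_const_smul hf, Pi.smul_apply, smul_apply, smul_eq_mul]
  ring

/-- `πⱼ` as an operator on test functions. -/
def momentum (β : ℝ) (j : Fin 3) : testFunctions →ₗ[ℂ] testFunctions where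
  toFun f := ⟨momentumFun β j f, isTestFunction_momentumFun β j f.2⟩
  map_add' f g := Subtype.ext <| funext fun x =>
    momentumFun_add β j (f.2.differentiable x) (g.2.differentiable x)
  map_smul' c f := Subtype.ext <| funext fun x =>
    momentumFun_smul β j c (f.2.differentiable x)

theorem momentum_apply (β : ℝ) (j : Fin 3) (f : testFunctions) (x : Space) :
    momentum β j f x = momentumFun β j f x := rfl

theorem dense_range_toL2 : DenseRange toL2 := by
  have h : (LinearMap.range toL2).topologicalClosure = ⊤ := by
    rw [Submodule.topologicalClosure_eq_top_iff, Submodule.eq_bot_iff]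
    intro ψ hψ
    have h0 : ∀ᵐ x, ψ x = 0 := by
      refine ae_eq_zero_of_integral_contDiff_smul_eq_zero
        ((Lp.memLp ψ).locallyIntegrable (by norm_num)) fun g hg hgc => ?_
      have ht : IsTestFunction fun x => (g x : ℂ) :=
        ⟨Complex.ofRealCLM.contDiff.comp hg, hgc.comp_left (g := fun z : ℝ => (z : ℂ)) (by simp)⟩
      have := (Submodule.mem_orthogonal _ _).1 hψ _ ⟨⟨_, ht⟩, rfl⟩
      rw [inner_toL2_left] at this
      rw [← this]
      refine integral_congr_ae (Filter.Eventually.of_forall fun x => ?_)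
      simp [mul_comm]
    exact (Lp.eq_zero_iff_ae_eq_zero).2 h0
  intro ψ
  have : ψ ∈ (LinearMap.range toL2).topologicalClosure := h ▸ Submodule.mem_top
  exact this

theorem eq_of_forall_inner_toL2 {ψ φ : L2} (h : ∀ f, ⟪toL2 f, ψ⟫_ℂ = ⟪toL2 f, φ⟫_ℂ) : ψ = φ :=
  dense_range_toL2.eq_of_inner_right ℂ h

/-- Duality against a dense set. Approximation errors are estimated below only after pairing with
test functions. -/
theorem norm_le_of_forall_inner_toL2 {ψ : L2} {C : ℝ} (hC : 0 ≤ C)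
    (h : ∀ f, ‖⟪toL2 f, ψ⟫_ℂ‖ ≤ C * ‖toL2 f‖) : ‖ψ‖ ≤ C := by
  have h1 : ∀ φ : L2, ‖⟪φ, ψ⟫_ℂ‖ ≤ C * ‖φ‖ := fun φ =>
    dense_range_toL2.induction_on φ (isClosed_le (by fun_prop) (by fun_prop)) h
  have h2 := h1 ψ
  rw [inner_self_eq_norm_sq_to_K] at h2
  simp only [norm_pow, RCLike.norm_ofReal, abs_norm] at h2
  by_contra! hlt
  nlinarith [norm_nonneg ψ]

/-! ### Weak operators as relations between inner products -/

theorem isWeakMomentum_iff {β : ℝ} {j : Fin 3} {ψ g : L2} :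
    IsWeakMomentum β j ψ g ↔ ∀ f, ⟪toL2 f, g⟫_ℂ = ⟪toL2 (momentum β j f), ψ⟫_ℂ := by
  simp_rw [inner_toL2_left, momentum_apply]
  constructor
  · intro h f
    rw [h _ f.2.conj]
    simp_rw [momentumTranspose_conj]
  · intro h φ hφ
    have := h ⟨_, hφ.conj⟩
    simp_rw [← momentumTranspose_conj, Complex.conj_conj] at this
    exact this

/-- The annihilation operator `π₀ - i π₁`. -/
def lowering (β : ℝ) : testFunctions →ₗ[ℂ] testFunctions :=
  momentum β 0 - Complex.I • momentum β 1

/-- The creation operator `π₀ + i π₁`. -/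
def raising (β : ℝ) : testFunctions →ₗ[ℂ] testFunctions :=
  momentum β 0 + Complex.I • momentum β 1

theorem mem_lowestLandauBand_iff {β : ℝ} {ψ : L2} :
    ψ ∈ lowestLandauBand β ↔ ∀ f, ⟪toL2 (raising β f), ψ⟫_ℂ = 0 := by
  change (∀ φ : Space → ℂ, IsTestFunction φ → ∫ x, ψ x * landauTranspose β φ x = 0) ↔ _
  have key : ∀ f : testFunctions, ⟪toL2 (raising β f), ψ⟫_ℂ
      = ∫ x, ψ x * landauTranspose β (fun y => conj (f y)) x := by
    intro f
    simp_rw [inner_toL2_left, landauTranspose_conj]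
    rfl
  simp_rw [key]
  constructor
  · intro h f
    exact h _ f.2.conj
  · intro h φ hφ
    simpa using h ⟨_, hφ.conj⟩

/-! ### Symmetry and commutation relations -/

theorem integral_fderiv_eq_zero {𝕜 : Type*} [RCLike 𝕜] {F : Space → 𝕜} (h1 : ContDiff ℝ 1 F) (h2 : HasCompactSupport F)
    (v : Space) : ∫ x, fderiv ℝ F x v = 0 := by
  have hc : Continuous fun x => fderiv ℝ F x v :=
    (h1.continuous_fderiv (by simp)).clm_apply continuous_const
  have hi : Integrable fun x => fderiv ℝ F x v :=
    hc.integrable_of_hasCompactSupport (h2.fderiv_apply (𝕜 := ℝ) v)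
  have hF : Integrable F := h1.continuous.integrable_of_hasCompactSupport h2
  have := integral_mul_fderiv_eq_neg_fderiv_mul_of_integrable (μ := (volume : Measure Space))
    (f := fun _ => (1 : 𝕜)) (g := F) (v := v) (by simp) (by simpa using hi) (by simpa using hF)
    (fun _ _ => by fun_prop) (fun x _ => h1.differentiable (by simp) x)
  simpa using this

/-- Integrate the derivative of `g · conj f`; the potential is real and drops out. Only `f` has
compact support, so that the Gaussian is allowed as `g`. -/
theorem integral_conj_momentumFun (β : ℝ) (j : Fin 3) {f g : Space → ℂ} (hf : IsTestFunction f)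
    (hg : ContDiff ℝ 1 g) :
    ∫ x, g x * conj (momentumFun β j f x) = ∫ x, momentumFun β j g x * conj (f x) := by
  have hf1 : ContDiff ℝ 1 f := hf.1.of_le (by exact_mod_cast le_top)
  have hfc : ContDiff ℝ 1 fun x => conj (f x) := hf.conj.1.of_le (by exact_mod_cast le_top)
  have hF : ContDiff ℝ 1 fun x => g x * conj (f x) := hg.mul hfc
  have hFs : HasCompactSupport fun x => g x * conj (f x) := hf.conj.2.mul_left
  have h0 := integral_fderiv_eq_zero hF hFs (unitVec j)
  have hd : ∀ x, fderiv ℝ (fun x => g x * conj (f x)) x (unitVec j)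
      = Complex.I * (momentumFun β j g x * conj (f x) - g x * conj (momentumFun β j f x)) := by
    intro x
    rw [fderiv_fun_mul (hg.differentiable (by simp) x) (hfc.differentiable (by simp) x)]
    simp only [add_apply, smul_apply, smul_eq_mul, fderiv_conj_apply, momentumFun, map_add, map_mul,
      map_neg, Complex.conj_I, Complex.conj_ofReal]
    linear_combination (g x * conj (fderiv ℝ f x (unitVec j))
      + fderiv ℝ g x (unitVec j) * conj (f x)) * Complex.I_mul_I
  simp_rw [hd] at h0
  have hi1 : Integrable fun x => momentumFun β j g x * conj (f x) := by
    refine Continuous.integrable_of_hasCompactSupport ?_ hf.conj.2.mul_left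
    have := hg.continuous_fderiv (by simp)
    have h3 := hf.conj.1.continuous
    have h4 := hg.continuous
    unfold momentumFun
    fun_prop
  have hi2 : Integrable fun x => g x * conj (momentumFun β j f x) := by
    have ht := (isTestFunction_momentumFun β j hf).conj
    exact (hg.continuous.mul ht.1.continuous).integrable_of_hasCompactSupport ht.2.mul_left
  rw [integral_const_mul, integral_sub hi1 hi2] at h0
  have := (mul_eq_zero.1 h0).resolve_left Complex.I_ne_zero
  exact (sub_eq_zero.1 this).symm

theorem inner_momentum (β : ℝ) (j : Fin 3) (f g : testFunctions) :
    ⟪toL2 (momentum β j f), toL2 g⟫_ℂ = ⟪toL2 f, toL2 (momentum β j g)⟫_ℂ := by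
  have h : ∀ f g : testFunctions, ⟪toL2 f, toL2 g⟫_ℂ = ∫ x, g x * conj (f x) := by
    intro f g
    rw [inner_toL2_left]
    refine integral_congr_ae ?_
    filter_upwards [coeFn_toL2 g] with x hx
    rw [hx]
  rw [h, h]
  exact integral_conj_momentumFun β j f.2 (g.2.1.of_le (by exact_mod_cast le_top))

theorem two_le_smoothness : (2 : WithTop ℕ∞) ≤ ((⊤ : ℕ∞) : WithTop ℕ∞) := by
  exact WithTop.coe_le_coe.2 le_top

/-- Second derivatives cancel by symmetry, and what is left is `-iβ` times the curl `∂₀a₁ - ∂₁a₀ =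
1/2 + 1/2`. -/
theorem momentum_comm (β : ℝ) (f : testFunctions) :
    momentum β 0 (momentum β 1 f) - momentum β 1 (momentum β 0 f) = (-Complex.I * β) • f := by
  refine Subtype.ext (funext fun x => ?_)
  change momentumFun β 0 (momentumFun β 1 f) x - momentumFun β 1 (momentumFun β 0 f) x
    = (-Complex.I * β) * f x
  have hd : ∀ (j k : Fin 3), fderiv ℝ (momentumFun β j f) x (unitVec k)
      = -Complex.I * fderiv ℝ (fderiv ℝ f) x (unitVec k) (unitVec j)
        + ((β * potential j (unitVec k) : ℝ) * f x
          + (β * potential j x : ℝ) * fderiv ℝ f x (unitVec k)) := by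
    intro j k
    have h1 : HasFDerivAt (fderiv ℝ f) (fderiv ℝ (fderiv ℝ f) x) x :=
      ((f.2.1.fderiv_right (m := 1) (by simpa [one_add_one_eq_two] using two_le_smoothness)).differentiable (by simp) x).hasFDerivAt
    have h2 : HasFDerivAt (fun y => fderiv ℝ f y (unitVec j))
      ((fderiv ℝ (fderiv ℝ f) x).flip (unitVec j)) x := by
      simpa using h1.clm_apply (hasFDerivAt_const (unitVec j) x)
    have h3 : HasFDerivAt (fun y => ((β * potential j y : ℝ) : ℂ))
        (Complex.ofRealCLM.comp (β • potential j)) x :=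
      (Complex.ofRealCLM.comp (β • potential j)).hasFDerivAt
    have h4 := (h2.const_mul (-Complex.I)).add
      (h3.mul ((f.2.differentiable x).hasFDerivAt))
    have h5 : HasFDerivAt (momentumFun β j f) _ x := h4
    rw [h5.fderiv]
    simp
    ring
  have hs : fderiv ℝ (fderiv ℝ f) x (unitVec 0) (unitVec 1)
      = fderiv ℝ (fderiv ℝ f) x (unitVec 1) (unitVec 0) := by
    have : IsSymmSndFDerivAt ℝ f x :=
      (f.2.1.contDiffAt).isSymmSndFDerivAt (by simpa [one_add_one_eq_two] using two_le_smoothness)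
    exact this.eq _ _
  have e0 : potential 0 (unitVec 1) = -2⁻¹ := by simp [potential]
  have e1 : potential 1 (unitVec 0) = 2⁻¹ := by simp [potential]
  have hm : ∀ (j : Fin 3) (g : Space → ℂ), momentumFun β j g x
      = -Complex.I * fderiv ℝ g x (unitVec j) + (β * potential j x : ℝ) * g x := fun _ _ => rfl
  rw [hm 0 (momentumFun β 1 f), hm 1 (momentumFun β 0 f), hd, hd, hs, e0, e1, hm, hm]
  push_cast
  linear_combination

/-- Expand `‖π₀f ∓ iπ₁f‖²`; by the commutator the cross term is `∓β‖f‖²` or its opposite. The first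
identity contains the lowest level `β`, the second the gap `2β`. -/
theorem norm_momentum_sq_add (β : ℝ) (f : testFunctions) :
    ‖toL2 (momentum β 0 f)‖ ^ 2 + ‖toL2 (momentum β 1 f)‖ ^ 2
      = ‖toL2 (lowering β f)‖ ^ 2 + β * ‖toL2 f‖ ^ 2 ∧
    ‖toL2 (raising β f)‖ ^ 2 = ‖toL2 (lowering β f)‖ ^ 2 + 2 * β * ‖toL2 f‖ ^ 2 := by
  have hl : toL2 (lowering β f) = toL2 (momentum β 0 f) - Complex.I • toL2 (momentum β 1 f) := by
    simp [lowering]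
  have hr : toL2 (raising β f) = toL2 (momentum β 0 f) + Complex.I • toL2 (momentum β 1 f) := by
    simp [raising]
  have hi : ‖Complex.I • toL2 (momentum β 1 f)‖ = ‖toL2 (momentum β 1 f)‖ := by
    rw [norm_smul]; simp
  have hc : (2 * RCLike.re ⟪toL2 (momentum β 0 f), Complex.I • toL2 (momentum β 1 f)⟫_ℂ)
      = β * ‖toL2 f‖ ^ 2 := by
    have h1 : ⟪toL2 (momentum β 0 f), toL2 (momentum β 1 f)⟫_ℂ
        - ⟪toL2 (momentum β 1 f), toL2 (momentum β 0 f)⟫_ℂ = (-Complex.I * β) * ‖toL2 f‖ ^ 2 := by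
      rw [inner_momentum, inner_momentum, ← inner_sub_right, ← map_sub, momentum_comm, map_smul,
        inner_smul_right, inner_self_eq_norm_sq_to_K]
      simp
    rw [← inner_conj_symm (toL2 (momentum β 1 f)), Complex.sub_conj] at h1
    have h2 := congrArg Complex.im h1
    rw [inner_smul_right]
    simp [← Complex.ofReal_pow] at h2 ⊢
    linarith
  rw [hl, hr, @norm_sub_sq ℂ, @norm_add_sq ℂ, hi]
  constructor <;> linarith

/-! ### Multiplication operators and translations -/

theorem memLp_mul {b : Space → ℂ} (hb : Measurable b) {C : ℝ} (hC : ∀ x, ‖b x‖ ≤ C)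
    (ψ : L2) : MemLp (fun x => b x * ψ x) 2 (volume : Measure Space) := by
  refine (Lp.memLp ψ).of_le_mul (c := C)
    (hb.aestronglyMeasurable.mul (Lp.aestronglyMeasurable ψ)) ?_
  exact Filter.Eventually.of_forall fun x => by
    rw [norm_mul]
    gcongr
    exact hC x

/-- Multiplication by a bounded measurable function. -/
def mulL2 (b : Space → ℂ) (hb : Measurable b) (C : ℝ) (hC : ∀ x, ‖b x‖ ≤ C) : L2 →L[ℂ] L2 :=
  LinearMap.mkContinuous
    { toFun := fun ψ => (memLp_mul hb hC ψ).toLp _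
      map_add' := fun ψ φ => by
        refine Lp.ext ?_
        filter_upwards [MemLp.coeFn_toLp (memLp_mul hb hC (ψ + φ)),
          MemLp.coeFn_toLp (memLp_mul hb hC ψ), MemLp.coeFn_toLp (memLp_mul hb hC φ),
          Lp.coeFn_add ψ φ, Lp.coeFn_add ((memLp_mul hb hC ψ).toLp _)
            ((memLp_mul hb hC φ).toLp _)] with x h1 h2 h3 h4 h5
        rw [h1, h5, Pi.add_apply, h2, h3, h4, Pi.add_apply, mul_add]
      map_smul' := fun c ψ => by
        refine Lp.ext ?_
        filter_upwards [MemLp.coeFn_toLp (memLp_mul hb hC (c • ψ)),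
          MemLp.coeFn_toLp (memLp_mul hb hC ψ), Lp.coeFn_smul c ψ,
          Lp.coeFn_smul c ((memLp_mul hb hC ψ).toLp _)] with x h1 h2 h3 h4
        rw [h1, RingHom.id_apply, h4, Pi.smul_apply, h2, h3, Pi.smul_apply, smul_eq_mul,
          smul_eq_mul, mul_left_comm] }
    C fun ψ => by
      refine Lp.norm_le_mul_norm_of_ae_le_mul ?_
      filter_upwards [MemLp.coeFn_toLp (memLp_mul hb hC ψ)] with x hx
      change ‖((memLp_mul hb hC ψ).toLp _ : L2) x‖ ≤ _
      rw [hx, norm_mul]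
      gcongr
      exact hC x

theorem coeFn_mulL2 {b : Space → ℂ} (hb : Measurable b) {C : ℝ} (hC : ∀ x, ‖b x‖ ≤ C) (ψ : L2) :
    mulL2 b hb C hC ψ =ᵐ[volume] fun x => b x * ψ x :=
  (memLp_mul hb hC ψ).coeFn_toLp

theorem norm_mulL2_apply_le {b : Space → ℂ} (hb : Measurable b) {C : ℝ} (hC : ∀ x, ‖b x‖ ≤ C)
    (ψ : L2) : ‖mulL2 b hb C hC ψ‖ ≤ C * ‖ψ‖ := by
  refine Lp.norm_le_mul_norm_of_ae_le_mul ?_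
  filter_upwards [coeFn_mulL2 hb hC ψ] with x hx
  rw [hx, norm_mul]
  gcongr
  exact hC x

theorem inner_toL2_mulL2 {b : Space → ℂ} (hb : Measurable b) {C : ℝ} (hC : ∀ x, ‖b x‖ ≤ C)
    (f : testFunctions) (ψ : L2) :
    ⟪toL2 f, mulL2 b hb C hC ψ⟫_ℂ = ∫ x, b x * ψ x * conj (f x) := by
  rw [inner_toL2_left]
  refine integral_congr_ae ?_
  filter_upwards [coeFn_mulL2 hb hC ψ] with x hx
  rw [hx]

theorem integrable_mul_conj (f : testFunctions) (ψ : L2) :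
    Integrable fun x => ψ x * conj (f x) :=
  (Lp.memLp ψ).integrable_mul f.2.conj.memLp

/-- The translation `ψ ↦ ψ(· + s)`. -/
def translate (s : Space) : L2 →ₗᵢ[ℂ] L2 :=
  Lp.compMeasurePreservingₗᵢ ℂ (· + s) (measurePreserving_add_right volume s)

theorem coeFn_translate (s : Space) (ψ : L2) :
    translate s ψ =ᵐ[volume] fun x => ψ (x + s) :=
  Lp.coeFn_compMeasurePreserving ψ (measurePreserving_add_right volume s)

theorem continuous_translate (ψ : L2) : Continuous fun s => translate s ψ := by
  have := continuous_const (y := ψ) |>.compMeasurePreservingLp (X := Space)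
    (g := fun s : Space => (⟨(· + s), by fun_prop⟩ : C(Space, Space)))
    (ContinuousMap.continuous_of_continuous_uncurry _ (by
      simp only [Function.uncurry_def, ContinuousMap.coe_mk]; fun_prop))
    (fun s => measurePreserving_add_right volume s) (by norm_num)
  exact this

theorem translate_zero (ψ : L2) : translate 0 ψ = ψ := by
  refine Lp.ext ?_
  filter_upwards [coeFn_translate 0 ψ] with x hx
  rw [hx, add_zero]

/-- The translation `f ↦ f(· + s)` of a test function. -/
def shift (s : Space) : testFunctions →ₗ[ℂ] testFunctions where
  toFun f := ⟨fun x => f (x + s), f.2.1.comp (contDiff_id.add contDiff_const),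
    f.2.2.comp_homeomorph (Homeomorph.addRight s)⟩
  map_add' _ _ := rfl
  map_smul' _ _ := rfl

theorem inner_toL2_translate (f : testFunctions) (s : Space) (ψ : L2) :
    ⟪toL2 f, translate s ψ⟫_ℂ = ⟪toL2 (shift (-s) f), ψ⟫_ℂ := by
  rw [inner_toL2_left, inner_toL2_left,
    ← integral_add_right_eq_self (fun x => ψ x * conj (shift (-s) f x)) s]
  refine integral_congr_ae ?_
  filter_upwards [coeFn_translate s ψ] with x hx
  rw [hx]
  simp [shift]

theorem shift_momentum (β : ℝ) (j : Fin 3) (s : Space) (f : testFunctions) :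
    shift s (momentum β j f)
      = momentum β j (shift s f) + ((β * potential j s : ℝ) : ℂ) • shift s f := by
  refine Subtype.ext (funext fun x => ?_)
  change momentumFun β j f (x + s) = momentumFun β j (fun y => f (y + s)) x
    + ((β * potential j s : ℝ) : ℂ) * f (x + s)
  simp only [momentumFun, fderiv_comp_add_right, map_add]
  push_cast
  ring

/-! ### Mollification -/

/-- Take `m = φ * ψ` for a bump `φ` of radius `δ`. By associativity `⟪h, m⟫` is the `φ`-average near
`0` of `F(s) = ⟪h, ψ(· + s)⟫`, so it is as close to `F 0` as `F` is on that ball. One `m` serves all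
`h` and `ε`, which allows approximation in several graph norms at once. -/
theorem exists_mollification (ψ : L2) {R : ℝ} (hR : ∀ᵐ x, R ≤ ‖x‖ → ψ x = 0) {δ : ℝ} (hδ : 0 < δ) :
    ∃ m : testFunctions, ∀ (h : testFunctions) (ε : ℝ),
      (∀ s, ‖s‖ < δ → ‖⟪toL2 h, translate s ψ⟫_ℂ - ⟪toL2 h, ψ⟫_ℂ‖ ≤ ε) →
      ‖⟪toL2 h, toL2 m⟫_ℂ - ⟪toL2 h, ψ⟫_ℂ‖ ≤ ε := by
  -- A representative that vanishes outside a ball everywhere, as compact support of the convolution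
  -- requires.
  set ψ₀ : Space → ℂ := (Metric.closedBall (0 : Space) R).indicator ψ with hψ₀
  have hae : ψ₀ =ᵐ[volume] ψ := by
    filter_upwards [hR] with x hx
    by_cases h : x ∈ Metric.closedBall (0 : Space) R
    · simp [hψ₀, h]
    · rw [hψ₀, Set.indicator_of_notMem h, hx]
      simpa using (not_le.1 (by simpa using h)).le
  have hsupp : HasCompactSupport ψ₀ :=
    HasCompactSupport.intro (isCompact_closedBall (0 : Space) R) fun x hx =>
      Set.indicator_of_notMem hx _
  have hmem : MemLp ψ₀ 2 (volume : Measure Space) := (Lp.memLp ψ).ae_eq hae.symm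
  have hloc : LocallyIntegrable ψ₀ volume := hmem.locallyIntegrable (by norm_num)
  let φ : ContDiffBump (0 : Space) := ⟨δ / 2, δ, by positivity, by linarith⟩
  set m₀ : Space → ℂ :=
    convolution (φ.normed volume) ψ₀ (ContinuousLinearMap.lsmul ℝ ℝ) volume with hm₀
  have hm : IsTestFunction m₀ :=
    ⟨φ.hasCompactSupport_normed.contDiff_convolution_left _ φ.contDiff_normed hloc,
      φ.hasCompactSupport_normed.convolution _ hsupp⟩
  refine ⟨⟨m₀, hm⟩, fun h ε hε => ?_⟩
  set h' : Space → ℂ := fun x => conj (h (-x)) with hh'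
  have hh'c : Continuous h' := by
    have := h.2.conj.1.continuous
    exact this.comp continuous_neg
  have hh's : HasCompactSupport h' :=
    (h.2.conj.2).comp_homeomorph (Homeomorph.neg Space)
  set F : Space → ℂ := convolution ψ₀ h' (ContinuousLinearMap.mul ℝ ℂ) volume with hF
  have hFs : ∀ s, F s = ⟪toL2 h, translate s ψ⟫_ℂ := by
    intro s
    rw [inner_toL2_translate, inner_toL2_left, hF, convolution_def]
    refine integral_congr_ae ?_
    filter_upwards [hae] with x hx
    rw [hx]
    simp [hh', shift, sub_eq_add_neg]
  have hassoc : ⟪toL2 h, toL2 ⟨m₀, hm⟩⟫_ℂ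
      = convolution (φ.normed volume) F (ContinuousLinearMap.lsmul ℝ ℝ) volume 0 := by
    have h1 := convolution_assoc (f := φ.normed (volume : Measure Space)) (g := ψ₀) (k := h')
      (ContinuousLinearMap.lsmul ℝ ℝ) (ContinuousLinearMap.mul ℝ ℂ)
      (ContinuousLinearMap.lsmul ℝ ℝ) (ContinuousLinearMap.mul ℝ ℂ) (x₀ := (0 : Space))
      (μ := (volume : Measure Space)) (ν := (volume : Measure Space))
      (by intro x y z; simp [mul_assoc])
      φ.continuous_normed.aestronglyMeasurable hmem.1 hh'c.aestronglyMeasurable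
      ?_ ?_ ?_
    · rw [← h1, convolution_def, inner_toL2_left]
      refine integral_congr_ae ?_
      filter_upwards [coeFn_toL2 ⟨m₀, hm⟩] with x hx
      rw [hx]
      simp [hh', hm₀]
    · exact Filter.Eventually.of_forall fun y =>
        φ.hasCompactSupport_normed.convolutionExists_left _ φ.continuous_normed hloc y
    · refine Filter.Eventually.of_forall fun y => ?_
      exact (hh's.norm).convolutionExists_right _ (hmem.norm.locallyIntegrable (by norm_num)) hh'c.norm y
    · refine HasCompactSupport.convolutionExists_left _ φ.hasCompactSupport_normed.norm
        φ.continuous_normed.norm ?_ 0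
      refine (HasCompactSupport.continuous_convolution_right _ hh's.norm (hmem.norm.locallyIntegrable (by norm_num))
        hh'c.norm).locallyIntegrable
  have hF0 : F 0 = ⟪toL2 h, ψ⟫_ℂ := by rw [hFs, translate_zero]
  rw [hassoc, ← hF0, ← dist_eq_norm]
  refine φ.dist_normed_convolution_le ?_ ?_
  · exact (HasCompactSupport.continuous_convolution_right _ hh's hloc hh'c).aestronglyMeasurable
  · intro s hs
    rw [dist_eq_norm, hF0, hFs]
    exact hε s (by simpa using hs)

/-! ### First order operators with constant coefficients in `π` -/

/-- The operator `∑ⱼ cⱼ πⱼ` on test functions. -/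
def combination (β : ℝ) (c : Fin 3 → ℂ) : testFunctions →ₗ[ℂ] testFunctions :=
  ∑ j, c j • momentum β j

/-- `∑ⱼ cⱼ πⱼ ψ = g` in the sense of distributions. -/
def IsWeakCombination (β : ℝ) (c : Fin 3 → ℂ) (ψ g : L2) : Prop :=
  ∀ f, ⟪toL2 f, g⟫_ℂ = ⟪toL2 (combination β (fun j => conj (c j)) f), ψ⟫_ℂ

theorem combination_apply (β : ℝ) (c : Fin 3 → ℂ) (f : testFunctions) :
    combination β c f = ∑ j, c j • momentum β j f := by
  simp [combination, LinearMap.sum_apply]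

theorem isWeakCombination_toL2 (β : ℝ) (c : Fin 3 → ℂ) (f : testFunctions) :
    IsWeakCombination β c (toL2 f) (toL2 (combination β c f)) := by
  intro h
  simp only [combination_apply, map_sum, map_smul, inner_sum, sum_inner, inner_smul_left,
    inner_smul_right, inner_momentum, Complex.conj_conj]

theorem isWeakMomentum_iff_combination {β : ℝ} {j : Fin 3} {ψ g : L2} :
    IsWeakMomentum β j ψ g ↔ IsWeakCombination β (Pi.single j 1) ψ g := by
  rw [isWeakMomentum_iff]
  have h : ∀ f, combination β (fun k => conj ((Pi.single j 1 : Fin 3 → ℂ) k)) f = momentum β j f := by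
    intro f
    rw [combination_apply, Finset.sum_eq_single j]
    · simp
    · intro k _ hk
      simp [hk]
    · simp
  simp only [IsWeakCombination, h]

theorem combination_single (β : ℝ) (j : Fin 3) (f : testFunctions) :
    combination β (Pi.single j 1) f = momentum β j f := by
  rw [combination_apply, Finset.sum_eq_single j]
  · simp
  · intro k _ hk
    simp [hk]
  · simp

/-- The function `β ∑ⱼ cⱼ aⱼ(s)`. -/
def combinationPotential (β : ℝ) (c : Fin 3 → ℂ) (s : Space) : ℂ :=
  ∑ j, c j * ((β * potential j s : ℝ) : ℂ)

theorem continuous_combinationPotential (β : ℝ) (c : Fin 3 → ℂ) :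
    Continuous (combinationPotential β c) := by
  unfold combinationPotential
  fun_prop

theorem combinationPotential_zero (β : ℝ) (c : Fin 3 → ℂ) : combinationPotential β c 0 = 0 := by
  simp [combinationPotential]

theorem shift_combination (β : ℝ) (c : Fin 3 → ℂ) (s : Space) (f : testFunctions) :
    shift s (combination β c f)
      = combination β c (shift s f) + combinationPotential β c s • shift s f := by
  simp only [combination_apply, map_sum, map_smul, shift_momentum, smul_add,
    Finset.sum_add_distrib, combinationPotential, Finset.sum_smul, mul_smul]

/-- The potential is linear, so translation by `s` changes `∑ⱼ cⱼ πⱼ` only by the constant `β ∑ⱼ cⱼ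
aⱼ(s)`. This vanishes as `s → 0`, so mollification also converges after applying the operator. -/
theorem IsWeakCombination.inner_translate {β : ℝ} {c : Fin 3 → ℂ} {ψ g : L2}
    (h : IsWeakCombination β c ψ g) (f : testFunctions) (s : Space) :
    ⟪toL2 (combination β (fun j => conj (c j)) f), translate s ψ⟫_ℂ
      = ⟪toL2 f, translate s g - combinationPotential β c s • translate s ψ⟫_ℂ := by
  have hc : conj (combinationPotential β (fun j => conj (c j)) (-s))
      = -combinationPotential β c s := by
    simp [combinationPotential]
  rw [inner_toL2_translate, shift_combination, map_add, inner_add_left, ← h, map_smul,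
    inner_smul_left, hc, inner_sub_right, inner_smul_right, inner_toL2_translate,
    inner_toL2_translate, neg_mul, sub_eq_add_neg]

/-- By strong continuity of translations one radius `δ` controls `ψ` and all `g k`. In the pairing
the operator is moved onto the test function, then across the translation. -/
theorem exists_test_approx_of_bounded_support {κ : Type*} [Finite κ] {β : ℝ} (c : κ → Fin 3 → ℂ)
    {ψ : L2} {g : κ → L2} (h : ∀ k, IsWeakCombination β (c k) ψ (g k)) {R : ℝ}
    (hR : ∀ᵐ x, R ≤ ‖x‖ → ψ x = 0) {ε : ℝ} (hε : 0 < ε) :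
    ∃ f : testFunctions, ‖toL2 f - ψ‖ ≤ ε ∧ ∀ k, ‖toL2 (combination β (c k) f) - g k‖ ≤ ε := by
  have hG : ∀ k, ∀ᶠ s in nhds (0 : Space),
      ‖translate s (g k) - combinationPotential β (c k) s • translate s ψ - g k‖ < ε := by
    intro k
    have hcont : Continuous fun s : Space =>
        ‖translate s (g k) - combinationPotential β (c k) s • translate s ψ - g k‖ :=
      (((continuous_translate (g k)).sub ((continuous_combinationPotential β (c k)).smul
        (continuous_translate ψ))).sub continuous_const).norm
    refine hcont.continuousAt.eventually_lt continuousAt_const ?_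
    simpa [combinationPotential_zero, translate_zero] using hε
  have hψ : ∀ᶠ s in nhds (0 : Space), ‖translate s ψ - ψ‖ < ε := by
    have hcont : Continuous fun s : Space => ‖translate s ψ - ψ‖ :=
      ((continuous_translate ψ).sub continuous_const).norm
    refine hcont.continuousAt.eventually_lt continuousAt_const ?_
    simpa [translate_zero] using hε
  obtain ⟨δ, hδ, hball⟩ := Metric.eventually_nhds_iff.1 ((Filter.eventually_all.2 hG).and hψ)
  obtain ⟨m, hm⟩ := exists_mollification ψ hR hδ
  refine ⟨m, ?_, fun k => ?_⟩
  · refine norm_le_of_forall_inner_toL2 hε.le fun f => ?_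
    rw [inner_sub_right]
    refine hm f _ fun s hs => ?_
    rw [← inner_sub_right, mul_comm]
    refine (norm_inner_le_norm _ _).trans ?_
    gcongr
    exact (hball (by simpa using hs)).2.le
  · refine norm_le_of_forall_inner_toL2 hε.le fun f => ?_
    rw [inner_sub_right, isWeakCombination_toL2, h k]
    refine hm _ _ fun s hs => ?_
    rw [(h k).inner_translate, ← h k, ← inner_sub_right, mul_comm]
    refine (norm_inner_le_norm _ _).trans ?_
    gcongr
    exact ((hball (by simpa using hs)).1 k).le

/-! ### Cutoff -/

/-- Multiplication of a test function by a smooth real function. -/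
def mulTest (χ : Space → ℝ) (hχ : ContDiff ℝ (⊤ : ℕ∞) χ) (f : testFunctions) : testFunctions :=
  ⟨fun x => (χ x : ℂ) * f x, (Complex.ofRealCLM.contDiff.comp hχ).mul f.2.1, f.2.2.mul_left⟩

theorem momentum_mulTest (β : ℝ) (j : Fin 3) {χ : Space → ℝ} (hχ : ContDiff ℝ (⊤ : ℕ∞) χ)
    (f : testFunctions) (x : Space) :
    momentum β j (mulTest χ hχ f) x
      = χ x * momentum β j f x - Complex.I * (fderiv ℝ χ x (unitVec j) : ℂ) * f x := by
  have h1 : HasFDerivAt (fun y => (χ y : ℂ)) (Complex.ofRealCLM.comp (fderiv ℝ χ x)) x :=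
    Complex.ofRealCLM.hasFDerivAt.comp x (hχ.differentiable (by simp) x).hasFDerivAt
  have h2 := h1.mul (f.2.differentiable x).hasFDerivAt
  have h3 : HasFDerivAt (mulTest χ hχ f : Space → ℂ) _ x := h2
  simp only [momentum_apply, momentumFun]
  rw [h3.fderiv]
  simp [mulTest]
  ring

/-- The rescaled cutoff function `χ(· / (n + 1))`. -/
def cutoffBump : ContDiffBump (0 : Space) := ⟨1, 2, by norm_num, by norm_num⟩

def cutoff (n : ℕ) (x : Space) : ℝ := cutoffBump (((n : ℝ) + 1)⁻¹ • x)

theorem contDiff_cutoff (n : ℕ) : ContDiff ℝ (⊤ : ℕ∞) (cutoff n) :=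
  cutoffBump.contDiff.comp (contDiff_const_smul _)

theorem norm_cutoff_le (n : ℕ) (x : Space) : ‖(cutoff n x : ℂ)‖ ≤ 1 := by
  rw [Complex.norm_real, Real.norm_eq_abs, cutoff, abs_of_nonneg cutoffBump.nonneg]
  exact cutoffBump.le_one

theorem measurable_cutoff (n : ℕ) : Measurable fun x => (cutoff n x : ℂ) :=
  (Complex.continuous_ofReal.comp (contDiff_cutoff n).continuous).measurable

theorem cutoff_eq_one {n : ℕ} {x : Space} (h : ‖x‖ ≤ n + 1) : cutoff n x = 1 := by
  refine cutoffBump.one_of_mem_closedBall ?_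
  rw [mem_closedBall_zero_iff, norm_smul, Real.norm_eq_abs, abs_of_pos (by positivity)]
  change _ ≤ (1 : ℝ)
  rwa [inv_mul_le_one₀ (by positivity)]

theorem cutoff_eq_zero {n : ℕ} {x : Space} (h : 2 * ((n : ℝ) + 1) ≤ ‖x‖) : cutoff n x = 0 := by
  refine cutoffBump.zero_of_le_dist ?_
  rw [dist_zero_right, norm_smul, Real.norm_eq_abs, abs_of_pos (by positivity)]
  change (2 : ℝ) ≤ _
  rw [le_inv_mul_iff₀ (by positivity)]
  linarith

/-- The chain rule for the rescaled bump gives the factor `1/(n + 1)`; this makes the commutator of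
`πⱼ` with the cutoff disappear in the limit. -/
theorem exists_norm_fderiv_cutoff_le :
    ∃ C : ℝ, 0 ≤ C ∧ ∀ (n : ℕ) (x : Space) (j : Fin 3),
      ‖((fderiv ℝ (cutoff n) x (unitVec j) : ℝ) : ℂ)‖ ≤ C * ((n : ℝ) + 1)⁻¹ := by
  have hsm : ContDiff ℝ 1 (cutoffBump : Space → ℝ) := cutoffBump.contDiff
  obtain ⟨C, hC⟩ := (hsm.continuous_fderiv (by simp)).bounded_above_of_compact_support
    (cutoffBump.hasCompactSupport.fderiv (𝕜 := ℝ))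
  refine ⟨C, (norm_nonneg _).trans (hC 0), fun n x j => ?_⟩
  have h : fderiv ℝ (cutoff n) x = ((n : ℝ) + 1)⁻¹ • fderiv ℝ cutoffBump (((n : ℝ) + 1)⁻¹ • x) :=
    fderiv_comp_smul _
  have hn : (0 : ℝ) ≤ ((n : ℝ) + 1)⁻¹ := by positivity
  rw [Complex.norm_real, h, smul_apply, norm_smul, mul_comm, Real.norm_of_nonneg hn]
  refine mul_le_mul_of_nonneg_right ?_ hn
  refine (ContinuousLinearMap.le_opNorm _ _).trans ?_
  simpa using hC _

/-- Multiplication by the cutoff function. -/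
def cutoffL2 (n : ℕ) : L2 →L[ℂ] L2 :=
  mulL2 (fun x => (cutoff n x : ℂ)) (measurable_cutoff n) 1 (norm_cutoff_le n)

/-- The cutoffs are contractions and eventually fix each test function; density does the rest. -/
theorem tendsto_cutoffL2 (ψ : L2) :
    Filter.Tendsto (fun n => cutoffL2 n ψ) Filter.atTop (nhds ψ) := by
  have hbound : ∀ n φ, ‖cutoffL2 n φ‖ ≤ ‖φ‖ := fun n φ => by
    exact (norm_mulL2_apply_le (measurable_cutoff n) (norm_cutoff_le n) φ).trans_eq (one_mul _)
  rw [Metric.tendsto_atTop]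
  intro ε hε
  obtain ⟨f, hf⟩ := dense_range_toL2.exists_dist_lt ψ (half_pos hε)
  obtain ⟨R, hR⟩ := f.2.2.isCompact.isBounded.exists_norm_le
  obtain ⟨N, hN⟩ := exists_nat_ge R
  refine ⟨N, fun n hn => ?_⟩
  have hfix : cutoffL2 n (toL2 f) = toL2 f := by
    refine Lp.ext ?_
    filter_upwards [coeFn_mulL2 (measurable_cutoff n) (norm_cutoff_le n) (toL2 f),
      coeFn_toL2 f] with x hx hfx
    rw [cutoffL2, hx, hfx]
    by_cases h0 : x ∈ tsupport f
    · have hx1 : ‖x‖ ≤ n + 1 := by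
        have : (N : ℝ) ≤ n := by exact_mod_cast hn
        linarith [hR x h0]
      rw [cutoff_eq_one hx1]
      simp
    · rw [image_eq_zero_of_notMem_tsupport h0, mul_zero]
  have : cutoffL2 n ψ - ψ = cutoffL2 n (ψ - toL2 f) - (ψ - toL2 f) := by
    rw [map_sub, hfix]
    abel
  rw [dist_eq_norm, this]
  rw [dist_eq_norm] at hf
  linarith [norm_sub_le (cutoffL2 n (ψ - toL2 f)) (ψ - toL2 f), hbound n (ψ - toL2 f)]

theorem measurable_fderiv_cutoff (n : ℕ) (j : Fin 3) :
    Measurable fun x => ((fderiv ℝ (cutoff n) x (unitVec j) : ℝ) : ℂ) :=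
  Complex.measurable_ofReal.comp (measurable_fderiv_apply_const ℝ (cutoff n) (unitVec j))

/-- The Leibniz rule `πⱼ(χψ) = χ πⱼψ - i(∂ⱼχ)ψ` gives `G n`, whose last term is of size `O(1/n)`. -/
theorem exists_isWeakCombination_cutoff {β : ℝ} {c : Fin 3 → ℂ} {ψ g : L2}
    (h : IsWeakCombination β c ψ g) :
    ∃ G : ℕ → L2, (∀ n, IsWeakCombination β c (cutoffL2 n ψ) (G n)) ∧
      Filter.Tendsto G Filter.atTop (nhds g) := by
  obtain ⟨C, hC0, hC⟩ := exists_norm_fderiv_cutoff_le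
  set D : ℕ → Fin 3 → L2 →L[ℂ] L2 := fun n j =>
    mulL2 (fun x => ((fderiv ℝ (cutoff n) x (unitVec j) : ℝ) : ℂ)) (measurable_fderiv_cutoff n j)
      (C * ((n : ℝ) + 1)⁻¹) (fun x => hC n x j) with hD
  have hmulf : ∀ (n : ℕ) (f : testFunctions) (φ : L2),
      ⟪toL2 f, cutoffL2 n φ⟫_ℂ = ⟪toL2 (mulTest (cutoff n) (contDiff_cutoff n) f), φ⟫_ℂ := by
    intro n f φ
    rw [cutoffL2, inner_toL2_mulL2, inner_toL2_left]
    refine integral_congr_ae (Filter.Eventually.of_forall fun x => ?_)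
    simp [mulTest]
    ring
  have hmom : ∀ (n : ℕ) (j : Fin 3) (f : testFunctions),
      ⟪toL2 (momentum β j f), cutoffL2 n ψ⟫_ℂ
        = ⟪toL2 (momentum β j (mulTest (cutoff n) (contDiff_cutoff n) f)), ψ⟫_ℂ
          - Complex.I * ⟪toL2 f, D n j ψ⟫_ℂ := by
    intro n j f
    rw [hD, inner_toL2_mulL2, inner_toL2_left (mulTest _ _ _ |> momentum β j), cutoffL2, inner_toL2_mulL2,
      ← integral_const_mul,
      ← integral_sub (integrable_mul_conj _ _)]
    · refine integral_congr_ae (Filter.Eventually.of_forall fun x => ?_)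
      simp only [momentum_mulTest, map_sub, map_mul, Complex.conj_I, Complex.conj_ofReal]
      ring
    · refine Integrable.const_mul ?_ _
      have := integrable_mul_conj f (D n j ψ)
      refine this.congr ?_
      filter_upwards [coeFn_mulL2 (measurable_fderiv_cutoff n j) (fun x => hC n x j) ψ] with x hx
      rw [hD, hx]
  refine ⟨fun n => cutoffL2 n g - Complex.I • ∑ j, c j • D n j ψ, fun n f => ?_, ?_⟩
  · have h1 := h (mulTest (cutoff n) (contDiff_cutoff n) f)
    rw [inner_sub_right, hmulf, h1]
    simp only [combination_apply, map_sum, map_smul, inner_sum, sum_inner, inner_smul_left,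
      inner_smul_right, hmom, Complex.conj_conj, Finset.mul_sum, ← Finset.sum_sub_distrib]
    refine Finset.sum_congr rfl fun j _ => ?_
    ring
  · have h0 : ∀ j, Filter.Tendsto (fun n => D n j ψ) Filter.atTop (nhds 0) := by
      intro j
      have hlim : Filter.Tendsto (fun n : ℕ => C * ((n : ℝ) + 1)⁻¹ * ‖ψ‖) Filter.atTop (nhds 0) := by
        have := tendsto_one_div_add_atTop_nhds_zero_nat (𝕜 := ℝ)
        simp only [one_div] at this
        simpa using (this.const_mul C).mul_const ‖ψ‖
      exact squeeze_zero_norm (fun n => norm_mulL2_apply_le _ _ ψ) hlim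
    have h2 : Filter.Tendsto (fun n => Complex.I • ∑ j, c j • D n j ψ) Filter.atTop (nhds 0) := by
      have := (tendsto_finsetSum Finset.univ fun j _ => (h0 j).const_smul (c j)).const_smul
        Complex.I
      simpa using this
    simpa using (tendsto_cutoffL2 g).sub h2

/-- Test functions are a common core of finitely many first order operators. -/
theorem exists_test_approx {κ : Type*} [Finite κ] {β : ℝ} (c : κ → Fin 3 → ℂ)
    {ψ : L2} {g : κ → L2} (h : ∀ k, IsWeakCombination β (c k) ψ (g k)) {ε : ℝ} (hε : 0 < ε) :
    ∃ f : testFunctions, ‖toL2 f - ψ‖ ≤ ε ∧ ∀ k, ‖toL2 (combination β (c k) f) - g k‖ ≤ ε := by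
  choose G hG hGt using fun k => exists_isWeakCombination_cutoff (h k)
  have h1 : ∀ᶠ n in Filter.atTop, ‖cutoffL2 n ψ - ψ‖ < ε / 2 := by
    have := (Metric.tendsto_nhds.1 (tendsto_cutoffL2 ψ)) (ε / 2) (half_pos hε)
    simpa only [dist_eq_norm] using this
  have h2 : ∀ᶠ n in Filter.atTop, ∀ k, ‖G k n - g k‖ < ε / 2 := by
    refine Filter.eventually_all.2 fun k => ?_
    have := (Metric.tendsto_nhds.1 (hGt k)) (ε / 2) (half_pos hε)
    simpa only [dist_eq_norm] using this
  obtain ⟨n, hn1, hn2⟩ := (h1.and h2).exists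
  have hR : ∀ᵐ x, 2 * ((n : ℝ) + 1) ≤ ‖x‖ → cutoffL2 n ψ x = 0 := by
    filter_upwards [coeFn_mulL2 (measurable_cutoff n) (norm_cutoff_le n) ψ] with x hx hxn
    rw [cutoffL2, hx, cutoff_eq_zero hxn]
    simp
  obtain ⟨f, hf1, hf2⟩ := exists_test_approx_of_bounded_support c (fun k => hG k n) hR (half_pos hε)
  refine ⟨f, ?_, fun k => ?_⟩
  · linarith [norm_sub_le_norm_sub_add_norm_sub (toL2 f) (cutoffL2 n ψ) ψ]
  · linarith [norm_sub_le_norm_sub_add_norm_sub (toL2 (combination β (c k) f)) (G k n) (g k),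
      hf2 k, hn2 k]

/-! ### Weak momenta -/

theorem IsWeakMomentum.unique {β : ℝ} {j : Fin 3} {ψ g g' : L2} (h : IsWeakMomentum β j ψ g)
    (h' : IsWeakMomentum β j ψ g') : g = g' :=
  eq_of_forall_inner_toL2 fun f => by
    rw [isWeakMomentum_iff.1 h, isWeakMomentum_iff.1 h']

theorem momentumSq_eq {β : ℝ} {j : Fin 3} {ψ g : L2} (h : IsWeakMomentum β j ψ g) :
    momentumSq β j ψ = ‖g‖ₑ ^ 2 := by
  refine le_antisymm (iInf₂_le g h) (le_iInf₂ fun g' hg' => ?_)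
  rw [h.unique hg']

theorem exists_isWeakMomentum {β : ℝ} {j : Fin 3} {ψ : L2} (h : momentumSq β j ψ < ∞) :
    ∃ g, IsWeakMomentum β j ψ g := by
  by_contra! hne
  refine h.ne ?_
  simp [momentumSq, hne]

theorem isWeakMomentum_of_tendsto {β : ℝ} {j : Fin 3} {ψ g : L2} {f : ℕ → testFunctions}
    (h1 : Filter.Tendsto (fun n => toL2 (f n)) Filter.atTop (nhds ψ))
    (h2 : Filter.Tendsto (fun n => toL2 (momentum β j (f n))) Filter.atTop (nhds g)) :
    IsWeakMomentum β j ψ g := by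
  refine isWeakMomentum_iff.2 fun h => ?_
  have h3 := (tendsto_const_nhds (x := toL2 h)).inner (𝕜 := ℂ) h2
  simp_rw [← inner_momentum] at h3
  exact tendsto_nhds_unique h3 (tendsto_const_nhds.inner h1)

/-- `(π₀ - i π₁) ψ = g` in the sense of distributions. -/
abbrev IsWeakLowering (β : ℝ) (ψ g : L2) : Prop :=
  IsWeakCombination β ![1, -Complex.I, 0] ψ g

theorem combination_lowering (β : ℝ) (f : testFunctions) :
    combination β ![1, -Complex.I, 0] f = lowering β f := by
  simp [combination_apply, Fin.sum_univ_three, lowering, sub_eq_add_neg]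
  exact neg_smul Complex.I (momentum β 1 f)

theorem isWeakLowering_iff {β : ℝ} {ψ g : L2} :
    IsWeakLowering β ψ g ↔ ∀ f, ⟪toL2 f, g⟫_ℂ = ⟪toL2 (raising β f), ψ⟫_ℂ := by
  have h : ∀ f, combination β (fun j => conj ((![1, -Complex.I, 0] : Fin 3 → ℂ) j)) f
      = raising β f := by
    intro f
    simp [combination_apply, Fin.sum_univ_three, raising]
  simp only [IsWeakLowering, IsWeakCombination, h]

theorem mem_lowestLandauBand_iff_isWeakLowering {β : ℝ} {ψ : L2} :
    ψ ∈ lowestLandauBand β ↔ IsWeakLowering β ψ 0 := by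
  rw [mem_lowestLandauBand_iff, isWeakLowering_iff]
  simp [eq_comm]

theorem isWeakLowering_of_isWeakMomentum {β : ℝ} {ψ g₀ g₁ : L2} (h₀ : IsWeakMomentum β 0 ψ g₀)
    (h₁ : IsWeakMomentum β 1 ψ g₁) : IsWeakLowering β ψ (g₀ - Complex.I • g₁) := by
  refine isWeakLowering_iff.2 fun f => ?_
  rw [inner_sub_right, inner_smul_right, isWeakMomentum_iff.1 h₀, isWeakMomentum_iff.1 h₁, raising]
  simp [inner_add_left, inner_smul_left, sub_eq_add_neg]

theorem exists_seq_test_approx {κ : Type*} [Finite κ] {β : ℝ} (c : κ → Fin 3 → ℂ)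
    {ψ : L2} {g : κ → L2} (h : ∀ k, IsWeakCombination β (c k) ψ (g k)) :
    ∃ f : ℕ → testFunctions, Filter.Tendsto (fun n => toL2 (f n)) Filter.atTop (nhds ψ) ∧
      ∀ k, Filter.Tendsto (fun n => toL2 (combination β (c k) (f n))) Filter.atTop
        (nhds (g k)) := by
  choose f hf1 hf2 using fun n : ℕ => exists_test_approx c h (ε := 1 / ((n : ℝ) + 1)) (by positivity)
  refine ⟨f, ?_, fun k => ?_⟩
  · rw [tendsto_iff_norm_sub_tendsto_zero]
    exact squeeze_zero (fun _ => norm_nonneg _) hf1 tendsto_one_div_add_atTop_nhds_zero_nat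
  · rw [tendsto_iff_norm_sub_tendsto_zero]
    exact squeeze_zero (fun _ => norm_nonneg _) (fun n => hf2 n k)
      tendsto_one_div_add_atTop_nhds_zero_nat

/-- If `(π₀ - i π₁) ψ` is in `L²`, then so are `π₀ ψ` and `π₁ ψ`. -/
theorem IsWeakLowering.exists_isWeakMomentum {β : ℝ} {ψ g : L2}
    (h : IsWeakLowering β ψ g) :
    ∃ g₀ g₁, IsWeakMomentum β 0 ψ g₀ ∧ IsWeakMomentum β 1 ψ g₁ ∧
      ‖g₀‖ ^ 2 + ‖g₁‖ ^ 2 = ‖g‖ ^ 2 + β * ‖ψ‖ ^ 2 := by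
  obtain ⟨f, hf1, hf2⟩ := exists_seq_test_approx (κ := Unit) (fun _ => ![1, -Complex.I, 0])
    (g := fun _ => g) (fun _ => h)
  replace hf2 := hf2 ()
  simp_rw [combination_lowering] at hf2
  -- On test functions `‖πⱼ p‖²` is bounded by the squared graph norm of `π₀ - iπ₁`. Applied to
  -- differences this makes the momenta of the approximating sequence Cauchy.
  have hcauchy : ∀ j : Fin 3, (∀ p : testFunctions, ‖toL2 (momentum β j p)‖ ^ 2
      ≤ ‖toL2 (lowering β p)‖ ^ 2 + β * ‖toL2 p‖ ^ 2) →
      ∃ u, Filter.Tendsto (fun n => toL2 (momentum β j (f n))) Filter.atTop (nhds u) := by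
    intro j hj
    refine cauchySeq_tendsto_of_complete (cauchySeq_iff_tendsto_dist_atTop_0.2 ?_)
    have hsq : Filter.Tendsto (fun n : ℕ × ℕ => dist (toL2 (lowering β (f n.1)))
        (toL2 (lowering β (f n.2))) ^ 2 + β * dist (toL2 (f n.1)) (toL2 (f n.2)) ^ 2)
        Filter.atTop (nhds 0) := by
      have e1 := (cauchySeq_iff_tendsto_dist_atTop_0.1 hf1.cauchySeq).pow 2
      have e2 := (cauchySeq_iff_tendsto_dist_atTop_0.1 hf2.cauchySeq).pow 2
      simpa using e2.add (e1.const_mul β)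
    have hle : ∀ n : ℕ × ℕ, dist (toL2 (momentum β j (f n.1))) (toL2 (momentum β j (f n.2))) ^ 2
        ≤ dist (toL2 (lowering β (f n.1))) (toL2 (lowering β (f n.2))) ^ 2
          + β * dist (toL2 (f n.1)) (toL2 (f n.2)) ^ 2 := by
      intro n
      simp_rw [dist_eq_norm, ← map_sub]
      exact hj _
    have h0 := squeeze_zero (fun n => by positivity) hle hsq
    have := h0.sqrt
    simpa [Real.sqrt_sq] using this
  have hid := fun p => (norm_momentum_sq_add β p).1
  obtain ⟨u, hu⟩ := hcauchy 0 fun p => by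
    rw [← hid]; linarith [sq_nonneg ‖toL2 (momentum β 1 p)‖]
  obtain ⟨v, hv⟩ := hcauchy 1 fun p => by
    rw [← hid]; linarith [sq_nonneg ‖toL2 (momentum β 0 p)‖]
  refine ⟨u, v, isWeakMomentum_of_tendsto hf1 hu, isWeakMomentum_of_tendsto hf1 hv, ?_⟩
  refine tendsto_nhds_unique ((hu.norm.pow 2).add (hv.norm.pow 2)) ?_
  simp_rw [hid]
  exact (hf2.norm.pow 2).add ((hf1.norm.pow 2).const_mul β)

/-- The gap above the lowest Landau band. -/
theorem two_mul_norm_sq_le_of_mem_orthogonal {β : ℝ} (hβ : 0 < β) {ψ g : L2}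
    (hψ : ψ ∈ (lowestLandauBand β)ᗮ) (h : IsWeakLowering β ψ g) :
    2 * β * ‖ψ‖ ^ 2 ≤ ‖g‖ ^ 2 := by
  set M : Submodule ℂ L2 := LinearMap.range (toL2 ∘ₗ raising β)
  -- Hence the orthogonal complement of the band is the closure of the range of the creation
  -- operator.
  have hM : lowestLandauBand β = Mᗮ := by
    ext φ
    rw [mem_lowestLandauBand_iff, Submodule.mem_orthogonal]
    constructor
    · rintro hφ _ ⟨f, rfl⟩
      exact hφ f
    · intro hφ f
      exact hφ _ ⟨f, rfl⟩
  rw [hM, Submodule.orthogonal_orthogonal_eq_closure] at hψ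
  -- For `u = (π₀ + iπ₁)f` one has `⟪u, ψ⟫ = ⟪f, g⟫` and `√(2β)‖f‖ ≤ ‖u‖`. The bound extends to the
  -- closure, where `u = ψ` may be inserted.
  have key : ∀ u ∈ M.topologicalClosure, Real.sqrt (2 * β) * ‖⟪u, ψ⟫_ℂ‖ ≤ ‖u‖ * ‖g‖ := by
    intro u hu
    have hcl : IsClosed {u : L2 | Real.sqrt (2 * β) * ‖⟪u, ψ⟫_ℂ‖ ≤ ‖u‖ * ‖g‖} :=
      isClosed_le (by fun_prop) (by fun_prop)
    refine closure_minimal ?_ hcl hu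
    rintro _ ⟨f, rfl⟩
    change Real.sqrt (2 * β) * ‖⟪toL2 (raising β f), ψ⟫_ℂ‖ ≤ ‖toL2 (raising β f)‖ * ‖g‖
    rw [← isWeakLowering_iff.1 h]
    have h1 : Real.sqrt (2 * β) * ‖toL2 f‖ ≤ ‖toL2 (raising β f)‖ := by
      refine abs_le_of_sq_le_sq' ?_ (norm_nonneg _) |>.2
      rw [mul_pow, Real.sq_sqrt (by positivity)]
      linarith [(norm_momentum_sq_add β f).2, sq_nonneg ‖toL2 (lowering β f)‖]
    calc Real.sqrt (2 * β) * ‖⟪toL2 f, g⟫_ℂ‖ ≤ Real.sqrt (2 * β) * (‖toL2 f‖ * ‖g‖) := by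
          gcongr
          exact norm_inner_le_norm _ _
      _ = Real.sqrt (2 * β) * ‖toL2 f‖ * ‖g‖ := by ring
      _ ≤ _ := by gcongr
  have h2 := key ψ hψ
  rw [inner_self_eq_norm_sq_to_K] at h2
  simp only [norm_pow, RCLike.norm_ofReal, abs_norm] at h2
  have h3 : Real.sqrt (2 * β) * ‖ψ‖ ≤ ‖g‖ := by
    rcases (norm_nonneg ψ).eq_or_lt with h0 | h0
    · rw [← h0]; simp
    · nlinarith
  calc 2 * β * ‖ψ‖ ^ 2 = (Real.sqrt (2 * β) * ‖ψ‖) ^ 2 := by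
        rw [mul_pow, Real.sq_sqrt (by positivity)]
    _ ≤ _ := by gcongr

/-! ### The Coulomb potential is form bounded by the kinetic energy -/

/-- The regularized Coulomb potential `(|x - y|² + ε²)^{-1/2}`. -/
def softCoulomb (y : Space) (ε : ℝ) (x : Space) : ℝ := (Real.sqrt (‖x - y‖ ^ 2 + ε ^ 2))⁻¹

theorem softCoulomb_pos (y : Space) {ε : ℝ} (hε : 0 < ε) (x : Space) : 0 < softCoulomb y ε x := by
  unfold softCoulomb; positivity

theorem softCoulomb_sq (y : Space) {ε : ℝ} (hε : 0 < ε) (x : Space) :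
    softCoulomb y ε x ^ 2 * (‖x - y‖ ^ 2 + ε ^ 2) = 1 := by
  unfold softCoulomb
  rw [inv_pow, Real.sq_sqrt (by positivity)]
  exact inv_mul_cancel₀ (by positivity)

theorem contDiff_softCoulomb (y : Space) {ε : ℝ} (hε : 0 < ε) :
    ContDiff ℝ 1 (softCoulomb y ε) := by
  have h : ContDiff ℝ 1 fun x : Space => ‖x - y‖ ^ 2 + ε ^ 2 :=
    ((contDiff_id.sub contDiff_const).norm_sq ℝ).add contDiff_const
  exact (h.sqrt fun x => by positivity).inv fun x => by positivity

theorem softCoulomb_le (y : Space) {ε : ℝ} (hε : 0 < ε) (x : Space) : softCoulomb y ε x ≤ ε⁻¹ := by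
  unfold softCoulomb
  gcongr
  exact Real.le_sqrt_of_sq_le (by nlinarith [sq_nonneg ‖x - y‖])

theorem hasFDerivAt_softCoulomb (y : Space) {ε : ℝ} (hε : 0 < ε) (x : Space) :
    HasFDerivAt (softCoulomb y ε) (-(softCoulomb y ε x) ^ 3 • innerSL ℝ (x - y)) x := by
  have h1 : HasFDerivAt (fun x : Space => ‖x - y‖ ^ 2 + ε ^ 2)
      (2 • (innerSL ℝ (x - y)).comp (ContinuousLinearMap.id ℝ Space)) x :=
    (((hasFDerivAt_id x).sub_const y).norm_sq).add_const _
  have hpos : 0 < ‖x - y‖ ^ 2 + ε ^ 2 := by positivity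
  have h2 := (hasDerivAt_inv (Real.sqrt_pos.2 hpos).ne').comp_hasFDerivAt x (h1.sqrt hpos.ne')
  have h3 : HasFDerivAt (softCoulomb y ε) _ x := h2
  refine h3.congr_fderiv ?_
  ext v
  have hs := (Real.sqrt_pos.2 hpos).ne'
  simp only [softCoulomb, smul_apply, ContinuousLinearMap.comp_apply, smul_eq_mul, nsmul_eq_mul,
    ContinuousLinearMap.id_apply]
  field_simp
  simp

theorem sum_sq_sub (x y : Space) : ∑ j, (x j - y j) ^ 2 = ‖x - y‖ ^ 2 := by
  rw [EuclideanSpace.norm_sq_eq]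
  simp

/-- One term of the divergence of `(x - y)|f|²/√(|x - y|² + ε²)`. The real potential contributes
only an imaginary part, so `∂ⱼf` may be replaced by `iπⱼf`; the resulting bound is independent of
the field. -/
theorem hasFDerivAt_virial (β : ℝ) (f : testFunctions) (y : Space) {ε : ℝ} (hε : 0 < ε)
    (j : Fin 3) (x : Space) :
    fderiv ℝ (fun x => (x j - y j) * softCoulomb y ε x * ‖f x‖ ^ 2) x (unitVec j)
      = (softCoulomb y ε x - (x j - y j) ^ 2 * softCoulomb y ε x ^ 3) * ‖f x‖ ^ 2
        + 2 * ((x j - y j) * softCoulomb y ε x)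
          * (conj (f x) * (Complex.I * momentum β j f x)).re := by
  have e1 : HasFDerivAt (fun x : Space => x j - y j) (EuclideanSpace.proj (𝕜 := ℝ) j) x :=
    (EuclideanSpace.proj (𝕜 := ℝ) j).hasFDerivAt.sub_const _
  have e2 := ((e1.mul (hasFDerivAt_softCoulomb y hε x)).mul
    ((f.2.differentiable x).hasFDerivAt.norm_sq))
  have e3 : HasFDerivAt (fun x => (x j - y j) * softCoulomb y ε x * ‖f x‖ ^ 2) _ x := e2
  rw [e3.fderiv]
  have e4 : (conj (f x) * (Complex.I * momentum β j f x)).re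
      = (conj (f x) * fderiv ℝ f x (unitVec j)).re := by
    have : conj (f x) * (Complex.I * momentum β j f x)
        = conj (f x) * fderiv ℝ f x (unitVec j)
          + ((β * potential j x : ℝ) : ℂ) * (f x * conj (f x)) * Complex.I := by
      simp only [momentum_apply, momentumFun]
      linear_combination (-conj (f x) * fderiv ℝ f x (unitVec j)) * Complex.I_mul_I
    rw [this, Complex.mul_conj, ← Complex.ofReal_mul, Complex.add_re, Complex.re_ofReal_mul]
    simp
  rw [e4]
  have e5 : ⟪x - y, unitVec j⟫_ℝ = x j - y j := by
    simp [unitVec, EuclideanSpace.inner_single_right]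
  have e6 : (EuclideanSpace.proj (𝕜 := ℝ) j) (unitVec j) = (1 : ℝ) := by simp [unitVec]
  have e7 : ⟪f x, fderiv ℝ f x (unitVec j)⟫_ℝ = (conj (f x) * fderiv ℝ f x (unitVec j)).re := by
    rw [Complex.inner, mul_comm]
  simp only [add_apply, smul_apply, ContinuousLinearMap.comp_apply, innerSL_apply_apply, smul_eq_mul,
    nsmul_eq_mul, e5, e6, e7, Pi.mul_apply]
  push_cast
  ring

/-- Here `r` is the regularized potential, `v = x - y`, `a = |f|`, `p j = |πⱼf|`. The divergence of
`v r` is `3r - d r³ ≥ 2r`, and the cross terms are absorbed by `2|vⱼ r| a pⱼ ≤ δ pⱼ² + δ⁻¹ vⱼ² r²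
a²` with `r² d ≤ 1`. -/
theorem virial_pointwise {r δ a d : ℝ} {v p t : Fin 3 → ℝ} (hr : 0 < r) (hδ : 0 < δ)
    (hv : ∑ j, v j ^ 2 = d) (hrd : r ^ 2 * d ≤ 1) (ht : ∀ j, |t j| ≤ a * p j) :
    2 * (r * a ^ 2) - (δ * ∑ j, p j ^ 2 + δ⁻¹ * a ^ 2)
      ≤ ∑ j, ((r - v j ^ 2 * r ^ 3) * a ^ 2 + 2 * (v j * r) * t j) := by
  have hterm : ∀ j, -(δ * p j ^ 2 + δ⁻¹ * (v j ^ 2 * (r ^ 2 * a ^ 2))) ≤ 2 * (v j * r) * t j := by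
    intro j
    have h5 : |2 * (v j * r) * t j| ≤ 2 * |v j * r| * (a * p j) := by
      rw [abs_mul, abs_mul, abs_two]
      exact mul_le_mul_of_nonneg_left (ht j) (by positivity)
    have h7 : δ * p j ^ 2 + δ⁻¹ * (v j ^ 2 * (r ^ 2 * a ^ 2)) - 2 * |v j * r| * (a * p j)
        = δ⁻¹ * (δ * p j - |v j * r| * a) ^ 2 := by
      have h8 : v j ^ 2 * (r ^ 2 * a ^ 2) = (|v j * r| * a) ^ 2 := by
        rw [mul_pow, sq_abs]; ring
      rw [h8]
      field_simp
      ring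
    have h8 : 0 ≤ δ⁻¹ * (δ * p j - |v j * r| * a) ^ 2 := by positivity
    linarith [neg_abs_le (2 * (v j * r) * t j)]
  have hsum := Finset.sum_le_sum fun j (_ : j ∈ Finset.univ) => hterm j
  rw [Finset.sum_neg_distrib, Finset.sum_add_distrib, ← Finset.mul_sum, ← Finset.mul_sum,
    ← Finset.sum_mul, hv] at hsum
  rw [Finset.sum_add_distrib, ← Finset.sum_mul, Finset.sum_sub_distrib, ← Finset.sum_mul, hv]
  simp only [Finset.sum_const, Finset.card_univ, Fintype.card_fin, nsmul_eq_mul]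
  have h1 : d * r ^ 3 ≤ r := by nlinarith
  have h2 : d * (r ^ 2 * a ^ 2) ≤ a ^ 2 := by nlinarith [sq_nonneg a]
  have h3 : δ⁻¹ * (d * (r ^ 2 * a ^ 2)) ≤ δ⁻¹ * a ^ 2 := by gcongr
  have h4 : (d * r ^ 3) * a ^ 2 ≤ r * a ^ 2 := by gcongr
  push_cast
  linarith

/-- The divergence integrates to zero, so the pointwise bound controls twice the potential energy.
The factor `2` is given away. -/
theorem integral_softCoulomb_le (β : ℝ) (f : testFunctions) (y : Space) {ε δ : ℝ} (hε : 0 < ε)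
    (hδ : 0 < δ) :
    ∫ x, softCoulomb y ε x * ‖f x‖ ^ 2
      ≤ δ * ∑ j, ‖toL2 (momentum β j f)‖ ^ 2 + δ⁻¹ * ‖toL2 f‖ ^ 2 := by
  obtain ⟨F, hF⟩ : ∃ F : Fin 3 → Space → ℝ,
      F = fun j x => (x j - y j) * softCoulomb y ε x * ‖f x‖ ^ 2 := ⟨_, rfl⟩
  have hf1 : ContDiff ℝ 1 f := f.2.1.of_le (by exact_mod_cast le_top)
  have hFc : ∀ j, ContDiff ℝ 1 (F j) := fun j => by
    rw [hF]
    exact (((EuclideanSpace.proj (𝕜 := ℝ) j).contDiff.sub contDiff_const).mul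
      (contDiff_softCoulomb y hε)).mul (hf1.norm_sq ℝ)
  have hns : HasCompactSupport fun x => ‖f x‖ ^ 2 :=
    f.2.2.comp_left (g := fun z : ℂ => ‖z‖ ^ 2) (by simp)
  have hFs : ∀ j, HasCompactSupport (F j) := fun j => by
    rw [hF]
    exact hns.mul_left
  have h0 : ∀ j, ∫ x, fderiv ℝ (F j) x (unitVec j) = 0 := fun j =>
    integral_fderiv_eq_zero (hFc j) (hFs j) _
  have hi : ∀ j, Integrable fun x => fderiv ℝ (F j) x (unitVec j) := fun j =>
    (((hFc j).continuous_fderiv (by simp)).clm_apply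
      continuous_const).integrable_of_hasCompactSupport ((hFs j).fderiv_apply (𝕜 := ℝ) _)
  have hpt : ∀ x, 2 * (softCoulomb y ε x * ‖f x‖ ^ 2)
        - (δ * ∑ j, ‖momentum β j f x‖ ^ 2 + δ⁻¹ * ‖f x‖ ^ 2)
      ≤ ∑ j, fderiv ℝ (F j) x (unitVec j) := by
    intro x
    simp_rw [hF, hasFDerivAt_virial β f y hε]
    refine virial_pointwise (softCoulomb_pos y hε x) hδ (sum_sq_sub x y) ?_ fun j => ?_
    · have := softCoulomb_sq y hε x
      nlinarith [mul_pos (pow_pos (softCoulomb_pos y hε x) 2) (pow_pos hε 2)]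
    · refine (Complex.abs_re_le_norm _).trans ?_
      simp
  have hint_sq : ∀ p : testFunctions, Integrable fun x => ‖p x‖ ^ 2 := fun p =>
    p.2.memLp.integrable_norm_pow (by norm_num)
  have hint_soft : Integrable fun x => softCoulomb y ε x * ‖f x‖ ^ 2 := by
    refine Continuous.integrable_of_hasCompactSupport ?_ hns.mul_left
    exact (contDiff_softCoulomb y hε).continuous.mul (hf1.continuous.norm.pow 2)
  have hint_sum : Integrable fun x => ∑ j, ‖momentum β j f x‖ ^ 2 :=
    integrable_finsetSum _ fun j _ => hint_sq _
  have hint_tot : Integrable fun x =>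
      δ * ∑ j, ‖momentum β j f x‖ ^ 2 + δ⁻¹ * ‖f x‖ ^ 2 :=
    (hint_sum.const_mul δ).add ((hint_sq f).const_mul δ⁻¹)
  have hle : ∫ x, (2 * (softCoulomb y ε x * ‖f x‖ ^ 2)
      - (δ * ∑ j, ‖momentum β j f x‖ ^ 2 + δ⁻¹ * ‖f x‖ ^ 2)) ≤ 0 := by
    refine (integral_mono ?_ (integrable_finsetSum Finset.univ fun j _ => hi j) hpt).trans_eq ?_
    · exact (hint_soft.const_mul 2).sub hint_tot
    · rw [integral_finsetSum _ fun j _ => hi j]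
      exact Finset.sum_eq_zero fun j _ => h0 j
  rw [integral_sub (hint_soft.const_mul 2) hint_tot,
    integral_add (hint_sum.const_mul δ) ((hint_sq f).const_mul δ⁻¹), integral_const_mul,
    integral_const_mul, integral_const_mul, integral_finsetSum _ fun j _ => hint_sq _] at hle
  simp_rw [norm_toL2_sq]
  have hnn : 0 ≤ ∫ x, softCoulomb y ε x * ‖f x‖ ^ 2 :=
    integral_nonneg fun x => mul_nonneg (softCoulomb_pos y hε x).le (by positivity)
  linarith

theorem enorm_sq_eq_lintegral (ψ : L2) : ‖ψ‖ₑ ^ 2 = ∫⁻ x, ‖ψ x‖ₑ ^ 2 := by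
  have h := eLpNorm_nnreal_pow_eq_lintegral (μ := (volume : Measure Space)) (f := ψ) (p := 2)
    (by norm_num)
  rw [Lp.enorm_def]
  simpa using h

/-- Multiplication by the square root of the regularized Coulomb potential. -/
def sqrtCoulomb (y : Space) (ε : ℝ) (hε : 0 < ε) : L2 →L[ℂ] L2 :=
  mulL2 (fun x => (Real.sqrt (softCoulomb y ε x) : ℂ))
    (Complex.measurable_ofReal.comp (contDiff_softCoulomb y hε).continuous.measurable.sqrt)
    (Real.sqrt ε⁻¹) fun x => by
      rw [Complex.norm_real, Real.norm_of_nonneg (Real.sqrt_nonneg _)]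
      exact Real.sqrt_le_sqrt (softCoulomb_le y hε x)

theorem enorm_sq_sqrtCoulomb (y : Space) {ε : ℝ} (hε : 0 < ε) (ψ : L2) :
    ‖sqrtCoulomb y ε hε ψ‖ₑ ^ 2 = ∫⁻ x, ENNReal.ofReal (softCoulomb y ε x) * ‖ψ x‖ₑ ^ 2 := by
  rw [enorm_sq_eq_lintegral]
  refine lintegral_congr_ae ?_
  filter_upwards [coeFn_mulL2 _ _ ψ] with x hx
  rw [sqrtCoulomb, hx, enorm_mul, mul_pow]
  congr 1
  rw [enorm_sq_eq_ofReal, Complex.norm_real, Real.norm_of_nonneg (Real.sqrt_nonneg _),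
    Real.sq_sqrt (softCoulomb_pos y hε x).le]

theorem norm_sq_sqrtCoulomb_toL2_le (β : ℝ) (f : testFunctions) (y : Space) {ε δ : ℝ} (hε : 0 < ε)
    (hδ : 0 < δ) :
    ‖sqrtCoulomb y ε hε (toL2 f)‖ ^ 2
      ≤ δ * ∑ j, ‖toL2 (momentum β j f)‖ ^ 2 + δ⁻¹ * ‖toL2 f‖ ^ 2 := by
  refine le_trans (le_of_eq ?_) (integral_softCoulomb_le β f y hε hδ)
  have h := enorm_sq_sqrtCoulomb y hε (toL2 f)
  rw [integral_eq_lintegral_of_nonneg_ae]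
  · rw [← toReal_enorm, ← ENNReal.toReal_pow, h]
    congr 1
    refine lintegral_congr_ae ?_
    filter_upwards [coeFn_toL2 f] with x hx
    rw [hx, enorm_sq_eq_ofReal, ← ENNReal.ofReal_mul (softCoulomb_pos y hε x).le]
  · exact Filter.Eventually.of_forall fun x =>
      mul_nonneg (softCoulomb_pos y hε x).le (by positivity)
  · exact ((contDiff_softCoulomb y hε).continuous.mul
      (f.2.differentiable.continuous.norm.pow 2)).aestronglyMeasurable

/-- For `ε > 0` multiplication by the root of the potential is bounded, so the estimate passes from
test functions to the whole form domain. -/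
theorem norm_sq_sqrtCoulomb_le {β : ℝ} {ψ : L2} {g : Fin 3 → L2}
    (hg : ∀ j, IsWeakMomentum β j ψ (g j)) (y : Space) {ε δ : ℝ} (hε : 0 < ε) (hδ : 0 < δ) :
    ‖sqrtCoulomb y ε hε ψ‖ ^ 2 ≤ δ * ∑ j, ‖g j‖ ^ 2 + δ⁻¹ * ‖ψ‖ ^ 2 := by
  obtain ⟨f, hf1, hf2⟩ := exists_seq_test_approx (fun j => Pi.single j 1)
    (fun j => isWeakMomentum_iff_combination.1 (hg j))
  simp_rw [combination_single] at hf2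
  have h1 := (((sqrtCoulomb y ε hε).continuous.tendsto ψ).comp hf1).norm.pow 2
  have h2 := ((tendsto_finsetSum Finset.univ fun j _ => (hf2 j).norm.pow 2).const_mul δ).add
    ((hf1.norm.pow 2).const_mul δ⁻¹)
  exact le_of_tendsto_of_tendsto' h1 h2 fun n => norm_sq_sqrtCoulomb_toL2_le β (f n) y hε hδ

theorem magneticForm_eq {β : ℝ} {ψ : L2} {g : Fin 3 → L2}
    (hg : ∀ j, IsWeakMomentum β j ψ (g j)) :
    magneticForm β ψ = ENNReal.ofReal (∑ j, ‖g j‖ ^ 2) := by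
  rw [magneticForm, ENNReal.ofReal_sum_of_nonneg fun _ _ => by positivity]
  refine Finset.sum_congr rfl fun j _ => ?_
  rw [momentumSq_eq (hg j), enorm_sq_eq_ofReal]

theorem exists_isWeakMomentum_of_magneticForm {β : ℝ} {ψ : L2} (h : magneticForm β ψ ≠ ∞) :
    ∃ g : Fin 3 → L2, ∀ j, IsWeakMomentum β j ψ (g j) := by
  have : ∀ j, ∃ g, IsWeakMomentum β j ψ g := fun j =>
    exists_isWeakMomentum (lt_of_le_of_lt (Finset.single_le_sum (f := fun j => momentumSq β j ψ)
      (fun _ _ => zero_le) (Finset.mem_univ j)) h.lt_top)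
  exact ⟨fun j => (this j).choose, fun j => (this j).choose_spec⟩

theorem lintegral_softCoulomb_le (β : ℝ) (ψ : L2) (y : Space) {ε δ : ℝ} (hε : 0 < ε) (hδ : 0 < δ) :
    ∫⁻ x, ENNReal.ofReal (softCoulomb y ε x) * ‖ψ x‖ₑ ^ 2
      ≤ ENNReal.ofReal δ * magneticForm β ψ + ENNReal.ofReal δ⁻¹ * ‖ψ‖ₑ ^ 2 := by
  by_cases htop : magneticForm β ψ = ∞
  · rw [htop, ENNReal.mul_top (by simpa using hδ), top_add]
    exact le_top
  obtain ⟨g, hg⟩ := exists_isWeakMomentum_of_magneticForm htop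
  rw [← enorm_sq_sqrtCoulomb y hε, magneticForm_eq hg, enorm_sq_eq_ofReal, enorm_sq_eq_ofReal,
    ← ENNReal.ofReal_mul hδ.le, ← ENNReal.ofReal_mul (by positivity),
    ← ENNReal.ofReal_add (by positivity) (by positivity)]
  exact ENNReal.ofReal_le_ofReal (norm_sq_sqrtCoulomb_le hg y hε hδ)

/-- The Coulomb potential with an arbitrary center is form bounded by the magnetic kinetic
energy. -/
theorem lintegral_coulomb_le (β : ℝ) (ψ : L2) (y : Space) {δ : ℝ} (hδ : 0 < δ) :
    ∫⁻ x, ‖ψ x‖ₑ ^ 2 * ‖x - y‖ₑ⁻¹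
      ≤ ENNReal.ofReal δ * magneticForm β ψ + ENNReal.ofReal δ⁻¹ * ‖ψ‖ₑ ^ 2 := by
  have hψ : Measurable fun x => ‖ψ x‖ₑ ^ 2 :=
    (Lp.stronglyMeasurable ψ).measurable.enorm.pow_const 2
  have hlim : ∀ᵐ x, Filter.liminf (fun n : ℕ =>
      ENNReal.ofReal (softCoulomb y (1 / ((n : ℝ) + 1)) x) * ‖ψ x‖ₑ ^ 2) Filter.atTop
      = ‖ψ x‖ₑ ^ 2 * ‖x - y‖ₑ⁻¹ := by
    have hne : ∀ᵐ x : Space, x ≠ y := by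
      simp [ae_iff]
    filter_upwards [hne] with x hx
    have hpos : 0 < ‖x - y‖ := norm_pos_iff.2 (sub_ne_zero.2 hx)
    refine Filter.Tendsto.liminf_eq ?_
    have h1 : Filter.Tendsto (fun n : ℕ => softCoulomb y (1 / ((n : ℝ) + 1)) x) Filter.atTop
        (nhds ‖x - y‖⁻¹) := by
      have h0 := ((tendsto_one_div_add_atTop_nhds_zero_nat (𝕜 := ℝ)).pow 2).const_add (‖x - y‖ ^ 2)
      have h2 := (h0.sqrt).inv₀ (by simpa using hpos.ne')
      simpa [softCoulomb, Real.sqrt_sq hpos.le] using h2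
    have h2 := ENNReal.tendsto_ofReal h1
    rw [mul_comm, ← ofReal_norm (x - y), ← ENNReal.ofReal_inv_of_pos hpos]
    exact ENNReal.Tendsto.mul_const h2 (Or.inr (by simp))
  -- Fatou's lemma with `ε = 1/(n + 1)`: the bound for the regularized potential does not depend on
  -- `ε`.
  rw [← lintegral_congr_ae hlim]
  refine (lintegral_liminf_le fun n => ?_).trans ?_
  · exact ((contDiff_softCoulomb y (by positivity)).continuous.measurable.ennreal_ofReal).mul hψ
  · refine Filter.liminf_le_of_le (by isBoundedDefault) fun b hb => ?_
    obtain ⟨n, hn⟩ := hb.exists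
    exact hn.trans (lintegral_softCoulomb_le β ψ y (by positivity) hδ)

/-! ### The projection onto the lowest Landau band reduces the kinetic energy -/

theorem projLow_mem (β : ℝ) (ψ : L2) : projLow β ψ ∈ lowestLandauBand β :=
  Submodule.starProjection_apply_mem _ _

theorem projLow_eq_self {β : ℝ} {ψ : L2} (h : ψ ∈ lowestLandauBand β) : projLow β ψ = ψ :=
  Submodule.starProjection_eq_self_iff.2 h

theorem projHigh_apply (β : ℝ) (ψ : L2) : projHigh β ψ = ψ - projLow β ψ := rfl

theorem projLow_add_projHigh (β : ℝ) (ψ : L2) : projLow β ψ + projHigh β ψ = ψ := by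
  rw [projHigh_apply, add_sub_cancel]

theorem projHigh_mem (β : ℝ) (ψ : L2) : projHigh β ψ ∈ (lowestLandauBand β)ᗮ :=
  Submodule.sub_starProjection_mem_orthogonal _

theorem inner_projLow_left (β : ℝ) (ψ φ : L2) : ⟪projLow β ψ, φ⟫_ℂ = ⟪ψ, projLow β φ⟫_ℂ :=
  Submodule.inner_starProjection_left_eq_right _ _ _

theorem norm_sq_eq_projLow_add_projHigh (β : ℝ) (ψ : L2) :
    ‖ψ‖ ^ 2 = ‖projLow β ψ‖ ^ 2 + ‖projHigh β ψ‖ ^ 2 := by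
  have h : ⟪projLow β ψ, projHigh β ψ⟫_ℂ = 0 :=
    Submodule.inner_right_of_mem_orthogonal (projLow_mem β ψ) (projHigh_mem β ψ)
  conv_lhs => rw [← projLow_add_projHigh β ψ]
  rw [sq, sq, sq, norm_add_sq_eq_norm_sq_add_norm_sq_of_inner_eq_zero _ _ h]

theorem potential_unitVec_two (j : Fin 3) : potential j (unitVec 2) = 0 := by
  fin_cases j <;> simp [potential]

theorem shift_raising (β t : ℝ) (f : testFunctions) :
    shift (t • unitVec 2) (raising β f) = raising β (shift (t • unitVec 2) f) := by
  simp [raising, shift_momentum, potential_unitVec_two]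

theorem translate_mem_lowestLandauBand {β : ℝ} (t : ℝ) {ψ : L2} (h : ψ ∈ lowestLandauBand β) :
    translate (t • unitVec 2) ψ ∈ lowestLandauBand β := by
  rw [mem_lowestLandauBand_iff] at h ⊢
  intro f
  rw [inner_toL2_translate, ← neg_smul, shift_raising]
  exact h _

theorem inner_translate_left (s : Space) (ψ φ : L2) :
    ⟪translate s ψ, φ⟫_ℂ = ⟪ψ, translate (-s) φ⟫_ℂ := by
  rw [L2.inner_def, L2.inner_def, ← integral_add_right_eq_self _ (-s)]
  have hq := (measurePreserving_add_right (volume : Measure Space) (-s)).quasiMeasurePreserving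
  refine integral_congr_ae ?_
  filter_upwards [hq.ae_eq_comp (coeFn_translate s ψ), coeFn_translate (-s) φ] with x h1 h2
  simp only [Function.comp_apply] at h1
  rw [h1, h2]
  simp

/-- Translations along the field leave `a` unchanged and so preserve the band. Both signs of `t` are
used: the inverse translation is the adjoint, so the orthogonal complement is preserved too. -/
theorem projLow_translate (β t : ℝ) (ψ : L2) :
    projLow β (translate (t • unitVec 2) ψ) = translate (t • unitVec 2) (projLow β ψ) := by
  refine Submodule.eq_starProjection_of_mem_of_inner_eq_zero
    (translate_mem_lowestLandauBand t (projLow_mem β ψ)) fun w hw => ?_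
  rw [← map_sub, inner_translate_left, ← neg_smul]
  refine Submodule.inner_left_of_mem_orthogonal (translate_mem_lowestLandauBand (-t) hw) ?_
  exact projHigh_mem β ψ

theorem momentum_two_apply (β : ℝ) (f : testFunctions) (x : Space) :
    momentum β 2 f x = -Complex.I * fderiv ℝ f x (unitVec 2) := by
  have : potential 2 x = 0 := by simp [potential]
  rw [momentum_apply, momentumFun, this]
  simp

/-- Since `a₂ = 0`, the generator of translations along the field is `iπ₂`. The derivative is taken
under the integral. -/
theorem hasDerivAt_inner_translate (β : ℝ) (f : testFunctions) (v : L2) :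
    HasDerivAt (fun t : ℝ => ⟪v, translate (t • unitVec 2) (toL2 f)⟫_ℂ)
      (Complex.I * ⟪v, toL2 (momentum β 2 f)⟫_ℂ) 0 := by
  obtain ⟨R, hR⟩ := f.2.2.isCompact.isBounded.exists_norm_le
  have hcont : Continuous fun x => fderiv ℝ f x (unitVec 2) :=
    (f.2.1.continuous_fderiv (by simp)).clm_apply continuous_const
  obtain ⟨C, hC⟩ := hcont.bounded_above_of_compact_support (f.2.2.fderiv_apply (𝕜 := ℝ) _)
  -- This ball contains the supports of all translates with `|t| < 1`.
  set B : Set Space := Metric.closedBall 0 (R + 1)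
  have hv : AEStronglyMeasurable (fun x => conj (v x)) volume :=
    Complex.continuous_conj.comp_aestronglyMeasurable (Lp.aestronglyMeasurable v)
  have hline : Continuous fun p : ℝ × Space => p.2 + p.1 • unitVec 2 := by fun_prop
  have hFm : ∀ t : ℝ, AEStronglyMeasurable (fun x => conj (v x) * f (x + t • unitVec 2)) volume :=
    fun t => hv.mul (f.2.1.continuous.comp (by fun_prop)).aestronglyMeasurable
  have key := hasDerivAt_integral_of_dominated_loc_of_deriv_le (μ := (volume : Measure Space))
    (F := fun (t : ℝ) x => conj (v x) * f (x + t • unitVec 2))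
    (F' := fun (t : ℝ) x => conj (v x) * fderiv ℝ f (x + t • unitVec 2) (unitVec 2))
    (x₀ := 0) (s := Metric.ball 0 1) (bound := fun x => B.indicator (fun x => ‖v x‖ * C) x)
    (Metric.ball_mem_nhds _ one_pos) (Filter.Eventually.of_forall hFm) ?_ ?_ ?_ ?_ ?_
  · have h1 : ∀ t : ℝ, ∫ x, conj (v x) * f (x + t • unitVec 2)
        = ⟪v, translate (t • unitVec 2) (toL2 f)⟫_ℂ := by
      intro t
      rw [L2.inner_def]
      have hq := (measurePreserving_add_right (volume : Measure Space)
        (t • unitVec 2)).quasiMeasurePreserving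
      refine integral_congr_ae ?_
      filter_upwards [coeFn_translate (t • unitVec 2) (toL2 f), hq.ae_eq_comp (coeFn_toL2 f)]
        with x h1 h2
      simp only [Function.comp_apply] at h2
      rw [h1, h2, RCLike.inner_apply']
    have h2 : ∫ x, conj (v x) * fderiv ℝ f (x + (0 : ℝ) • unitVec 2) (unitVec 2)
        = Complex.I * ⟪v, toL2 (momentum β 2 f)⟫_ℂ := by
      rw [L2.inner_def, ← integral_const_mul]
      refine integral_congr_ae ?_
      filter_upwards [coeFn_toL2 (momentum β 2 f)] with x hx
      rw [hx, RCLike.inner_apply', momentum_two_apply, zero_smul, add_zero]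
      linear_combination (conj (v x) * fderiv ℝ f x (unitVec 2)) * Complex.I_mul_I
    simp_rw [h1, h2] at key
    exact key.2
  · have := (Lp.memLp v).star.integrable_mul f.2.memLp
    simp only [zero_smul, add_zero]
    exact this
  · exact hv.mul (hcont.comp (by fun_prop)).aestronglyMeasurable
  · refine Filter.Eventually.of_forall fun x t ht => ?_
    rw [norm_mul, RCLike.norm_conj]
    by_cases hx : x ∈ B
    · rw [Set.indicator_of_mem hx]
      gcongr
      exact hC _
    · rw [Set.indicator_of_notMem hx]
      have : fderiv ℝ f (x + t • unitVec 2) = 0 := by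
        by_contra h
        have h3 := hR _ (support_fderiv_subset ℝ h)
        have h4 : ‖t • unitVec 2‖ < 1 := by
          simpa [norm_smul] using ht
        have h5 := norm_sub_le (x + t • unitVec 2) (t • unitVec 2)
        rw [add_sub_cancel_right] at h5
        refine hx ?_
        rw [mem_closedBall_zero_iff]
        linarith
      rw [this]
      simp
  · rw [integrable_indicator_iff Metric.isClosed_closedBall.measurableSet]
    refine Integrable.mul_const ?_ _
    exact ((Lp.memLp v).norm.locallyIntegrable (by norm_num)).integrableOn_isCompact
      (isCompact_closedBall _ _)
  · refine Filter.Eventually.of_forall fun x t _ => ?_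
    have h1 : HasDerivAt (fun t : ℝ => x + t • unitVec 2) (unitVec 2) t := by
      simpa using ((hasDerivAt_id t).smul_const (unitVec 2)).const_add x
    exact (((f.2.differentiable _).hasFDerivAt.comp_hasDerivAt t h1)).const_mul _

/-- Differentiate `⟪Π₀h, f(· + t e₂)⟫ = conj ⟪Π₀f, h(· - t e₂)⟫` at `t = 0`. The derivative always
falls on a test function, so no smoothness of `Π₀f` is needed. -/
theorem isWeakMomentum_projLow_toL2 (β : ℝ) (f : testFunctions) :
    IsWeakMomentum β 2 (projLow β (toL2 f)) (projLow β (toL2 (momentum β 2 f))) := by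
  refine isWeakMomentum_iff.2 fun h => ?_
  have h1 : HasDerivAt (fun t : ℝ => ⟪projLow β (toL2 h), translate (t • unitVec 2) (toL2 f)⟫_ℂ)
      _ 0 := hasDerivAt_inner_translate β f (projLow β (toL2 h))
  have h2 := (hasDerivAt_inner_translate β h (projLow β (toL2 f)))
  have h3 : HasDerivAt (fun t : ℝ => conj ⟪projLow β (toL2 f),
      translate ((-t) • unitVec 2) (toL2 h)⟫_ℂ)
      (-conj (Complex.I * ⟪projLow β (toL2 f), toL2 (momentum β 2 h)⟫_ℂ)) 0 := by
    have h4 : HasDerivAt (fun t : ℝ => ⟪projLow β (toL2 f),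
        translate ((-t) • unitVec 2) (toL2 h)⟫_ℂ)
        (-(Complex.I * ⟪projLow β (toL2 f), toL2 (momentum β 2 h)⟫_ℂ)) 0 := by
      have h5 := HasDerivAt.scomp (0 : ℝ) (h := fun t : ℝ => -t) (by simpa using h2)
        (hasDerivAt_neg (0 : ℝ))
      simpa [Function.comp_def] using h5
    have h6 := Complex.conjCLE.toContinuousLinearMap.hasFDerivAt.comp_hasDerivAt (0 : ℝ) h4
    simpa [Function.comp_def] using h6
  have heq : (fun t : ℝ => conj ⟪projLow β (toL2 f), translate ((-t) • unitVec 2) (toL2 h)⟫_ℂ)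
      = fun t : ℝ => ⟪projLow β (toL2 h), translate (t • unitVec 2) (toL2 f)⟫_ℂ := by
    funext t
    rw [inner_conj_symm, inner_translate_left, inner_projLow_left, projLow_translate, neg_smul,
      neg_neg]
  rw [heq] at h3
  have h7 := h1.unique h3
  rw [map_mul, Complex.conj_I, inner_conj_symm, neg_mul, neg_neg] at h7
  have h8 := mul_left_cancel₀ Complex.I_ne_zero h7
  rw [← inner_projLow_left]
  exact h8

theorem IsWeakMomentum.projLow {β : ℝ} {ψ g : L2} (h : IsWeakMomentum β 2 ψ g) :
    IsWeakMomentum β 2 (projLow β ψ) (projLow β g) := by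
  obtain ⟨f, hf1, hf2⟩ := exists_seq_test_approx (κ := Unit) (fun _ => Pi.single 2 1)
    (g := fun _ => g) (fun _ => isWeakMomentum_iff_combination.1 h)
  replace hf2 := hf2 ()
  simp_rw [combination_single] at hf2
  refine isWeakMomentum_iff.2 fun p => ?_
  have h1 := ((MagneticHartree.projLow β).continuous.tendsto ψ).comp hf1
  have h2 := ((MagneticHartree.projLow β).continuous.tendsto g).comp hf2
  refine tendsto_nhds_unique ((tendsto_const_nhds (x := toL2 p)).inner (𝕜 := ℂ) h2) ?_
  have h3 := (tendsto_const_nhds (x := toL2 (momentum β 2 p))).inner (𝕜 := ℂ) h1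
  refine h3.congr fun n => ?_
  exact (isWeakMomentum_iff.1 (isWeakMomentum_projLow_toL2 β (f n)) p).symm

theorem momentumSq_add_of_isWeakLowering {β : ℝ} (hβ : 0 ≤ β) {ψ g : L2} (h : IsWeakLowering β ψ g) :
    momentumSq β 0 ψ + momentumSq β 1 ψ = ‖g‖ₑ ^ 2 + ENNReal.ofReal β * ‖ψ‖ₑ ^ 2 := by
  obtain ⟨g₀, g₁, h₀, h₁, hid⟩ := h.exists_isWeakMomentum
  rw [momentumSq_eq h₀, momentumSq_eq h₁]
  simp_rw [enorm_sq_eq_ofReal]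
  rw [← ENNReal.ofReal_mul hβ, ← ENNReal.ofReal_add (by positivity) (by positivity),
    ← ENNReal.ofReal_add (by positivity) (by positivity), hid]

theorem magneticForm_eq_of_mem {β : ℝ} (hβ : 0 ≤ β) {ψ : L2} (h : ψ ∈ lowestLandauBand β) :
    magneticForm β ψ = ENNReal.ofReal β * ‖ψ‖ₑ ^ 2 + momentumSq β 2 ψ := by
  rw [magneticForm, Fin.sum_univ_three, momentumSq_add_of_isWeakLowering hβ
    (mem_lowestLandauBand_iff_isWeakLowering.1 h)]
  simp

theorem IsWeakMomentum.sub {β : ℝ} {j : Fin 3} {ψ φ g h : L2} (hψ : IsWeakMomentum β j ψ g)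
    (hφ : IsWeakMomentum β j φ h) : IsWeakMomentum β j (ψ - φ) (g - h) :=
  isWeakMomentum_iff.2 fun f => by
    rw [inner_sub_right, inner_sub_right, isWeakMomentum_iff.1 hψ, isWeakMomentum_iff.1 hφ]

theorem IsWeakCombination.sub {β : ℝ} {c : Fin 3 → ℂ} {ψ φ g h : L2}
    (hψ : IsWeakCombination β c ψ g) (hφ : IsWeakCombination β c φ h) :
    IsWeakCombination β c (ψ - φ) (g - h) := fun f => by
  rw [inner_sub_right, inner_sub_right, hψ, hφ]

theorem enorm_sq_eq_projLow_add_projHigh (β : ℝ) (ψ : L2) :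
    ‖ψ‖ₑ ^ 2 = ‖projLow β ψ‖ₑ ^ 2 + ‖projHigh β ψ‖ₑ ^ 2 := by
  simp_rw [enorm_sq_eq_ofReal]
  rw [norm_sq_eq_projLow_add_projHigh β ψ, ENNReal.ofReal_add (by positivity) (by positivity)]

/-- The perpendicular form is `‖(π₀ - iπ₁)ψ‖² + β‖ψ‖²`. The first term sees only `Π_>ψ`, since `π₀ -
iπ₁` annihilates the band, and the second splits by Pythagoras. The parallel form splits because
`π₂` commutes with `Π₀`. -/
theorem magneticForm_eq_projLow_add_projHigh {β : ℝ} (hβ : 0 ≤ β) {ψ : L2}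
    (h : magneticForm β ψ ≠ ∞) :
    magneticForm β ψ = magneticForm β (projLow β ψ) + magneticForm β (projHigh β ψ) := by
  obtain ⟨g, hg⟩ := exists_isWeakMomentum_of_magneticForm h
  have hl := isWeakLowering_of_isWeakMomentum (hg 0) (hg 1)
  have h0 := mem_lowestLandauBand_iff_isWeakLowering.1 (projLow_mem β ψ)
  have hh := hl.sub h0
  rw [sub_zero] at hh
  have e2 : momentumSq β 2 ψ = momentumSq β 2 (projLow β ψ) + momentumSq β 2 (projHigh β ψ) := by
    rw [momentumSq_eq (hg 2), momentumSq_eq (hg 2).projLow, projHigh_apply,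
      momentumSq_eq ((hg 2).sub (hg 2).projLow), ← projHigh_apply,
      enorm_sq_eq_projLow_add_projHigh β]
  rw [magneticForm_eq_of_mem hβ (projLow_mem β ψ), magneticForm, magneticForm, Fin.sum_univ_three,
    Fin.sum_univ_three, momentumSq_add_of_isWeakLowering hβ hl, e2, projHigh_apply,
    momentumSq_add_of_isWeakLowering hβ hh, ← projHigh_apply, enorm_sq_eq_projLow_add_projHigh β ψ]
  ring

/-- `3β` is the gap `2β` plus the lowest level `β`. -/
theorem le_magneticForm_projHigh {β : ℝ} (hβ : 0 < β) (ψ : L2) :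
    ENNReal.ofReal (3 * β) * ‖projHigh β ψ‖ₑ ^ 2 ≤ magneticForm β (projHigh β ψ) := by
  by_cases h : magneticForm β (projHigh β ψ) = ∞
  · rw [h]; exact le_top
  obtain ⟨g, hg⟩ := exists_isWeakMomentum_of_magneticForm h
  have hl := isWeakLowering_of_isWeakMomentum (hg 0) (hg 1)
  have hgap := two_mul_norm_sq_le_of_mem_orthogonal hβ (projHigh_mem β ψ) hl
  rw [magneticForm, Fin.sum_univ_three, momentumSq_add_of_isWeakLowering hβ.le hl]
  refine le_trans ?_ le_self_add
  simp_rw [enorm_sq_eq_ofReal]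
  rw [← ENNReal.ofReal_mul (by positivity), ← ENNReal.ofReal_mul (by positivity),
    ← ENNReal.ofReal_add (by positivity) (by positivity)]
  exact ENNReal.ofReal_le_ofReal (by linarith)

theorem le_magneticForm {β : ℝ} (hβ : 0 ≤ β) (ψ : L2) :
    ENNReal.ofReal β * ‖ψ‖ₑ ^ 2 ≤ magneticForm β ψ := by
  by_cases h : magneticForm β ψ = ∞
  · rw [h]; exact le_top
  obtain ⟨g, hg⟩ := exists_isWeakMomentum_of_magneticForm h
  have hl := isWeakLowering_of_isWeakMomentum (hg 0) (hg 1)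
  rw [magneticForm, Fin.sum_univ_three, momentumSq_add_of_isWeakLowering hβ hl]
  exact le_trans le_add_self le_self_add

/-! ### Dilations along the magnetic field -/

/-- The dilation `(x₀, x₁, x₂) ↦ (x₀, x₁, s x₂)`. -/
def stretch (s : ℝ) : Space →L[ℝ] Space :=
  ContinuousLinearMap.id ℝ Space
    + (s - 1) • (EuclideanSpace.proj (𝕜 := ℝ) 2 : Space →L[ℝ] ℝ).smulRight (unitVec 2)

theorem stretch_apply (s : ℝ) (x : Space) (j : Fin 3) :
    stretch s x j = if j = 2 then s * x j else x j := by
  fin_cases j <;> simp [stretch]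
  ring

theorem stretch_stretch (s t : ℝ) (x : Space) : stretch s (stretch t x) = stretch (s * t) x := by
  ext j
  simp only [stretch_apply]
  split_ifs <;> ring

theorem stretch_one (x : Space) : stretch 1 x = x := by
  ext j
  simp [stretch_apply]

theorem norm_sq_stretch (s : ℝ) (x : Space) :
    ‖stretch s x‖ ^ 2 = x 0 ^ 2 + x 1 ^ 2 + s ^ 2 * x 2 ^ 2 := by
  rw [EuclideanSpace.norm_sq_eq, Fin.sum_univ_three]
  simp [stretch_apply, mul_pow]

theorem norm_le_norm_stretch {s : ℝ} (hs : 1 ≤ s) (x : Space) : ‖x‖ ≤ ‖stretch s x‖ := by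
  refine abs_le_of_sq_le_sq' ?_ (norm_nonneg _) |>.2
  have h := norm_sq_stretch 1 x
  rw [stretch_one] at h
  rw [h, norm_sq_stretch]
  have h2 : (1 : ℝ) ^ 2 ≤ s ^ 2 := by gcongr
  gcongr

theorem norm_stretch_le {s : ℝ} (hs : 1 ≤ s) (x : Space) : ‖stretch s x‖ ≤ s * ‖x‖ := by
  refine abs_le_of_sq_le_sq' ?_ (by positivity) |>.2
  have h := norm_sq_stretch 1 x
  rw [stretch_one] at h
  rw [mul_pow, h, norm_sq_stretch]
  have h2 : 1 ≤ s ^ 2 := one_le_pow₀ hs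
  nlinarith [mul_le_mul_of_nonneg_right h2 (sq_nonneg (x 0)),
    mul_le_mul_of_nonneg_right h2 (sq_nonneg (x 1))]

theorem abs_mul_le_norm_stretch (s : ℝ) (x : Space) :
    s * |x 2| ≤ ‖stretch s x‖ := by
  refine abs_le_of_sq_le_sq' ?_ (norm_nonneg _) |>.2
  rw [mul_pow, sq_abs, norm_sq_stretch]
  nlinarith [sq_nonneg (x 0), sq_nonneg (x 1)]

/-- A dilation along the field as a homeomorphism. -/
def stretchHomeomorph (s : ℝ) (hs : 0 < s) : Space ≃ₜ Space where
  toFun := stretch s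
  invFun := stretch s⁻¹
  left_inv x := by rw [stretch_stretch, inv_mul_cancel₀ hs.ne', stretch_one]
  right_inv x := by rw [stretch_stretch, mul_inv_cancel₀ hs.ne', stretch_one]
  continuous_toFun := (stretch s).continuous
  continuous_invFun := (stretch s⁻¹).continuous

theorem measurableEmbedding_stretch {s : ℝ} (hs : 0 < s) : MeasurableEmbedding (stretch s) :=
  (stretchHomeomorph s hs).measurableEmbedding

theorem det_stretch (s : ℝ) : LinearMap.det (stretch s : Space →ₗ[ℝ] Space) = s := by
  have h : (stretch s : Space →ₗ[ℝ] Space)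
      = Matrix.toLin (EuclideanSpace.basisFun (Fin 3) ℝ).toBasis
          (EuclideanSpace.basisFun (Fin 3) ℝ).toBasis (Matrix.diagonal ![1, 1, s]) := by
    refine (EuclideanSpace.basisFun (Fin 3) ℝ).toBasis.ext fun j => ?_
    rw [Matrix.toLin_self]
    ext k
    fin_cases j <;> fin_cases k <;>
      simp [stretch, Matrix.diagonal]
  rw [h, LinearMap.det_toLin, Matrix.det_diagonal, Fin.prod_univ_three]
  simp

theorem map_stretch {s : ℝ} (hs : 0 < s) :
    Measure.map (stretch s) (volume : Measure Space) = ENNReal.ofReal s⁻¹ • volume := by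
  have h := Measure.map_linearMap_addHaar_eq_smul_addHaar (volume : Measure Space)
    (f := (stretch s : Space →ₗ[ℝ] Space)) (by rw [det_stretch]; exact hs.ne')
  rw [det_stretch, abs_of_pos (inv_pos.2 hs)] at h
  exact h

theorem lintegral_comp_stretch {s : ℝ} (hs : 0 < s) (F : Space → ℝ≥0∞) :
    ∫⁻ x, F (stretch s x) = ENNReal.ofReal s⁻¹ * ∫⁻ x, F x := by
  rw [← (measurableEmbedding_stretch hs).lintegral_map, map_stretch hs, lintegral_smul_measure,
    smul_eq_mul]

theorem integral_comp_stretch {s : ℝ} (hs : 0 < s) (F : Space → ℂ) :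
    ∫ x, F (stretch s x) = s⁻¹ * ∫ x, F x := by
  rw [← (measurableEmbedding_stretch hs).integral_map, map_stretch hs, integral_smul_measure,
    ENNReal.toReal_ofReal (inv_pos.2 hs).le, Complex.real_smul, Complex.ofReal_inv]

theorem quasiMeasurePreserving_stretch {s : ℝ} (hs : 0 < s) :
    Measure.QuasiMeasurePreserving (stretch s) (volume : Measure Space) volume :=
  ⟨(stretch s).continuous.measurable, by
    rw [map_stretch hs]
    exact Measure.smul_absolutelyContinuous⟩

theorem memLp_dilate {s : ℝ} (hs : 0 < s) (ψ : L2) :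
    MemLp (fun x => (Real.sqrt s : ℂ) * ψ (stretch s x)) 2 (volume : Measure Space) := by
  refine MemLp.const_mul ?_ _
  refine MemLp.comp_of_map (g := ψ) ?_ (stretch s).continuous.aemeasurable
  rw [map_stretch hs]
  exact (Lp.memLp ψ).smul_measure ENNReal.ofReal_ne_top

theorem enorm_sq_toLp_dilate {s : ℝ} (hs : 0 < s) (ψ : L2) :
    ‖(memLp_dilate hs ψ).toLp _‖ₑ ^ 2 = ‖ψ‖ₑ ^ 2 := by
  rw [enorm_sq_eq_lintegral, enorm_sq_eq_lintegral]
  have h : ∫⁻ x, ‖(memLp_dilate hs ψ).toLp _ x‖ₑ ^ 2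
      = ∫⁻ x, ENNReal.ofReal s * ‖ψ (stretch s x)‖ₑ ^ 2 := by
    refine lintegral_congr_ae ?_
    filter_upwards [(memLp_dilate hs ψ).coeFn_toLp] with x hx
    rw [hx, enorm_mul, mul_pow, enorm_sq_eq_ofReal (Real.sqrt s : ℂ), Complex.norm_real,
      Real.norm_of_nonneg (Real.sqrt_nonneg _), Real.sq_sqrt hs.le]
  rw [h, lintegral_const_mul' _ _ ENNReal.ofReal_ne_top,
    lintegral_comp_stretch hs fun x => ‖ψ x‖ₑ ^ 2, ← mul_assoc, ← ENNReal.ofReal_mul hs.le,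
    mul_inv_cancel₀ hs.ne', ENNReal.ofReal_one, one_mul]

/-- The unitary dilation `ψ ↦ s^{1/2} ψ(x₀, x₁, s x₂)`. -/
def dilate (s : ℝ) (hs : 0 < s) : L2 →L[ℂ] L2 :=
  LinearMap.mkContinuous
    { toFun := fun ψ => (memLp_dilate hs ψ).toLp _
      map_add' := fun ψ φ => by
        have hq := quasiMeasurePreserving_stretch hs
        refine Lp.ext ?_
        filter_upwards [MemLp.coeFn_toLp (memLp_dilate hs (ψ + φ)),
          MemLp.coeFn_toLp (memLp_dilate hs ψ), MemLp.coeFn_toLp (memLp_dilate hs φ),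
          hq.ae_eq_comp (Lp.coeFn_add ψ φ), Lp.coeFn_add ((memLp_dilate hs ψ).toLp _)
            ((memLp_dilate hs φ).toLp _)] with x h1 h2 h3 h4 h5
        simp only [Function.comp_apply] at h4
        rw [h1, h5, Pi.add_apply, h2, h3, h4, Pi.add_apply, mul_add]
      map_smul' := fun c ψ => by
        have hq := quasiMeasurePreserving_stretch hs
        refine Lp.ext ?_
        filter_upwards [MemLp.coeFn_toLp (memLp_dilate hs (c • ψ)),
          MemLp.coeFn_toLp (memLp_dilate hs ψ), hq.ae_eq_comp (Lp.coeFn_smul c ψ),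
          Lp.coeFn_smul c ((memLp_dilate hs ψ).toLp _)] with x h1 h2 h3 h4
        simp only [Function.comp_apply] at h3
        rw [h1, RingHom.id_apply, h4, Pi.smul_apply, h2, h3, Pi.smul_apply, smul_eq_mul,
          smul_eq_mul, mul_left_comm] }
    1 fun ψ => by
      have h := enorm_sq_toLp_dilate hs ψ
      rw [enorm_sq_eq_ofReal, enorm_sq_eq_ofReal,
        ENNReal.ofReal_eq_ofReal_iff (by positivity) (by positivity),
        sq_eq_sq₀ (norm_nonneg _) (norm_nonneg _)] at h
      rw [one_mul]
      exact h.le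

theorem coeFn_dilate {s : ℝ} (hs : 0 < s) (ψ : L2) :
    dilate s hs ψ =ᵐ[volume] fun x => (Real.sqrt s : ℂ) * ψ (stretch s x) :=
  (memLp_dilate hs ψ).coeFn_toLp

theorem enorm_sq_dilate {s : ℝ} (hs : 0 < s) (ψ : L2) : ‖dilate s hs ψ‖ₑ ^ 2 = ‖ψ‖ₑ ^ 2 :=
  enorm_sq_toLp_dilate hs ψ

/-- The dilation of a test function. -/
def dilateTest (s : ℝ) (hs : 0 < s) : testFunctions →ₗ[ℂ] testFunctions where
  toFun f := ⟨fun x => (Real.sqrt s : ℂ) * f (stretch s x),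
    contDiff_const.mul (f.2.1.comp (stretch s).contDiff),
    (f.2.2.comp_homeomorph (stretchHomeomorph s hs)).mul_left⟩
  map_add' f g := Subtype.ext (funext fun x => by simp [mul_add])
  map_smul' c f := Subtype.ext (funext fun x => by simp [mul_left_comm])

theorem inner_toL2_dilate {s : ℝ} (hs : 0 < s) (f : testFunctions) (ψ : L2) :
    ⟪toL2 f, dilate s hs ψ⟫_ℂ = ⟪toL2 (dilateTest s⁻¹ (inv_pos.2 hs) f), ψ⟫_ℂ := by
  rw [inner_toL2_left, inner_toL2_left]
  have h1 : ∫ x, dilate s hs ψ x * conj (f x)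
      = ∫ x, (fun y => (Real.sqrt s : ℂ) * (ψ y * conj (f (stretch s⁻¹ y)))) (stretch s x) := by
    refine integral_congr_ae ?_
    filter_upwards [coeFn_dilate hs ψ] with x hx
    simp only [hx, stretch_stretch, inv_mul_cancel₀ hs.ne', stretch_one]
    ring
  rw [h1, integral_comp_stretch hs fun y => (Real.sqrt s : ℂ) * (ψ y * conj (f (stretch s⁻¹ y))),
    ← integral_const_mul]
  refine integral_congr_ae (Filter.Eventually.of_forall fun x => ?_)
  have h2 : (Real.sqrt s⁻¹ : ℝ) = s⁻¹ * Real.sqrt s := by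
    rw [Real.sqrt_inv]
    field_simp
    rw [Real.sq_sqrt hs.le]
  simp only [dilateTest, LinearMap.coe_mk, AddHom.coe_mk, map_mul, Complex.conj_ofReal, h2]
  push_cast
  ring

theorem momentum_dilateTest (β : ℝ) (j : Fin 3) {s : ℝ} (hs : 0 < s) (f : testFunctions) :
    momentum β j (dilateTest s hs f)
      = (if j = 2 then (s : ℂ) else 1) • dilateTest s hs (momentum β j f) := by
  refine Subtype.ext (funext fun x => ?_)
  change momentumFun β j (fun y => (Real.sqrt s : ℂ) * f (stretch s y)) x
    = (if j = 2 then (s : ℂ) else 1) * ((Real.sqrt s : ℂ) * momentumFun β j f (stretch s x))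
  have h1 : HasFDerivAt (fun y => f (stretch s y)) ((fderiv ℝ f (stretch s x)).comp (stretch s)) x :=
    (f.2.differentiable (stretch s x)).hasFDerivAt.comp x (stretch s).hasFDerivAt
  have h2 : stretch s (unitVec j) = (if j = 2 then s else 1) • unitVec j := by
    ext k
    rw [stretch_apply]
    fin_cases j <;> fin_cases k <;> simp
  have h3 : (potential j (stretch s x) : ℝ) = potential j x := by
    fin_cases j <;> simp [potential, stretch_apply]
  have h4 : j = 2 → potential j x = 0 := by
    rintro rfl
    simp [potential]
  simp only [momentumFun]
  rw [(h1.const_mul (Real.sqrt s : ℂ)).fderiv, h3]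
  simp only [smul_apply, ContinuousLinearMap.comp_apply, h2, map_smul, Complex.real_smul,
    smul_eq_mul]
  split_ifs with hj
  · rw [h4 hj]
    push_cast
    ring
  · push_cast
    ring

/-- `π₀` and `π₁` do not involve the coordinate along the field, so the dilation commutes with them.
-/
theorem dilate_mem_lowestLandauBand {β s : ℝ} (hs : 0 < s) {ψ : L2} (h : ψ ∈ lowestLandauBand β) :
    dilate s hs ψ ∈ lowestLandauBand β := by
  rw [mem_lowestLandauBand_iff] at h ⊢
  intro f
  have hr : dilateTest s⁻¹ (inv_pos.2 hs) (raising β f)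
      = raising β (dilateTest s⁻¹ (inv_pos.2 hs) f) := by
    simp [raising, momentum_dilateTest]
  rw [inner_toL2_dilate, hr]
  exact h _

theorem IsWeakMomentum.dilate {β s : ℝ} (hs : 0 < s) {ψ g : L2} (h : IsWeakMomentum β 2 ψ g) :
    IsWeakMomentum β 2 (dilate s hs ψ) ((s : ℂ) • dilate s hs g) := by
  refine isWeakMomentum_iff.2 fun f => ?_
  have h1 := isWeakMomentum_iff.1 h (dilateTest s⁻¹ (inv_pos.2 hs) f)
  rw [momentum_dilateTest, if_pos rfl, map_smul, inner_smul_left, ← inner_toL2_dilate hs,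
    ← inner_toL2_dilate hs] at h1
  rw [inner_smul_right, h1, ← mul_assoc]
  have : (s : ℂ) ≠ 0 := by exact_mod_cast hs.ne'
  simp [this]

theorem momentumSq_dilate_le (β : ℝ) {s : ℝ} (hs : 0 < s) (ψ : L2) :
    momentumSq β 2 (dilate s hs ψ) ≤ ENNReal.ofReal (s ^ 2) * momentumSq β 2 ψ := by
  rcases eq_or_ne (momentumSq β 2 ψ) ∞ with h | h
  · rw [h, ENNReal.mul_top (by simpa using hs.ne')]
    exact le_top
  obtain ⟨g, hg⟩ := exists_isWeakMomentum h.lt_top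
  rw [momentumSq_eq hg, momentumSq_eq (hg.dilate hs), enorm_smul, mul_pow, enorm_sq_dilate,
    enorm_sq_eq_ofReal (s : ℂ)]
  simp

/-! ### A Gaussian in the lowest Landau band -/

theorem hasFDerivAt_gaussian (β : ℝ) (x : Space) :
    HasFDerivAt (fun x : Space => (Real.exp (-(β / 4) * ‖x‖ ^ 2) : ℂ))
      (Complex.ofRealCLM.comp (Real.exp (-(β / 4) * ‖x‖ ^ 2) • (-(β / 2)) • innerSL ℝ x)) x := by
  have h1 : HasFDerivAt (fun x : Space => -(β / 4) * ‖x‖ ^ 2)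
      (-(β / 4) • (2 • (innerSL ℝ x).comp (ContinuousLinearMap.id ℝ Space))) x :=
    ((hasFDerivAt_id x).norm_sq).const_mul _
  have h2 := Complex.ofRealCLM.hasFDerivAt.comp x h1.exp
  refine h2.congr_fderiv ?_
  ext v
  simp
  ring_nf

theorem contDiff_gaussian (β : ℝ) :
    ContDiff ℝ 1 fun x : Space => (Real.exp (-(β / 4) * ‖x‖ ^ 2) : ℂ) :=
  Complex.ofRealCLM.contDiff.comp (Real.contDiff_exp.comp (contDiff_const.mul (contDiff_norm_sq ℝ)))

theorem momentumFun_gaussian (β : ℝ) (j : Fin 3) (x : Space) :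
    momentumFun β j (fun x : Space => (Real.exp (-(β / 4) * ‖x‖ ^ 2) : ℂ)) x
      = (Complex.I * (β / 2 * x j : ℝ) + (β * potential j x : ℝ))
        * (Real.exp (-(β / 4) * ‖x‖ ^ 2) : ℂ) := by
  rw [momentumFun, (hasFDerivAt_gaussian β x).fderiv]
  have h : ⟪x, unitVec j⟫_ℝ = x j := by simp [unitVec, EuclideanSpace.inner_single_right]
  simp only [ContinuousLinearMap.comp_apply, smul_apply, innerSL_apply_apply, h, smul_eq_mul,
    Complex.ofRealCLM_apply]
  push_cast
  ring

theorem memLp_gaussian {b : ℝ} (hb : 0 < b) :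
    MemLp (fun x : Space => (Real.exp (-b * ‖x‖ ^ 2) : ℂ)) 2 (volume : Measure Space) := by
  have hc : Continuous fun x : Space => (Real.exp (-b * ‖x‖ ^ 2) : ℂ) := by fun_prop
  rw [← memLp_norm_iff hc.aestronglyMeasurable,
    memLp_two_iff_integrable_sq hc.norm.aestronglyMeasurable]
  have h := (GaussianFourier.integrable_cexp_neg_mul_sq_norm_add (V := Space) (b := ((2 * b : ℝ) : ℂ))
    (by simpa using hb) 0 0).norm
  refine h.congr (Filter.Eventually.of_forall fun x => ?_)
  simp only [Complex.norm_exp, Complex.norm_real, Real.norm_eq_abs, Real.abs_exp]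
  rw [← Real.exp_nat_mul]
  congr 1
  simp [← Complex.ofReal_pow]
  ring

/-- The witness is `exp(-β|x|²/4)`: its perpendicular factor is annihilated by `π₀ - iπ₁`, and the
factor in `x₂` provides decay. -/
theorem exists_ne_zero_mem_lowestLandauBand {β : ℝ} (hβ : 0 < β) :
    ∃ ψ ∈ lowestLandauBand β, ψ ≠ 0 ∧ momentumSq β 2 ψ ≠ ∞ := by
  set G : Space → ℂ := fun x => (Real.exp (-(β / 4) * ‖x‖ ^ 2) : ℂ) with hG
  have hGm : MemLp G 2 (volume : Measure Space) := memLp_gaussian (by positivity)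
  have hpair : ∀ (j : Fin 3) (f : testFunctions),
      ⟪toL2 (momentum β j f), hGm.toLp G⟫_ℂ = ∫ x, momentumFun β j G x * conj (f x) := by
    intro j f
    rw [inner_toL2_left, ← integral_conj_momentumFun β j f.2 (contDiff_gaussian β)]
    refine integral_congr_ae ?_
    filter_upwards [hGm.coeFn_toLp] with x hx
    rw [hx]
    rfl
  have hcm : ∀ j, Continuous (momentumFun β j G) := by
    intro j
    have : momentumFun β j G = fun x => (Complex.I * (β / 2 * x j : ℝ) + (β * potential j x : ℝ))
        * (Real.exp (-(β / 4) * ‖x‖ ^ 2) : ℂ) := funext (momentumFun_gaussian β j)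
    rw [this]
    fun_prop
  refine ⟨hGm.toLp G, ?_, ?_, ?_⟩
  · rw [mem_lowestLandauBand_iff]
    intro f
    have h1 : toL2 (raising β f) = toL2 (momentum β 0 f) + Complex.I • toL2 (momentum β 1 f) := by
      simp [raising]
    have hint : ∀ j, Integrable fun x => momentumFun β j G x * conj (f x) := fun j =>
      ((hcm j).mul f.2.conj.1.continuous).integrable_of_hasCompactSupport f.2.conj.2.mul_left
    rw [h1, inner_add_left, inner_smul_left, hpair, hpair, ← integral_const_mul,
      ← integral_add (hint 0) ((hint 1).const_mul _)]
    refine integral_eq_zero_of_ae (Filter.Eventually.of_forall fun x => ?_)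
    have e0 : potential 0 x = -(x 1) / 2 := by simp [potential]; ring
    have e1 : potential 1 x = x 0 / 2 := by simp [potential]; ring
    simp only [hG, momentumFun_gaussian, e0, e1, Complex.conj_I, Pi.zero_apply]
    push_cast
    linear_combination (-(β / 2 * x 1 : ℂ) * Complex.exp (-(β / 4) * (‖x‖ : ℂ) ^ 2) * conj (f x))
      * Complex.I_mul_I
  · intro h0
    have h1 : G =ᵐ[volume] fun _ => 0 :=
      hGm.coeFn_toLp.symm.trans ((Lp.eq_zero_iff_ae_eq_zero).1 h0)
    obtain ⟨x, hx⟩ := h1.exists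
    simp [hG] at hx
  -- `π₂G` is `(iβ/2) x₂ G`. Half of the exponent absorbs the factor `x₂`; the other half is square
  -- integrable.
  · have hm : MemLp (momentumFun β 2 G) 2 (volume : Measure Space) := by
      refine (memLp_gaussian (b := β / 8) (by positivity)).of_le_mul (c := β / 2 * (1 + 8 / β))
        (hcm 2).aestronglyMeasurable (Filter.Eventually.of_forall fun x => ?_)
      have e2 : potential 2 x = 0 := by simp [potential]
      rw [hG, momentumFun_gaussian, e2]
      simp only [mul_zero, Complex.ofReal_zero, add_zero, norm_mul, Complex.norm_I, one_mul,
        Complex.norm_real, Real.norm_eq_abs, Real.abs_exp]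
      rw [abs_of_pos (half_pos hβ)]
      have hx2 : |x 2| ≤ ‖x‖ := by simpa using PiLp.norm_apply_le x 2
      have hexp : Real.exp (-(β / 4) * ‖x‖ ^ 2)
          = Real.exp (-(β / 8) * ‖x‖ ^ 2) * Real.exp (-(β / 8) * ‖x‖ ^ 2) := by
        rw [← Real.exp_add]
        ring_nf
      have hb : |x 2| * Real.exp (-(β / 8) * ‖x‖ ^ 2) ≤ 1 + 8 / β := by
        rw [neg_mul, Real.exp_neg, ← div_eq_mul_inv, div_le_iff₀ (Real.exp_pos _)]
        have h3 := Real.add_one_le_exp (β / 8 * ‖x‖ ^ 2)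
        have h4 : 8 / β * (β / 8 * ‖x‖ ^ 2) = ‖x‖ ^ 2 := by field_simp
        have h5 : 0 < 8 / β := by positivity
        nlinarith [sq_nonneg (‖x‖ - 1), norm_nonneg x, mul_le_mul_of_nonneg_left h3 h5.le,
          mul_nonneg (half_pos hβ).le (sq_nonneg ‖x‖)]
      rw [hexp]
      calc β / 2 * |x 2| * (Real.exp (-(β / 8) * ‖x‖ ^ 2) * Real.exp (-(β / 8) * ‖x‖ ^ 2))
          = β / 2 * (|x 2| * Real.exp (-(β / 8) * ‖x‖ ^ 2)) * Real.exp (-(β / 8) * ‖x‖ ^ 2) := by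
            ring
        _ ≤ _ := by gcongr
    have hw : IsWeakMomentum β 2 (hGm.toLp G) (hm.toLp _) := by
      refine isWeakMomentum_iff.2 fun f => ?_
      rw [hpair, inner_toL2_left]
      refine integral_congr_ae ?_
      filter_upwards [hm.coeFn_toLp] with x hx
      rw [hx]
    rw [momentumSq_eq hw]
    exact ENNReal.pow_ne_top enorm_ne_top

/-! ### Independence of the factorization `Γ = T T*` -/

instance : TopologicalSpace.SeparableSpace L2 :=
  haveI : Fact ((2 : ℝ≥0∞) ≠ ∞) := ⟨by simp⟩
  haveI : SecondCountableTopology L2 := Lp.SecondCountableTopology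
  inferInstance

instance : Countable basisIndex := HilbertBasis.countable onb

/-- `∑ᵢ ‖T eᵢ‖²`. -/
def mass (T : L2 →L[ℂ] L2) : ℝ≥0∞ := ∑' i, ‖T (onb i)‖ₑ ^ 2

/-- `∑ᵢ ⟨T eᵢ, H_β T eᵢ⟩`. -/
def kinetic (β : ℝ) (T : L2 →L[ℂ] L2) : ℝ≥0∞ := ∑' i, magneticForm β (T (onb i))

/-- `∑ᵢ |T eᵢ (x)|²`. -/
def frameDensity (T : L2 →L[ℂ] L2) (x : Space) : ℝ≥0∞ := ∑' i, ‖T (onb i) x‖ₑ ^ 2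

/-- The Hartree energy of `T T*`. -/
def frameEnergy (β : ℝ) (T : L2 →L[ℂ] L2) : ℝ :=
  ((kinetic β T).toReal - β * (mass T).toReal)
    - (attraction (frameDensity T)).toReal + (repulsion (frameDensity T)).toReal

/-- The graph of `πⱼ` on test functions lies in `L² × L²`, and weak momenta are values of its
adjoint. Symmetry makes `πⱼ` well defined on classes. -/
theorem exists_tsum_eq_momentumSq (β : ℝ) (j : Fin 3) :
    ∃ (s : Set L2) (w : s → L2), ∀ ψ : L2, momentumSq β j ψ = ∑' k, ‖⟪w k, ψ⟫_ℂ‖ₑ ^ 2 := by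
  obtain ⟨s, w, hw⟩ := exists_tsum_enorm_inner_sq_eq_iInf (H := L2)
    (LinearMap.range (toL2.prod (toL2 ∘ₗ momentum β j))) (by
      rintro _ ⟨f, rfl⟩ hf
      change toL2 f = 0 at hf
      change toL2 (momentum β j f) = 0
      refine eq_of_forall_inner_toL2 fun g => ?_
      rw [← inner_momentum, hf, inner_zero_right, inner_zero_right])
  refine ⟨s, w, fun ψ => ?_⟩
  rw [← hw, momentumSq]
  refine iInf_congr fun g => ?_
  have : IsWeakMomentum β j ψ g ↔ ∀ p ∈ LinearMap.range (toL2.prod (toL2 ∘ₗ momentum β j)),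
      ⟪p.1, g⟫_ℂ = ⟪p.2, ψ⟫_ℂ := by
    rw [isWeakMomentum_iff]
    refine ⟨?_, fun h f => h _ ⟨f, rfl⟩⟩
    rintro h _ ⟨f, rfl⟩
    exact h f
  rw [iInf_congr_Prop this fun _ => rfl]

/-- Each `‖πⱼψ‖²` is a sum of squares of bounded functionals. After exchanging sums, every
functional contributes a quantity that only depends on `T T*`. -/
theorem kinetic_eq (β : ℝ) {S T : L2 →L[ℂ] L2} (h : S ∘L S.adjoint = T ∘L T.adjoint) :
    kinetic β S = kinetic β T := by
  have key : ∀ j, ∑' i, momentumSq β j (S (onb i)) = ∑' i, momentumSq β j (T (onb i)) := by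
    intro j
    obtain ⟨s, w, hw⟩ := exists_tsum_eq_momentumSq β j
    simp_rw [hw]
    rw [ENNReal.tsum_comm, ENNReal.tsum_comm (f := fun i k => ‖⟪w k, T (onb i)⟫_ℂ‖ₑ ^ 2)]
    exact tsum_congr fun k => tsum_enorm_sq_inner_eq onb (w k) h
  simp only [kinetic, magneticForm, Fin.sum_univ_three, ENNReal.tsum_add, key]

theorem mass_eq {S T : L2 →L[ℂ] L2} (h : S ∘L S.adjoint = T ∘L T.adjoint) : mass S = mass T :=
  tsum_enorm_sq_comp_eq onb (ContinuousLinearMap.id ℂ L2) h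

theorem aemeasurable_enorm_sq (ψ : L2) : AEMeasurable (fun x => ‖ψ x‖ₑ ^ 2) volume :=
  (Lp.aestronglyMeasurable ψ).enorm.pow_const 2

theorem aemeasurable_frameDensity (T : L2 →L[ℂ] L2) : AEMeasurable (frameDensity T) volume :=
  AEMeasurable.tsum fun i => aemeasurable_enorm_sq (T (onb i))

theorem lintegral_frameDensity_mul (T : L2 →L[ℂ] L2) {F : Space → ℝ≥0∞} (hF : Measurable F) :
    ∫⁻ x, frameDensity T x * F x = ∑' i, ∫⁻ x, ‖T (onb i) x‖ₑ ^ 2 * F x := by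
  rw [← lintegral_tsum (f := fun i x => ‖T (onb i) x‖ₑ ^ 2 * F x)
    fun i => (aemeasurable_enorm_sq _).mul hF.aemeasurable]
  simp [frameDensity, ENNReal.tsum_mul_right]

theorem lintegral_frameDensity (T : L2 →L[ℂ] L2) : ∫⁻ x, frameDensity T x = mass T := by
  have := lintegral_frameDensity_mul T (F := fun _ => 1) measurable_const
  simpa [mass, enorm_sq_eq_lintegral] using this

/-- The integral of the density over a set is `∑ᵢ ‖1_s T eᵢ‖²`, which only depends on `T T*`; finite
mass then gives equality almost everywhere. -/
theorem frameDensity_ae_eq {S T : L2 →L[ℂ] L2} (h : S ∘L S.adjoint = T ∘L T.adjoint)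
    (hT : mass T ≠ ∞) : frameDensity S =ᵐ[volume] frameDensity T := by
  refine AEMeasurable.ae_eq_of_forall_setLIntegral_eq (aemeasurable_frameDensity S)
    (aemeasurable_frameDensity T) (by rwa [lintegral_frameDensity, mass_eq h])
    (by rwa [lintegral_frameDensity]) fun s hs _ => ?_
  have hb : Measurable (s.indicator fun _ => (1 : ℂ)) := measurable_const.indicator hs
  have hC : ∀ x, ‖s.indicator (fun _ => (1 : ℂ)) x‖ ≤ 1 := fun x => by
    by_cases hx : x ∈ s <;> simp [hx]
  have key : ∀ R : L2 →L[ℂ] L2, ∫⁻ x in s, frameDensity R x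
      = ∑' i, ‖mulL2 _ hb 1 hC (R (onb i))‖ₑ ^ 2 := by
    intro R
    rw [← lintegral_indicator hs]
    have e1 : ∀ x, s.indicator (frameDensity R) x = frameDensity R x * s.indicator 1 x := by
      intro x
      by_cases hx : x ∈ s <;> simp [hx]
    simp_rw [e1]
    rw [lintegral_frameDensity_mul R (measurable_one.indicator hs)]
    refine tsum_congr fun i => ?_
    rw [enorm_sq_eq_lintegral]
    refine lintegral_congr_ae ?_
    filter_upwards [coeFn_mulL2 hb hC (R (onb i))] with x hx
    rw [hx]
    by_cases hxs : x ∈ s <;> simp [hxs]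
  rw [key, key]
  exact tsum_enorm_sq_comp_eq onb _ h

theorem attraction_congr {ρ σ : Space → ℝ≥0∞} (h : ρ =ᵐ[volume] σ) :
    attraction ρ = attraction σ :=
  lintegral_congr_ae (h.mono fun x hx => by simp only [hx])

theorem repulsion_congr {ρ σ : Space → ℝ≥0∞} (h : ρ =ᵐ[volume] σ) :
    repulsion ρ = repulsion σ := by
  unfold repulsion
  congr 1
  refine lintegral_congr_ae (h.mono fun x hx => ?_)
  exact lintegral_congr_ae (h.mono fun y hy => by simp only [hx, hy])

theorem frameEnergy_eq (β : ℝ) {S T : L2 →L[ℂ] L2} (h : S ∘L S.adjoint = T ∘L T.adjoint)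
    (hT : mass T ≠ ∞) : frameEnergy β S = frameEnergy β T := by
  have := frameDensity_ae_eq h hT
  rw [frameEnergy, frameEnergy, kinetic_eq β h, mass_eq h, attraction_congr this,
    repulsion_congr this]

/-! ### Traces -/

theorem opSqrt_adjoint {H : Type*} [NormedAddCommGroup H] [InnerProductSpace ℂ H]
    [CompleteSpace H] (Γ : H →L[ℂ] H) : (opSqrt Γ).adjoint = opSqrt Γ := by
  have h : (0 : H →L[ℂ] H) ≤ CFC.sqrt Γ := CFC.sqrt_nonneg Γ
  exact ((ContinuousLinearMap.nonneg_iff_isPositive _).1 h).isSelfAdjoint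

theorem opSqrt_comp_adjoint {H : Type*} [NormedAddCommGroup H] [InnerProductSpace ℂ H]
    [CompleteSpace H] {Γ : H →L[ℂ] H} (h : Γ.IsPositive) :
    opSqrt Γ ∘L (opSqrt Γ).adjoint = Γ := by
  rw [opSqrt_adjoint]
  exact CFC.sqrt_mul_sqrt_self Γ ((ContinuousLinearMap.nonneg_iff_isPositive _).2 h)

theorem hasSum_norm_sq {T : L2 →L[ℂ] L2} (hT : mass T ≠ ∞) :
    HasSum (fun i => ‖T (onb i)‖ ^ 2) (mass T).toReal := by
  have := ENNReal.hasSum_toReal hT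
  simpa [mass, ENNReal.tsum_toReal_eq] using this

theorem mass_adjoint (T : L2 →L[ℂ] L2) : mass T.adjoint = mass T :=
  tsum_enorm_sq_adjoint onb onb T

theorem enorm_add_sq_le {E : Type*} [SeminormedAddCommGroup E] (x y : E) {ε : ℝ} (hε : 0 < ε) :
    ‖x + y‖ₑ ^ 2 ≤ ENNReal.ofReal (1 + ε) * ‖x‖ₑ ^ 2 + ENNReal.ofReal (1 + ε⁻¹) * ‖y‖ₑ ^ 2 := by
  simp only [enorm_sq_eq_ofReal]
  rw [← ENNReal.ofReal_mul (by positivity), ← ENNReal.ofReal_mul (by positivity),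
    ← ENNReal.ofReal_add (by positivity) (by positivity)]
  refine ENNReal.ofReal_le_ofReal ?_
  have h1 : 0 ≤ ε⁻¹ * (ε * ‖x‖ - ‖y‖) ^ 2 := by positivity
  have h2 : ε⁻¹ * (ε * ‖x‖ - ‖y‖) ^ 2 = ε * ‖x‖ ^ 2 - 2 * (‖x‖ * ‖y‖) + ε⁻¹ * ‖y‖ ^ 2 := by
    field_simp
    ring
  nlinarith [norm_add_le x y, norm_nonneg (x + y), norm_nonneg x, norm_nonneg y]

theorem mass_add_ne_top {S T : L2 →L[ℂ] L2} (hS : mass S ≠ ∞) (hT : mass T ≠ ∞) :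
    mass (S + T) ≠ ∞ := by
  refine ne_top_of_le_ne_top
    (b := ENNReal.ofReal (1 + 1) * mass S + ENNReal.ofReal (1 + 1⁻¹) * mass T) (by finiteness) ?_
  rw [mass, mass, mass, ← ENNReal.tsum_mul_left, ← ENNReal.tsum_mul_left, ← ENNReal.tsum_add]
  exact ENNReal.tsum_le_tsum fun i => enorm_add_sq_le (S (onb i)) (T (onb i)) one_pos

theorem mass_comp_ne_top (M : L2 →L[ℂ] L2) {T : L2 →L[ℂ] L2} (hT : mass T ≠ ∞) :
    mass (M ∘L T) ≠ ∞ := by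
  refine ne_top_of_le_ne_top (b := ‖M‖ₑ ^ 2 * mass T) (by finiteness) ?_
  rw [mass, mass, ← ENNReal.tsum_mul_left]
  refine ENNReal.tsum_le_tsum fun i => ?_
  rw [← mul_pow]
  gcongr
  exact M.le_opENorm _

theorem mass_neg (T : L2 →L[ℂ] L2) : mass (-T) = mass T := by simp [mass]

theorem hasSum_re_inner {S T : L2 →L[ℂ] L2} (hS : mass S ≠ ∞) (hT : mass T ≠ ∞) :
    HasSum (fun i => (⟪S (onb i), T (onb i)⟫_ℂ).re)
      (((mass (S + T)).toReal - (mass (S - T)).toReal) / 4) := by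
  have h1 := hasSum_norm_sq (mass_add_ne_top hS hT)
  have h2 := hasSum_norm_sq (T := S - T) (by
    rw [sub_eq_add_neg]
    exact mass_add_ne_top hS (by rwa [mass_neg]))
  have h3 : (fun i => (⟪S (onb i), T (onb i)⟫_ℂ).re)
      = fun i => (‖(S + T) (onb i)‖ ^ 2 - ‖(S - T) (onb i)‖ ^ 2) / 4 := by
    ext i
    have := re_inner_eq_norm_add_mul_self_sub_norm_sub_mul_self_div_four (𝕜 := ℂ)
      (S (onb i)) (T (onb i))
    simp only [RCLike.re_eq_complex_re] at this
    rw [this]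
    simp [sq]
  rw [h3]
  exact (h1.sub h2).div_const 4

theorem summable_inner {S T : L2 →L[ℂ] L2} (hS : mass S ≠ ∞) (hT : mass T ≠ ∞) :
    Summable fun i => ⟪S (onb i), T (onb i)⟫_ℂ := by
  refine Summable.of_norm_bounded
    ((hasSum_norm_sq hS).summable.add (hasSum_norm_sq hT).summable) fun i => ?_
  have := norm_inner_le_norm (𝕜 := ℂ) (S (onb i)) (T (onb i))
  nlinarith [sq_nonneg (‖S (onb i)‖ - ‖T (onb i)‖), norm_nonneg (S (onb i)),
    norm_nonneg (T (onb i)), mul_nonneg (norm_nonneg (S (onb i))) (norm_nonneg (T (onb i)))]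

/-- Polarization of the adjoint invariance of the mass; it plays the role of cyclicity of the trace.
-/
theorem re_tsum_inner_adjoint {S T : L2 →L[ℂ] L2} (hS : mass S ≠ ∞) (hT : mass T ≠ ∞) :
    (∑' i, ⟪S (onb i), T (onb i)⟫_ℂ).re
      = (∑' i, ⟪S.adjoint (onb i), T.adjoint (onb i)⟫_ℂ).re := by
  have hS' : mass S.adjoint ≠ ∞ := by rwa [mass_adjoint]
  have hT' : mass T.adjoint ≠ ∞ := by rwa [mass_adjoint]
  rw [Complex.re_tsum (summable_inner hS hT), Complex.re_tsum (summable_inner hS' hT'),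
    (hasSum_re_inner hS hT).tsum_eq, (hasSum_re_inner hS' hT').tsum_eq, ← map_add, ← map_sub,
    mass_adjoint, mass_adjoint]

theorem trace_comp_adjoint {T : L2 →L[ℂ] L2} (hT : mass T ≠ ∞) :
    trace (T ∘L T.adjoint) = ((mass T).toReal : ℂ) := by
  have h := hasSum_norm_sq (T := T.adjoint) (by rwa [mass_adjoint])
  rw [mass_adjoint] at h
  have h2 := Complex.hasSum_ofReal.2 h |>.tsum_eq
  rw [← h2, trace]
  refine tsum_congr fun i => ?_
  rw [ContinuousLinearMap.comp_apply, ← ContinuousLinearMap.adjoint_inner_left,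
    inner_self_eq_norm_sq_to_K]
  simp

theorem isDensityMatrix_comp_adjoint {T : L2 →L[ℂ] L2} (hT : mass T ≠ ∞) :
    IsDensityMatrix (T ∘L T.adjoint) := by
  refine ⟨ContinuousLinearMap.isPositive_self_comp_adjoint T, ?_⟩
  have hT' : mass T.adjoint ≠ ∞ := by rwa [mass_adjoint]
  refine (summable_inner hT' hT').congr fun i => ?_
  rw [ContinuousLinearMap.comp_apply, ContinuousLinearMap.adjoint_inner_left]

theorem IsDensityMatrix.mass_opSqrt_ne_top {Γ : L2 →L[ℂ] L2} (h : IsDensityMatrix Γ) :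
    mass (opSqrt Γ) ≠ ∞ := by
  have key : ∀ i, (⟪onb i, Γ (onb i)⟫_ℂ).re = ‖opSqrt Γ (onb i)‖ ^ 2 := by
    intro i
    conv_lhs => rw [← opSqrt_comp_adjoint h.nonneg]
    rw [ContinuousLinearMap.comp_apply, ← ContinuousLinearMap.adjoint_inner_left, opSqrt_adjoint,
      inner_self_eq_norm_sq_to_K]
    norm_cast
  have hs : Summable fun i => ‖opSqrt Γ (onb i)‖ ^ 2 :=
    (Complex.hasSum_re h.traceClass.hasSum).summable.congr key
  simp_rw [mass, enorm_sq_eq_ofReal]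
  exact hs.tsum_ofReal_ne_top

/-- For an orthogonal projection `P`, `Re Tr[P T T*] = ∑ᵢ ‖P T eᵢ‖²`. -/
theorem re_trace_comp {P T : L2 →L[ℂ] L2} (hP : P.adjoint = P) (hP2 : P ∘L P = P)
    (hT : mass T ≠ ∞) :
    (trace (P ∘L T ∘L T.adjoint)).re = (mass (P ∘L T)).toReal := by
  have hPT := mass_comp_ne_top P hT
  have hPT' : mass (P ∘L T).adjoint ≠ ∞ := by rwa [mass_adjoint]
  have hT' : mass T.adjoint ≠ ∞ := by rwa [mass_adjoint]
  have h1 : trace (P ∘L T ∘L T.adjoint)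
      = ∑' i, ⟪(P ∘L T).adjoint (onb i), T.adjoint (onb i)⟫_ℂ := by
    refine tsum_congr fun i => ?_
    rw [ContinuousLinearMap.adjoint_inner_left]
    rfl
  rw [h1, re_tsum_inner_adjoint hPT' hT', ContinuousLinearMap.adjoint_adjoint,
    ContinuousLinearMap.adjoint_adjoint, Complex.re_tsum (summable_inner hPT hT),
    ← (hasSum_norm_sq hPT).tsum_eq]
  refine tsum_congr fun i => ?_
  have h2 : (P ∘L T) (onb i) = P ((P ∘L T) (onb i)) := by
    rw [← ContinuousLinearMap.comp_apply P, ← ContinuousLinearMap.comp_assoc, hP2]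
  conv_lhs => rw [h2, ← hP, ContinuousLinearMap.adjoint_inner_left, hP]
  rw [← ContinuousLinearMap.comp_apply P T, inner_self_eq_norm_sq_to_K]
  norm_cast

/-- `T` and `(T T*)^{1/2}` are two factorizations of the same operator, so the energy may be
computed with `T`. -/
theorem energy_comp_adjoint (β : ℝ) {T : L2 →L[ℂ] L2} (hT : mass T ≠ ∞) :
    energy β (T ∘L T.adjoint) = frameEnergy β T := by
  have hd := isDensityMatrix_comp_adjoint hT
  have h := opSqrt_comp_adjoint hd.nonneg
  rw [← frameEnergy_eq β h hT, energy, frameEnergy, trace_comp_adjoint hT, mass_eq h,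
    Complex.ofReal_re]
  rfl

theorem magneticKinetic_comp_adjoint (β : ℝ) (T : L2 →L[ℂ] L2) :
    magneticKinetic β (T ∘L T.adjoint) = kinetic β T :=
  kinetic_eq β (opSqrt_comp_adjoint (ContinuousLinearMap.isPositive_self_comp_adjoint T))

theorem isAdmissible_comp_adjoint {β : ℝ} {T : L2 →L[ℂ] L2} (hT : mass T ≠ ∞)
    (hK : kinetic β T ≠ ∞) : IsAdmissible β (T ∘L T.adjoint) :=
  ⟨isDensityMatrix_comp_adjoint hT, by
    rw [magneticKinetic_comp_adjoint]
    exact hK.lt_top⟩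

theorem IsAdmissible.exists_eq {β : ℝ} {Γ : L2 →L[ℂ] L2} (h : IsAdmissible β Γ) :
    ∃ T : L2 →L[ℂ] L2, Γ = T ∘L T.adjoint ∧ mass T ≠ ∞ ∧ kinetic β T ≠ ∞ :=
  ⟨opSqrt Γ, (opSqrt_comp_adjoint h.densityMatrix.nonneg).symm,
    h.densityMatrix.mass_opSqrt_ne_top, h.finiteKinetic.ne⟩

/-! ### Coulomb energies -/

/-- The potential `∫ σ(y) / |x - y| dy`. -/
def coulombPotential (σ : Space → ℝ≥0∞) (x : Space) : ℝ≥0∞ := ∫⁻ y, σ y * ‖x - y‖ₑ⁻¹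

/-- The mutual Coulomb energy `∫∫ ρ(x) σ(y) / |x - y| dx dy`. -/
def coulombPair (ρ σ : Space → ℝ≥0∞) : ℝ≥0∞ := ∫⁻ x, ρ x * coulombPotential σ x

theorem measurable_coulomb (x : Space) : Measurable fun y : Space => ‖x - y‖ₑ⁻¹ := by
  fun_prop

theorem measurable_coulombPotential {σ : Space → ℝ≥0∞} (hσ : Measurable σ) :
    Measurable (coulombPotential σ) := by
  have h : Measurable fun p : Space × Space => σ p.2 * ‖p.1 - p.2‖ₑ⁻¹ := by fun_prop
  exact h.lintegral_prod_right'

theorem lintegral_mul_coulomb {σ : Space → ℝ≥0∞} (hσ : Measurable σ) (c : ℝ≥0∞) (x : Space) :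
    ∫⁻ y, c * σ y * ‖x - y‖ₑ⁻¹ = c * coulombPotential σ x := by
  simp_rw [mul_assoc]
  exact lintegral_const_mul _ (hσ.mul (measurable_coulomb x))

theorem repulsion_eq {ρ : Space → ℝ≥0∞} (hρ : Measurable ρ) :
    repulsion ρ = 2⁻¹ * coulombPair ρ ρ := by
  simp_rw [repulsion, lintegral_mul_coulomb hρ]
  rfl

theorem attraction_eq (ρ : Space → ℝ≥0∞) : attraction ρ = coulombPotential ρ 0 := by
  simp [attraction, coulombPotential]

theorem coulombPair_comm {ρ σ : Space → ℝ≥0∞} (hρ : Measurable ρ) (hσ : Measurable σ) :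
    coulombPair ρ σ = coulombPair σ ρ := by
  unfold coulombPair
  simp_rw [← lintegral_mul_coulomb hρ, ← lintegral_mul_coulomb hσ]
  rw [lintegral_lintegral_swap]
  · refine lintegral_congr fun x => lintegral_congr fun y => ?_
    rw [← enorm_neg, neg_sub, mul_comm (ρ y)]
  · exact (((hρ.comp measurable_fst).mul (hσ.comp measurable_snd)).mul
      (measurable_fst.sub measurable_snd).enorm.inv).aemeasurable

theorem coulombPotential_le {ρ σ τ : Space → ℝ≥0∞} (hρ : Measurable ρ) {a b : ℝ≥0∞}
    (h : ∀ᵐ x, σ x ≤ a * ρ x + b * τ x) (hτ : Measurable τ) (x : Space) :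
    coulombPotential σ x ≤ a * coulombPotential ρ x + b * coulombPotential τ x := by
  rw [← lintegral_mul_coulomb hρ, ← lintegral_mul_coulomb hτ,
    ← lintegral_add_left (f := fun y => a * ρ y * ‖x - y‖ₑ⁻¹) (by fun_prop)]
  refine lintegral_mono_ae (h.mono fun y hy => ?_)
  rw [← add_mul]
  gcongr

theorem coulombPair_le_of_potential_le {ρ σ : Space → ℝ≥0∞} {κ : ℝ≥0∞} (hρ : Measurable ρ)
    (h : ∀ x, coulombPotential σ x ≤ κ) : coulombPair ρ σ ≤ κ * ∫⁻ x, ρ x := by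
  rw [← lintegral_const_mul _ hρ]
  refine lintegral_mono fun x => ?_
  rw [mul_comm]
  gcongr
  exact h x

theorem coulombPair_le {ρ σ τ η : Space → ℝ≥0∞} (hρ : Measurable ρ) (hτ : Measurable τ)
    (hη : Measurable η) {a b κ : ℝ≥0∞} (h : ∀ᵐ x, σ x ≤ a * ρ x + b * τ x)
    (hκ : ∀ x, coulombPotential τ x ≤ κ) :
    coulombPair η σ ≤ a * coulombPair η ρ + b * κ * ∫⁻ x, η x := by
  rw [coulombPair, coulombPair, ← lintegral_const_mul _ hη,
    ← lintegral_const_mul (f := fun x => η x * coulombPotential ρ x) _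
      (hη.mul (measurable_coulombPotential hρ)),
    ← lintegral_add_left (f := fun x => a * (η x * coulombPotential ρ x))
      ((hη.mul (measurable_coulombPotential hρ)).const_mul a)]
  refine lintegral_mono fun x => ?_
  calc η x * coulombPotential σ x
      ≤ η x * (a * coulombPotential ρ x + b * κ) := by
        gcongr
        refine (coulombPotential_le hρ h hτ x).trans ?_
        gcongr
        exact hκ x
    _ = _ := by ring

/-- Apply the pointwise bound in one argument, then, by symmetry of the kernel, in the other. The
error needs only the supremum of the potential of `τ` and the total masses. -/
theorem coulombPair_self_le {ρ σ τ : Space → ℝ≥0∞} (hρ : Measurable ρ) (hσ : Measurable σ)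
    (hτ : Measurable τ) {a b κ : ℝ≥0∞} (h : ∀ᵐ x, σ x ≤ a * ρ x + b * τ x)
    (hκ : ∀ x, coulombPotential τ x ≤ κ) :
    coulombPair σ σ
      ≤ a ^ 2 * coulombPair ρ ρ + (a * b * κ * ∫⁻ x, ρ x) + b * κ * ∫⁻ x, σ x := by
  calc coulombPair σ σ ≤ a * coulombPair σ ρ + b * κ * ∫⁻ x, σ x := coulombPair_le hρ hτ hσ h hκ
    _ = a * coulombPair ρ σ + b * κ * ∫⁻ x, σ x := by rw [coulombPair_comm hσ hρ]
    _ ≤ a * (a * coulombPair ρ ρ + b * κ * ∫⁻ x, ρ x) + b * κ * ∫⁻ x, σ x := by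
        gcongr
        exact coulombPair_le hρ hτ hρ h hκ
    _ = _ := by ring

/-! ### Estimates for frames -/

theorem measurable_frameDensity (T : L2 →L[ℂ] L2) : Measurable (frameDensity T) :=
  Measurable.tsum fun i => (Lp.stronglyMeasurable (T (onb i))).measurable.enorm.pow_const 2

theorem coulombPotential_frameDensity_le (β : ℝ) (T : L2 →L[ℂ] L2) (y : Space) {δ : ℝ}
    (hδ : 0 < δ) :
    coulombPotential (frameDensity T) y
      ≤ ENNReal.ofReal δ * kinetic β T + ENNReal.ofReal δ⁻¹ * mass T := by
  rw [coulombPotential, lintegral_frameDensity_mul T (measurable_coulomb y), kinetic, mass, ← ENNReal.tsum_mul_left,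
    ← ENNReal.tsum_mul_left, ← ENNReal.tsum_add]
  refine ENNReal.tsum_le_tsum fun i => ?_
  simp_rw [fun x : Space => show ‖y - x‖ₑ = ‖x - y‖ₑ by rw [← enorm_neg, neg_sub]]
  exact lintegral_coulomb_le β _ y hδ

theorem frameDensity_add_le (S T : L2 →L[ℂ] L2) {ε : ℝ} (hε : 0 < ε) :
    ∀ᵐ x, frameDensity (S + T) x ≤ ENNReal.ofReal (1 + ε) * frameDensity S x
      + ENNReal.ofReal (1 + ε⁻¹) * frameDensity T x := by
  have h : ∀ᵐ x, ∀ i, (S + T) (onb i) x = S (onb i) x + T (onb i) x :=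
    ae_all_iff.2 fun i => Lp.coeFn_add (S (onb i)) (T (onb i))
  filter_upwards [h] with x hx
  rw [frameDensity, frameDensity, frameDensity, ← ENNReal.tsum_mul_left, ← ENNReal.tsum_mul_left,
    ← ENNReal.tsum_add]
  refine ENNReal.tsum_le_tsum fun i => ?_
  rw [hx i]
  exact enorm_add_sq_le _ _ hε

theorem frameDensity_neg_ae_eq (T : L2 →L[ℂ] L2) :
    frameDensity (-T) =ᵐ[volume] frameDensity T := by
  have h : ∀ᵐ x, ∀ i, (-T) (onb i) x = - T (onb i) x :=
    ae_all_iff.2 fun i => Lp.coeFn_neg (T (onb i))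
  filter_upwards [h] with x hx
  simp only [frameDensity, hx, enorm_neg]

theorem le_kinetic {β : ℝ} (hβ : 0 ≤ β) (T : L2 →L[ℂ] L2) :
    ENNReal.ofReal β * mass T ≤ kinetic β T := by
  rw [mass, ← ENNReal.tsum_mul_left]
  exact ENNReal.tsum_le_tsum fun i => le_magneticForm hβ _

theorem kinetic_eq_projLow_add_projHigh {β : ℝ} (hβ : 0 ≤ β) {T : L2 →L[ℂ] L2}
    (hT : kinetic β T ≠ ∞) :
    kinetic β T = kinetic β (projLow β ∘L T) + kinetic β (projHigh β ∘L T) := by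
  rw [kinetic, kinetic, kinetic, ← ENNReal.tsum_add]
  exact tsum_congr fun i =>
    magneticForm_eq_projLow_add_projHigh hβ (ENNReal.ne_top_of_tsum_ne_top hT i)

theorem mass_eq_projLow_add_projHigh (β : ℝ) (T : L2 →L[ℂ] L2) :
    mass T = mass (projLow β ∘L T) + mass (projHigh β ∘L T) := by
  rw [mass, mass, mass, ← ENNReal.tsum_add]
  exact tsum_congr fun i => enorm_sq_eq_projLow_add_projHigh β _

theorem le_kinetic_projHigh {β : ℝ} (hβ : 0 < β) (T : L2 →L[ℂ] L2) :
    ENNReal.ofReal (3 * β) * mass (projHigh β ∘L T) ≤ kinetic β (projHigh β ∘L T) := by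
  rw [mass, ← ENNReal.tsum_mul_left]
  exact ENNReal.tsum_le_tsum fun i => le_magneticForm_projHigh hβ _

/-- The parallel kinetic energy `∑ᵢ ‖π₂ T eᵢ‖²`. -/
def parallel (β : ℝ) (T : L2 →L[ℂ] L2) : ℝ≥0∞ := ∑' i, momentumSq β 2 (T (onb i))

theorem kinetic_eq_of_mem {β : ℝ} (hβ : 0 ≤ β) {T : L2 →L[ℂ] L2}
    (hT : ∀ ψ, T ψ ∈ lowestLandauBand β) :
    kinetic β T = ENNReal.ofReal β * mass T + parallel β T := by
  rw [kinetic, mass, parallel, ← ENNReal.tsum_mul_left, ← ENNReal.tsum_add]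
  exact tsum_congr fun i => magneticForm_eq_of_mem hβ (hT _)

theorem attraction_frameDensity_le (β : ℝ) (T : L2 →L[ℂ] L2) {δ : ℝ} (hδ : 0 < δ) :
    attraction (frameDensity T)
      ≤ ENNReal.ofReal δ * kinetic β T + ENNReal.ofReal δ⁻¹ * mass T := by
  rw [attraction_eq]
  exact coulombPotential_frameDensity_le β T 0 hδ

theorem coulombPair_frameDensity_ne_top {β : ℝ} {T : L2 →L[ℂ] L2} (hT : mass T ≠ ∞)
    (hK : kinetic β T ≠ ∞) : coulombPair (frameDensity T) (frameDensity T) ≠ ∞ := by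
  refine ne_top_of_le_ne_top ?_ (coulombPair_le_of_potential_le (measurable_frameDensity T)
    fun x => coulombPotential_frameDensity_le β T x one_pos)
  rw [lintegral_frameDensity]
  finiteness

theorem mass_ne_top_of_kinetic {β : ℝ} (hβ : 0 < β) {T : L2 →L[ℂ] L2} (hK : kinetic β T ≠ ∞) :
    mass T ≠ ∞ := by
  intro h
  have := le_kinetic hβ.le T
  rw [h, ENNReal.mul_top (by simpa using hβ)] at this
  exact hK (top_le_iff.1 this)

theorem toReal_attraction_frameDensity_le {β : ℝ} {T : L2 →L[ℂ] L2} (hT : mass T ≠ ∞)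
    (hK : kinetic β T ≠ ∞) {δ : ℝ} (hδ : 0 < δ) :
    (attraction (frameDensity T)).toReal ≤ δ * (kinetic β T).toReal + δ⁻¹ * (mass T).toReal := by
  have h := ENNReal.toReal_mono (by finiteness) (attraction_frameDensity_le β T hδ)
  rwa [ENNReal.toReal_add (by finiteness) (by finiteness), ENNReal.toReal_mul, ENNReal.toReal_mul,
    ENNReal.toReal_ofReal hδ.le, ENNReal.toReal_ofReal (inv_pos.2 hδ).le] at h

theorem kinetic_eq_toReal_of_mem {β : ℝ} (hβ : 0 < β) {T : L2 →L[ℂ] L2}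
    (hT : ∀ ψ, T ψ ∈ lowestLandauBand β) (hK : kinetic β T ≠ ∞) :
    (kinetic β T).toReal = β * (mass T).toReal + (parallel β T).toReal := by
  have hm := mass_ne_top_of_kinetic hβ hK
  have h := kinetic_eq_of_mem hβ.le hT
  have hp : parallel β T ≠ ∞ := fun hp => hK (by rw [h, hp, add_top])
  rw [h, ENNReal.toReal_add (by finiteness) hp, ENNReal.toReal_mul, ENNReal.toReal_ofReal hβ.le]

/-- With `δ = β^(-1/2)` the mass term `δ⁻¹ M = (δ/3)(3β) M` is at most `(δ/3) K` above the band, so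
the whole potential is at most `(1 + 1/3) δ K`. -/
theorem coulombPotential_projHigh_le {β δ : ℝ} (hβ : 0 < β) (hδ : 0 < δ) (hδβ : δ ^ 2 * β = 1)
    (T : L2 →L[ℂ] L2) (x : Space) :
    coulombPotential (frameDensity (projHigh β ∘L T)) x
      ≤ ENNReal.ofReal (4 / 3 * δ) * kinetic β (projHigh β ∘L T) := by
  refine (coulombPotential_frameDensity_le β _ x hδ).trans ?_
  have h : δ⁻¹ = δ / 3 * (3 * β) := by
    field_simp
    linarith
  rw [h, ENNReal.ofReal_mul (by positivity), mul_assoc]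
  calc _ ≤ ENNReal.ofReal δ * kinetic β (projHigh β ∘L T)
        + ENNReal.ofReal (δ / 3) * kinetic β (projHigh β ∘L T) := by
        gcongr
        exact le_kinetic_projHigh hβ T
    _ = _ := by
        rw [← add_mul, ← ENNReal.ofReal_add (by positivity) (by positivity)]
        ring_nf

theorem projLow_comp_add_projHigh_comp (β : ℝ) (T : L2 →L[ℂ] L2) :
    projLow β ∘L T + projHigh β ∘L T = T :=
  ContinuousLinearMap.ext fun ψ => projLow_add_projHigh β (T ψ)

/-- Replacing a state by its projection to the lowest Landau band, with a small loss in the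
Coulomb energies. -/
theorem le_frameEnergy {β m δ ε : ℝ} (hβ : 0 < β) (hδ : 0 < δ) (hδβ : δ ^ 2 * β = 1)
    (hm : 0 ≤ m) (hε : ε = 4 * (1 + m) * δ) (hε1 : ε ≤ 1 / 2) {T : L2 →L[ℂ] L2}
    (hK : kinetic β T ≠ ∞) (hmT : (mass T).toReal ≤ m) :
    (parallel β (projLow β ∘L T)).toReal
        - (1 + ε) * (attraction (frameDensity (projLow β ∘L T))).toReal
        + (1 - 2 * ε) * (repulsion (frameDensity (projLow β ∘L T))).toReal
      ≤ frameEnergy β T := by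
  have hε0 : 0 < ε := by rw [hε]; positivity
  have hsum := projLow_comp_add_projHigh_comp β T
  have hKs := kinetic_eq_projLow_add_projHigh hβ.le hK
  have hMs := mass_eq_projLow_add_projHigh β T
  have hMT := mass_ne_top_of_kinetic hβ hK
  have hK1 := le_kinetic_projHigh hβ T
  have hκ := coulombPotential_projHigh_le hβ hδ hδβ T
  have hmemS : ∀ ψ, (projLow β ∘L T) ψ ∈ lowestLandauBand β := fun ψ => projLow_mem β (T ψ)
  generalize hS : projLow β ∘L T = S at *
  generalize hR : projHigh β ∘L T = R at *
  have hSK : kinetic β S ≠ ∞ := fun h => hK (by rw [hKs, h, top_add])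
  have hRK : kinetic β R ≠ ∞ := fun h => hK (by rw [hKs, h, add_top])
  have hSM := mass_ne_top_of_kinetic hβ hSK
  have hRM := mass_ne_top_of_kinetic hβ hRK
  have hρT := measurable_frameDensity T
  have hρS := measurable_frameDensity S
  have hρR := measurable_frameDensity R
  set κ := ENNReal.ofReal (4 / 3 * δ) * kinetic β R with hκ_def
  have hκ_top : κ ≠ ∞ := by finiteness
  have hPT := coulombPair_frameDensity_ne_top hMT hK
  have hPS := coulombPair_frameDensity_ne_top hSM hSK
  have hAS : attraction (frameDensity S) ≠ ∞ :=
    ne_top_of_le_ne_top (by finiteness) (attraction_frameDensity_le β S one_pos)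
  have ha : ENNReal.ofReal (1 + ε) ≠ ∞ := by finiteness
  have hb : ENNReal.ofReal (1 + ε⁻¹) ≠ ∞ := by finiteness
  have hA : attraction (frameDensity T) ≤ ENNReal.ofReal (1 + ε) * attraction (frameDensity S)
      + ENNReal.ofReal (1 + ε⁻¹) * κ := by
    have h := frameDensity_add_le S R hε0
    rw [hsum] at h
    simp only [attraction_eq]
    refine (coulombPotential_le hρS h hρR 0).trans ?_
    gcongr
    exact hκ 0
  -- For the repulsion the roles are reversed: `S = T - R`, since the repulsion of `S` must be
  -- bounded above by that of `T`.
  have hP : coulombPair (frameDensity S) (frameDensity S)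
      ≤ ENNReal.ofReal (1 + ε) ^ 2 * coulombPair (frameDensity T) (frameDensity T)
        + (ENNReal.ofReal (1 + ε) * ENNReal.ofReal (1 + ε⁻¹) * κ * mass T)
        + ENNReal.ofReal (1 + ε⁻¹) * κ * mass S := by
    have h := frameDensity_add_le T (-R) hε0
    rw [show T + -R = S by rw [← hsum, add_neg_cancel_right]] at h
    rw [← lintegral_frameDensity T, ← lintegral_frameDensity S]
    refine coulombPair_self_le hρT hρS hρR ?_ hκ
    filter_upwards [h, frameDensity_neg_ae_eq R] with x hx hx2
    rwa [hx2] at hx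
  have hA' := ENNReal.toReal_mono (by finiteness) hA
  have hP' := ENNReal.toReal_mono (by finiteness) hP
  have hK1' := ENNReal.toReal_mono hRK hK1
  rw [ENNReal.toReal_add (by finiteness) (by finiteness)] at hA'
  rw [ENNReal.toReal_add (by finiteness) (by finiteness),
    ENNReal.toReal_add (by finiteness) (by finiteness)] at hP'
  simp only [ENNReal.toReal_mul, ENNReal.toReal_pow,
    ENNReal.toReal_ofReal (show 0 ≤ 1 + ε by positivity),
    ENNReal.toReal_ofReal (show 0 ≤ 1 + ε⁻¹ by positivity),
    ENNReal.toReal_ofReal (show 0 ≤ 3 * β by positivity)] at hA' hP' hK1'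
  have hκ' : κ.toReal = 4 / 3 * δ * (kinetic β R).toReal := by
    rw [hκ_def, ENNReal.toReal_mul, ENNReal.toReal_ofReal (by positivity)]
  have hKS := kinetic_eq_toReal_of_mem hβ hmemS hSK
  have hMs' : (mass T).toReal = (mass S).toReal + (mass R).toReal := by
    rw [hMs, ENNReal.toReal_add hSM hRM]
  rw [frameEnergy, repulsion_eq hρS, repulsion_eq hρT, hKs, ENNReal.toReal_add hSK hRK, hKS,
    hMs']
  simp only [ENNReal.toReal_mul, ENNReal.toReal_inv, ENNReal.toReal_ofNat]
  have n1 : 0 ≤ (mass R).toReal := ENNReal.toReal_nonneg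
  have n2 : 0 ≤ (mass S).toReal := ENNReal.toReal_nonneg
  have n3 : 0 ≤ (kinetic β R).toReal := ENNReal.toReal_nonneg
  have n4 : 0 ≤ (coulombPair (frameDensity T) (frameDensity T)).toReal := ENNReal.toReal_nonneg
  have n5 : 0 ≤ κ.toReal := ENNReal.toReal_nonneg
  generalize (coulombPair (frameDensity T) (frameDensity T)).toReal = pT at *
  generalize (coulombPair (frameDensity S) (frameDensity S)).toReal = pS at *
  generalize (attraction (frameDensity T)).toReal = aT at *
  generalize (attraction (frameDensity S)).toReal = aS at *
  generalize (kinetic β R).toReal = q at *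
  generalize κ.toReal = k at *
  generalize (mass T).toReal = mT at *
  generalize (mass S).toReal = mS at *
  generalize (mass R).toReal = mR at *
  have hb0 : 0 ≤ (1 + ε⁻¹) * k := by positivity
  -- The choice `ε = 4(1 + m)δ` turns the total Coulomb error, attraction plus half of the repulsion
  -- pair, into `(1 + ε)/3` of the kinetic energy `q` of `R`.
  have e1 : (1 + ε⁻¹) * k * (1 + m) = (1 + ε) / 3 * q := by
    rw [hκ']
    have : ε⁻¹ * ε = 1 := inv_mul_cancel₀ hε0.ne'
    have h4 : (1 + m) * δ = ε / 4 := by rw [hε]; ring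
    calc _ = (1 + ε⁻¹) * (4 / 3 * q) * ((1 + m) * δ) := by ring
      _ = (ε + ε⁻¹ * ε) / 3 * q := by rw [h4]; ring
      _ = _ := by rw [this]; ring
  have e2 : pS ≤ (1 + ε) ^ 2 * pT + (2 + ε) * ((1 + ε⁻¹) * k * m) := by
    refine hP'.trans ?_
    have h1 : (1 + ε⁻¹) * k * mT ≤ (1 + ε⁻¹) * k * m := by gcongr
    have h2 : (1 + ε⁻¹) * k * mS ≤ (1 + ε⁻¹) * k * m := by gcongr; linarith
    have h3 := mul_le_mul_of_nonneg_left h1 (show 0 ≤ 1 + ε by positivity)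
    linarith
  -- The factor `1 - 2ε` is chosen so that `(1 - 2ε)(1 + ε)² ≤ 1`.
  have e3 : (1 - 2 * ε) * pS ≤ pT + 2 * ((1 + ε⁻¹) * k * m) := by
    have hbm : 0 ≤ (1 + ε⁻¹) * k * m := by positivity
    calc (1 - 2 * ε) * pS
        ≤ (1 - 2 * ε) * ((1 + ε) ^ 2 * pT + (2 + ε) * ((1 + ε⁻¹) * k * m)) := by
          gcongr
          linarith
      _ = pT - (3 * ε ^ 2 + 2 * ε ^ 3) * pT + (2 * ((1 + ε⁻¹) * k * m)
          - (3 * ε + 2 * ε ^ 2) * ((1 + ε⁻¹) * k * m)) := by ring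
      _ ≤ _ := by
          have h1 : 0 ≤ (3 * ε ^ 2 + 2 * ε ^ 3) * pT := by positivity
          have h2 : 0 ≤ (3 * ε + 2 * ε ^ 2) * ((1 + ε⁻¹) * k * m) := by positivity
          linarith
  -- The gap leaves `q - β M(R) ≥ (2/3) q`, which pays for the Coulomb error.
  have e4 : (1 + ε) / 3 * q ≤ 2 / 3 * q := by gcongr; linarith
  linarith

/-! ### Scaling and dilating frames -/

theorem momentumSq_smul (β : ℝ) (j : Fin 3) (c : ℂ) (ψ : L2) :
    momentumSq β j (c • ψ) = ‖c‖ₑ ^ 2 * momentumSq β j ψ := by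
  obtain ⟨s, w, hw⟩ := exists_tsum_eq_momentumSq β j
  simp_rw [hw, inner_smul_right, enorm_mul, mul_pow, ENNReal.tsum_mul_left]

theorem mass_smul (c : ℂ) (T : L2 →L[ℂ] L2) : mass (c • T) = ‖c‖ₑ ^ 2 * mass T := by
  simp_rw [mass, _root_.smul_apply, enorm_smul, mul_pow, ENNReal.tsum_mul_left]

theorem parallel_smul (β : ℝ) (c : ℂ) (T : L2 →L[ℂ] L2) :
    parallel β (c • T) = ‖c‖ₑ ^ 2 * parallel β T := by
  simp_rw [parallel, _root_.smul_apply, momentumSq_smul, ENNReal.tsum_mul_left]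

theorem frameDensity_smul_ae_eq (c : ℂ) (T : L2 →L[ℂ] L2) :
    frameDensity (c • T) =ᵐ[volume] fun x => ‖c‖ₑ ^ 2 * frameDensity T x := by
  have h : ∀ᵐ x, ∀ i, (c • T) (onb i) x = c * T (onb i) x :=
    ae_all_iff.2 fun i => Lp.coeFn_smul c (T (onb i))
  filter_upwards [h] with x hx
  simp only [frameDensity, hx, enorm_mul, mul_pow, ENNReal.tsum_mul_left]

theorem attraction_frameDensity_smul (c : ℂ) (T : L2 →L[ℂ] L2) :
    attraction (frameDensity (c • T)) = ‖c‖ₑ ^ 2 * attraction (frameDensity T) := by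
  have h := lintegral_mul_coulomb (measurable_frameDensity T) (‖c‖ₑ ^ 2) 0
  rw [attraction_congr (frameDensity_smul_ae_eq c T), attraction_eq, attraction_eq, ← h]
  rfl

theorem repulsion_frameDensity_smul (c : ℂ) (T : L2 →L[ℂ] L2) :
    repulsion (frameDensity (c • T)) = ‖c‖ₑ ^ 4 * repulsion (frameDensity T) := by
  have hm := measurable_frameDensity T
  have h : ∀ x, coulombPotential (fun x => ‖c‖ₑ ^ 2 * frameDensity T x) x
      = ‖c‖ₑ ^ 2 * coulombPotential (frameDensity T) x := lintegral_mul_coulomb hm _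
  rw [repulsion_congr (frameDensity_smul_ae_eq c T), repulsion_eq (hm.const_mul _),
    repulsion_eq hm, coulombPair, coulombPair]
  simp_rw [h]
  have e : ∀ x, ‖c‖ₑ ^ 2 * frameDensity T x * (‖c‖ₑ ^ 2 * coulombPotential (frameDensity T) x)
      = ‖c‖ₑ ^ 4 * (frameDensity T x * coulombPotential (frameDensity T) x) := fun x => by ring
  simp_rw [e]
  rw [lintegral_const_mul (f := fun x => frameDensity T x * coulombPotential (frameDensity T) x) _
    (hm.mul (measurable_coulombPotential hm))]
  ring

theorem mass_dilate {s : ℝ} (hs : 0 < s) (T : L2 →L[ℂ] L2) :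
    mass (dilate s hs ∘L T) = mass T :=
  tsum_congr fun i => enorm_sq_dilate hs (T (onb i))

theorem parallel_dilate_le (β : ℝ) {s : ℝ} (hs : 0 < s) (T : L2 →L[ℂ] L2) :
    parallel β (dilate s hs ∘L T) ≤ ENNReal.ofReal (s ^ 2) * parallel β T := by
  rw [parallel, parallel, ← ENNReal.tsum_mul_left]
  exact ENNReal.tsum_le_tsum fun i => momentumSq_dilate_le β hs (T (onb i))

theorem frameDensity_dilate_ae_eq {s : ℝ} (hs : 0 < s) (T : L2 →L[ℂ] L2) :
    frameDensity (dilate s hs ∘L T)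
      =ᵐ[volume] fun x => ENNReal.ofReal s * frameDensity T (stretch s x) := by
  have h : ∀ᵐ x, ∀ i, (dilate s hs ∘L T) (onb i) x
      = (Real.sqrt s : ℂ) * T (onb i) (stretch s x) :=
    ae_all_iff.2 fun i => coeFn_dilate hs (T (onb i))
  have hc : ‖(Real.sqrt s : ℂ)‖ₑ ^ 2 = ENNReal.ofReal s := by
    rw [enorm_sq_eq_ofReal, Complex.norm_real, Real.norm_eq_abs, sq_abs, Real.sq_sqrt hs.le]
  filter_upwards [h] with x hx
  simp only [frameDensity, hx, enorm_mul, mul_pow, ENNReal.tsum_mul_left, hc]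

theorem lintegral_frameDensity_dilate_mul {s : ℝ} (hs : 0 < s) (T : L2 →L[ℂ] L2)
    (F : Space → ℝ≥0∞) :
    ∫⁻ x, frameDensity (dilate s hs ∘L T) x * F x
      = ∫⁻ y, frameDensity T y * F (stretch s⁻¹ y) := by
  have h1 : ∫⁻ x, frameDensity (dilate s hs ∘L T) x * F x
      = ∫⁻ x, ENNReal.ofReal s * (frameDensity T (stretch s x)
          * F (stretch s⁻¹ (stretch s x))) := by
    refine lintegral_congr_ae ?_
    filter_upwards [frameDensity_dilate_ae_eq hs T] with x hx
    rw [hx, stretch_stretch, inv_mul_cancel₀ hs.ne', stretch_one, mul_assoc]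
  rw [h1, lintegral_const_mul' _ _ ENNReal.ofReal_ne_top,
    lintegral_comp_stretch hs (fun y => frameDensity T y * F (stretch s⁻¹ y)), ← mul_assoc,
    ← ENNReal.ofReal_mul hs.le, mul_inv_cancel₀ hs.ne', ENNReal.ofReal_one, one_mul]

/-- Spreading by `1/s` enlarges the distance to the nucleus by at most that factor. -/
theorem le_attraction_dilate {s : ℝ} (hs : 0 < s) (hs1 : s ≤ 1) (T : L2 →L[ℂ] L2) :
    ENNReal.ofReal s * attraction (frameDensity T)
      ≤ attraction (frameDensity (dilate s hs ∘L T)) := by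
  rw [attraction, attraction, lintegral_frameDensity_dilate_mul hs T fun x => ‖x‖ₑ⁻¹,
    ← lintegral_const_mul' _ _ ENNReal.ofReal_ne_top]
  refine lintegral_mono fun y => ?_
  rw [mul_left_comm]
  gcongr
  rw [← inv_inv (ENNReal.ofReal s), ← ENNReal.mul_inv (by simp) (by simp [hs])]
  gcongr
  rw [← ENNReal.ofReal_inv_of_pos hs, ← ofReal_norm, ← ofReal_norm,
    ← ENNReal.ofReal_mul (by positivity)]
  exact ENNReal.ofReal_le_ofReal (norm_stretch_le ((one_le_inv₀ hs).2 hs1) y)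

theorem coulombPair_dilate {s : ℝ} (hs : 0 < s) (T : L2 →L[ℂ] L2) :
    coulombPair (frameDensity (dilate s hs ∘L T)) (frameDensity (dilate s hs ∘L T))
      = ∫⁻ x, frameDensity T x * ∫⁻ y, frameDensity T y * ‖stretch s⁻¹ (x - y)‖ₑ⁻¹ := by
  rw [coulombPair, lintegral_frameDensity_dilate_mul hs T]
  refine lintegral_congr fun x => ?_
  rw [coulombPotential, lintegral_frameDensity_dilate_mul hs T fun y => ‖stretch s⁻¹ x - y‖ₑ⁻¹]
  simp_rw [map_sub]

theorem enorm_le_enorm_stretch {s : ℝ} (hs : 1 ≤ s) (x : Space) : ‖x‖ₑ ≤ ‖stretch s x‖ₑ := by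
  rw [← ofReal_norm, ← ofReal_norm]
  exact ENNReal.ofReal_le_ofReal (norm_le_norm_stretch hs x)

theorem repulsion_dilate_le {s : ℝ} (hs : 0 < s) (hs1 : s ≤ 1) (T : L2 →L[ℂ] L2) :
    repulsion (frameDensity (dilate s hs ∘L T)) ≤ repulsion (frameDensity T) := by
  rw [repulsion_eq (measurable_frameDensity _), repulsion_eq (measurable_frameDensity T),
    coulombPair_dilate, coulombPair]
  simp only [coulombPotential]
  gcongr with x y
  exact enorm_le_enorm_stretch ((one_le_inv₀ hs).2 hs1) _

theorem volume_coordinate_eq (c : ℝ) : volume {y : Space | y 2 = c} = 0 := by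
  have h := (EuclideanSpace.volume_preserving_symm_measurableEquiv_toLp (Fin 3)).measure_preimage
    (s := {f : Fin 3 → ℝ | f 2 = c})
    ((measurableSet_singleton c).preimage (measurable_pi_apply 2)).nullMeasurableSet
  rw [volume_pi, Measure.pi_hyperplane] at h
  exact h

theorem tendsto_inv_enorm_stretch {x : Space} (hx : x 2 ≠ 0) :
    Filter.Tendsto (fun n : ℕ => ‖stretch ((n : ℝ) + 1) x‖ₑ⁻¹) Filter.atTop (nhds 0) := by
  have h1 : Filter.Tendsto (fun n : ℕ => ((n : ℝ) + 1) * |x 2|) Filter.atTop Filter.atTop :=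
    (Filter.tendsto_atTop_add_const_right _ _ tendsto_natCast_atTop_atTop).atTop_mul_const
      (abs_pos.2 hx)
  have h2 := ENNReal.tendsto_ofReal_atTop.comp
    (Filter.tendsto_atTop_mono (fun n : ℕ => abs_mul_le_norm_stretch ((n : ℝ) + 1) x) h1)
  have h3 := h2.inv
  simpa [Function.comp_def, ofReal_norm] using h3

/-- Dominated convergence in `y` and then in `x`. The stretched kernel tends to zero off the null
plane `y₂ = x₂` and is dominated by the Coulomb kernel, whose energy is finite. -/
theorem tendsto_coulombPair_dilate {β : ℝ} {T : L2 →L[ℂ] L2} (hT : mass T ≠ ∞)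
    (hK : kinetic β T ≠ ∞) :
    Filter.Tendsto (fun n : ℕ => ∫⁻ x, frameDensity T x
      * ∫⁻ y, frameDensity T y * ‖stretch ((n : ℝ) + 1) (x - y)‖ₑ⁻¹) Filter.atTop (nhds 0) := by
  have hm := measurable_frameDensity T
  have hfin : ∀ᵐ x, frameDensity T x < ∞ :=
    ae_lt_top hm (by rwa [lintegral_frameDensity])
  have hV : ∀ x, coulombPotential (frameDensity T) x ≠ ∞ := fun x =>
    ne_top_of_le_ne_top (by finiteness) (coulombPotential_frameDensity_le β T x one_pos)
  have hone : ∀ n : ℕ, (1 : ℝ) ≤ (n : ℝ) + 1 := fun n => by simp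
  have hmeas : ∀ n : ℕ, Measurable fun p : Space × Space =>
      frameDensity T p.2 * ‖stretch ((n : ℝ) + 1) (p.1 - p.2)‖ₑ⁻¹ := fun n => by fun_prop
  have hbound : ∀ (n : ℕ) x, ∫⁻ y, frameDensity T y * ‖stretch ((n : ℝ) + 1) (x - y)‖ₑ⁻¹
      ≤ coulombPotential (frameDensity T) x := fun n x =>
    lintegral_mono fun y => by
      gcongr
      exact enorm_le_enorm_stretch (hone n) _
  have hinner : ∀ x, Filter.Tendsto
      (fun n : ℕ => ∫⁻ y, frameDensity T y * ‖stretch ((n : ℝ) + 1) (x - y)‖ₑ⁻¹)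
      Filter.atTop (nhds 0) := by
    intro x
    have h := tendsto_lintegral_of_dominated_convergence
      (F := fun (n : ℕ) y => frameDensity T y * ‖stretch ((n : ℝ) + 1) (x - y)‖ₑ⁻¹)
      (f := fun _ => 0) (fun y => frameDensity T y * ‖x - y‖ₑ⁻¹) (fun n => by fun_prop)
      (fun n => Filter.Eventually.of_forall fun y => by
        dsimp only
        gcongr
        exact enorm_le_enorm_stretch (hone n) _) (hV x) (by
      have h0 : ∀ᵐ y : Space, y 2 ≠ x 2 := by
        rw [ae_iff]
        simpa using volume_coordinate_eq (x 2)
      filter_upwards [hfin, h0] with y hy hy2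
      have := ENNReal.Tendsto.const_mul (a := frameDensity T y)
        (tendsto_inv_enorm_stretch (x := x - y) (by simpa [sub_eq_zero] using hy2.symm))
        (Or.inr hy.ne)
      simpa using this)
    simpa using h
  have h := tendsto_lintegral_of_dominated_convergence
    (F := fun (n : ℕ) x => frameDensity T x
      * ∫⁻ y, frameDensity T y * ‖stretch ((n : ℝ) + 1) (x - y)‖ₑ⁻¹)
    (f := fun _ => 0) (fun x => frameDensity T x * coulombPotential (frameDensity T) x)
    (fun n => hm.mul (hmeas n).lintegral_prod_right')
    (fun n => Filter.Eventually.of_forall fun x => by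
      dsimp only
      gcongr
      exact hbound n x) (coulombPair_frameDensity_ne_top hT hK) (by
      filter_upwards [hfin] with x hx
      simpa using ENNReal.Tendsto.const_mul (a := frameDensity T x) (hinner x) (Or.inr hx.ne))
  simpa using h

/-! ### The variational problems in terms of frames -/

theorem projLow_adjoint (β : ℝ) : (projLow β).adjoint = projLow β :=
  ((ContinuousLinearMap.eq_adjoint_iff _ _).2 (inner_projLow_left β)).symm

theorem projLow_comp_projLow (β : ℝ) : projLow β ∘L projLow β = projLow β :=
  ContinuousLinearMap.ext fun ψ => projLow_eq_self (projLow_mem β ψ)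

theorem projHigh_adjoint (β : ℝ) : (projHigh β).adjoint = projHigh β := by
  rw [projHigh, map_sub, projLow_adjoint]
  congr 1
  exact ContinuousLinearMap.adjoint_id

theorem projHigh_comp_projHigh (β : ℝ) : projHigh β ∘L projHigh β = projHigh β := by
  ext1 ψ
  have h : projLow β (projLow β ψ) = projLow β ψ := projLow_eq_self (projLow_mem β ψ)
  simp [projHigh_apply, h]

theorem projLow_comp_eq_self {β : ℝ} {T : L2 →L[ℂ] L2} (hT : ∀ ψ, T ψ ∈ lowestLandauBand β) :
    projLow β ∘L T = T :=
  ContinuousLinearMap.ext fun ψ => projLow_eq_self (hT ψ)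

theorem energy_projLow_comp (β : ℝ) {T : L2 →L[ℂ] L2} (hT : mass T ≠ ∞) :
    energy β (projLow β ∘L (T ∘L T.adjoint) ∘L projLow β) = frameEnergy β (projLow β ∘L T) := by
  rw [← energy_comp_adjoint β (mass_comp_ne_top _ hT), ContinuousLinearMap.adjoint_comp,
    projLow_adjoint]
  rfl

/-- The form bound with `δ = 1` gives `A ≤ K + M`. Boundedness below is what makes the real `sInf` a
true infimum. -/
theorem neg_le_frameEnergy {β m : ℝ} (hβ : 0 < β) {T : L2 →L[ℂ] L2} (hK : kinetic β T ≠ ∞)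
    (hm : (mass T).toReal ≤ m) : -((β + 1) * m) ≤ frameEnergy β T := by
  have hT := mass_ne_top_of_kinetic hβ hK
  have h := toReal_attraction_frameDensity_le hT hK one_pos
  have h2 : 0 ≤ (repulsion (frameDensity T)).toReal := ENNReal.toReal_nonneg
  rw [frameEnergy]
  nlinarith

theorem kinetic_projLow_ne_top {β : ℝ} (hβ : 0 ≤ β) {T : L2 →L[ℂ] L2} (hK : kinetic β T ≠ ∞) :
    kinetic β (projLow β ∘L T) ≠ ∞ := fun h =>
  hK (by rw [kinetic_eq_projLow_add_projHigh hβ hK, h, top_add])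

theorem confinedEnergy_le {β lam : ℝ} (hβ : 0 < β) {T : L2 →L[ℂ] L2}
    (hK : kinetic β T ≠ ∞) (hm : (mass (projLow β ∘L T)).toReal ≤ lam) :
    confinedEnergy lam β ≤ frameEnergy β (projLow β ∘L T) := by
  refine csInf_le ⟨-((β + 1) * lam), ?_⟩ ?_
  · rintro _ ⟨Γ, hΓ, htr, rfl⟩
    obtain ⟨S, rfl, hS, hSK⟩ := hΓ.exists_eq
    rw [re_trace_comp (projLow_adjoint β) (projLow_comp_projLow β) hS] at htr
    rw [energy_projLow_comp β hS]
    exact neg_le_frameEnergy hβ (kinetic_projLow_ne_top hβ.le hSK) htr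
  · have hT := mass_ne_top_of_kinetic hβ hK
    refine ⟨T ∘L T.adjoint, isAdmissible_comp_adjoint hT hK, ?_, energy_projLow_comp β hT⟩
    rwa [re_trace_comp (projLow_adjoint β) (projLow_comp_projLow β) hT]

theorem frameEnergy_eq_of_mem {β : ℝ} (hβ : 0 < β) {T : L2 →L[ℂ] L2}
    (hT : ∀ ψ, T ψ ∈ lowestLandauBand β) (hK : kinetic β T ≠ ∞) :
    frameEnergy β T = (parallel β T).toReal - (attraction (frameDensity T)).toReal
      + (repulsion (frameDensity T)).toReal := by
  rw [frameEnergy, kinetic_eq_toReal_of_mem hβ hT hK]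
  ring

theorem confinedEnergy_nonpos {β lam : ℝ} (hβ : 0 < β) (hlam : 0 < lam) :
    confinedEnergy lam β ≤ 0 := by
  have hmem : ∀ ψ, (0 : L2 →L[ℂ] L2) ψ ∈ lowestLandauBand β := fun ψ => by simp
  have hm : mass 0 = 0 := by simp [mass]
  have hp : parallel β 0 = 0 := by
    have := parallel_smul β 0 0
    simpa using this
  have hK : kinetic β 0 ≠ ∞ := by rw [kinetic_eq_of_mem hβ.le hmem, hm, hp]; simp
  have hA : attraction (frameDensity 0) = 0 := by
    have := attraction_frameDensity_smul 0 0
    simpa using this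
  have hD : repulsion (frameDensity 0) = 0 := by
    have := repulsion_frameDensity_smul 0 0
    simpa using this
  have h := confinedEnergy_le (lam := lam) hβ hK (by simp [hm, hlam.le])
  rwa [projLow_comp_eq_self hmem, frameEnergy_eq_of_mem hβ hmem hK, hp, hA, hD, ENNReal.toReal_zero,
    sub_zero, add_zero] at h

theorem repulsion_frameDensity_ne_top {β : ℝ} {T : L2 →L[ℂ] L2} (hT : mass T ≠ ∞)
    (hK : kinetic β T ≠ ∞) : repulsion (frameDensity T) ≠ ∞ := by
  rw [repulsion_eq (measurable_frameDensity T)]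
  exact ENNReal.mul_ne_top (by simp) (coulombPair_frameDensity_ne_top hT hK)

theorem attraction_frameDensity_ne_top {β : ℝ} {T : L2 →L[ℂ] L2} (hT : mass T ≠ ∞)
    (hK : kinetic β T ≠ ∞) : attraction (frameDensity T) ≠ ∞ :=
  ne_top_of_le_ne_top (by finiteness) (attraction_frameDensity_le β T one_pos)

/-- If the energy of a confined state is not much larger than zero, then a dilated and diluted
version of it has an energy below a multiple of the attraction. -/
theorem attraction_le_confinedEnergy {β lam : ℝ} (hβ : 0 < β) {T : L2 →L[ℂ] L2}
    (hT : ∀ ψ, T ψ ∈ lowestLandauBand β) (hK : kinetic β T ≠ ∞) (hm : (mass T).toReal ≤ lam)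
    (hp : (parallel β T).toReal ≤ 11 / 10 * (attraction (frameDensity T)).toReal)
    (hr : (repulsion (frameDensity T)).toReal
      ≤ 11 / 8 * (attraction (frameDensity T)).toReal) :
    (attraction (frameDensity T)).toReal ≤ -200 * confinedEnergy lam β := by
  -- Dilating by `1/4` and multiplying by the amplitude `1/4` changes the parallel energy by at most
  -- `1/256`, the attraction by at least `1/64` and the repulsion by at most `1/256`. The hypotheses
  -- give `E_conf ≤ (11/10 - 4 + 11/8) A/256`, which is below `-A/200`.
  have hs : (0 : ℝ) < 1 / 4 := by norm_num
  set S := dilate (1 / 4) hs ∘L T with hS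
  have hmemS : ∀ ψ, S ψ ∈ lowestLandauBand β := fun ψ => dilate_mem_lowestLandauBand hs (hT ψ)
  set R := ((1 / 4 : ℝ) : ℂ) • S with hR
  have hmemR : ∀ ψ, R ψ ∈ lowestLandauBand β := fun ψ => Submodule.smul_mem _ _ (hmemS ψ)
  have hMT := mass_ne_top_of_kinetic hβ hK
  have hpT : parallel β T ≠ ∞ := fun h => hK (by rw [kinetic_eq_of_mem hβ.le hT, h, add_top])
  have hMS : mass S = mass T := mass_dilate hs T
  have hpS := parallel_dilate_le β hs T
  have hpS' : parallel β S ≠ ∞ := ne_top_of_le_ne_top (by finiteness) hpS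
  have hKS : kinetic β S ≠ ∞ := by
    rw [kinetic_eq_of_mem hβ.le hmemS, hMS]
    finiteness
  have hAS := attraction_frameDensity_ne_top (hMS ▸ hMT) hKS
  have hKR : kinetic β R ≠ ∞ := by
    rw [kinetic_eq_of_mem hβ.le hmemR, hR, mass_smul, parallel_smul, hMS]
    finiteness
  have hc : ‖((1 / 4 : ℝ) : ℂ)‖ₑ.toReal = 1 / 4 := by
    rw [toReal_enorm, Complex.norm_real]
    norm_num
  have hE := confinedEnergy_le (lam := lam) hβ hKR (by
    rw [projLow_comp_eq_self hmemR, hR, mass_smul, hMS, ENNReal.toReal_mul, ENNReal.toReal_pow, hc]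
    nlinarith [ENNReal.toReal_nonneg (a := mass T)])
  rw [projLow_comp_eq_self hmemR, frameEnergy_eq_of_mem hβ hmemR hKR, hR, parallel_smul,
    attraction_frameDensity_smul, repulsion_frameDensity_smul] at hE
  simp only [ENNReal.toReal_mul, ENNReal.toReal_pow, hc] at hE
  have h1 := ENNReal.toReal_mono (by finiteness) hpS
  have h2 := ENNReal.toReal_mono hAS (le_attraction_dilate hs (by norm_num) T)
  have h3 := ENNReal.toReal_mono (repulsion_frameDensity_ne_top hMT hK)
    (repulsion_dilate_le hs (by norm_num) T)
  rw [ENNReal.toReal_mul, ENNReal.toReal_ofReal (by norm_num)] at h1 h2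
  have h4 : 0 ≤ (attraction (frameDensity T)).toReal := ENNReal.toReal_nonneg
  linarith

/-- A nonnegative energy is trivially above the left side, as `E_conf ≤ 0`. Otherwise `p - (1 + ε)A
+ (1 - 2ε)D < 0`, so `p ≤ (11/10)A` and `D ≤ (11/8)A`. The error `ε(A + 2D)` is then at most
`(15/4)εA`, hence at most `750 ε (-E_conf)`. -/
theorem one_add_mul_confinedEnergy_le {β lam δ ε : ℝ} (hβ : 0 < β) (hlam : 0 < lam) (hδ : 0 < δ)
    (hδβ : δ ^ 2 * β = 1) (hε : ε = 4 * (1 + lam) * δ) (hε1 : ε ≤ 1 / 10) {T : L2 →L[ℂ] L2}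
    (hK : kinetic β T ≠ ∞) (hm : (mass T).toReal ≤ lam) :
    (1 + 800 * ε) * confinedEnergy lam β ≤ frameEnergy β T := by
  have h0 := confinedEnergy_nonpos hβ hlam
  have hε0 : 0 < ε := by rw [hε]; positivity
  have h1 := le_frameEnergy hβ hδ hδβ hlam.le hε (hε1.trans (by norm_num)) hK hm
  have hKS := kinetic_projLow_ne_top hβ.le hK
  have hMT := mass_ne_top_of_kinetic hβ hK
  have hmS : (mass (projLow β ∘L T)).toReal ≤ lam := by
    refine (ENNReal.toReal_mono hMT ?_).trans hm
    rw [mass_eq_projLow_add_projHigh β T]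
    exact le_self_add
  have h2 := confinedEnergy_le hβ hK hmS
  have hmem : ∀ ψ, (projLow β ∘L T) ψ ∈ lowestLandauBand β := fun ψ => projLow_mem β (T ψ)
  rw [frameEnergy_eq_of_mem hβ hmem hKS] at h2
  have h3 := attraction_le_confinedEnergy hβ hmem hKS hmS
  have n1 : 0 ≤ (parallel β (projLow β ∘L T)).toReal := ENNReal.toReal_nonneg
  have n2 : 0 ≤ (attraction (frameDensity (projLow β ∘L T))).toReal := ENNReal.toReal_nonneg
  have n3 : 0 ≤ (repulsion (frameDensity (projLow β ∘L T))).toReal := ENNReal.toReal_nonneg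
  generalize (parallel β (projLow β ∘L T)).toReal = p at *
  generalize (attraction (frameDensity (projLow β ∘L T))).toReal = a at *
  generalize (repulsion (frameDensity (projLow β ∘L T))).toReal = r at *
  generalize confinedEnergy lam β = e at *
  rcases le_or_gt 0 (frameEnergy β T) with hE | hE
  · nlinarith
  · have h4 : ε * a ≤ 1 / 10 * a := by gcongr
    have h5 : ε * r ≤ 1 / 10 * r := by gcongr
    have h6 : r ≤ 11 / 8 * a := by linarith
    have h7 := h3 (by linarith) h6
    nlinarith

theorem hartreeEnergy_le {β lam : ℝ} (hβ : 0 < β) {T : L2 →L[ℂ] L2}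
    (hK : kinetic β T ≠ ∞) (hm : (mass T).toReal = lam) :
    hartreeEnergy lam β ≤ frameEnergy β T := by
  refine csInf_le ⟨-((β + 1) * lam), ?_⟩ ?_
  · rintro _ ⟨Γ, hΓ, htr, rfl⟩
    obtain ⟨S, rfl, hS, hSK⟩ := hΓ.exists_eq
    rw [trace_comp_adjoint hS, Complex.ofReal_inj] at htr
    rw [energy_comp_adjoint β hS]
    exact neg_le_frameEnergy hβ hSK htr.le
  · have hT := mass_ne_top_of_kinetic hβ hK
    refine ⟨T ∘L T.adjoint, isAdmissible_comp_adjoint hT hK, ?_, energy_comp_adjoint β hT⟩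
    rw [trace_comp_adjoint hT, hm]

theorem exists_mem_lowestLandauBand_mass_eq {β lam : ℝ} (hβ : 0 < β) (hlam : 0 < lam) :
    ∃ T : L2 →L[ℂ] L2, (∀ ψ, T ψ ∈ lowestLandauBand β) ∧ kinetic β T ≠ ∞ ∧
      (mass T).toReal = lam := by
  obtain ⟨ψ, hψ, hψ0, hψ2⟩ := exists_ne_zero_mem_lowestLandauBand hβ
  set S : L2 →L[ℂ] L2 := (innerSL ℂ ψ).smulRight ψ with hS
  have hSa : ∀ φ, S φ = ⟪ψ, φ⟫_ℂ • ψ := fun φ => rfl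
  have hsum : ∑' i, ‖⟪ψ, onb i⟫_ℂ‖ₑ ^ 2 = ‖ψ‖ₑ ^ 2 := by
    rw [← HilbertBasis.tsum_enorm_inner_sq onb ψ]
    simp_rw [enorm_inner_symm]
  have hmS : mass S = ‖ψ‖ₑ ^ 2 * ‖ψ‖ₑ ^ 2 := by
    simp_rw [mass, hSa, enorm_smul, mul_pow, ENNReal.tsum_mul_right, hsum]
  have hpS : parallel β S = ‖ψ‖ₑ ^ 2 * momentumSq β 2 ψ := by
    simp_rw [parallel, hSa, momentumSq_smul, ENNReal.tsum_mul_right, hsum]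
  -- The rank one operator `S` has mass `‖ψ‖⁴`, so this `c` normalizes it to `lam`.
  set c : ℝ := Real.sqrt lam / ‖ψ‖ ^ 2
  have hmem : ∀ φ, ((c : ℂ) • S) φ ∈ lowestLandauBand β := fun φ =>
    Submodule.smul_mem _ _ (Submodule.smul_mem _ _ hψ)
  refine ⟨(c : ℂ) • S, hmem, ?_, ?_⟩
  · rw [kinetic_eq_of_mem hβ.le hmem, mass_smul, parallel_smul, hmS, hpS]
    finiteness
  · rw [mass_smul, hmS]
    simp only [ENNReal.toReal_mul, ENNReal.toReal_pow, toReal_enorm, Complex.norm_real,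
      Real.norm_eq_abs, sq_abs]
    have h0 : ‖ψ‖ ≠ 0 := norm_ne_zero_iff.2 hψ0
    simp only [c, div_pow, Real.sq_sqrt hlam.le]
    field_simp

/-- The constraint is an equality, so the zero state is not available. A state of the band with the
right mass is instead spread along the field by `n + 1`: its parallel energy and its repulsion tend
to zero, and the attraction only helps. -/
theorem hartreeEnergy_nonpos {β lam : ℝ} (hβ : 0 < β) (hlam : 0 < lam) :
    hartreeEnergy lam β ≤ 0 := by
  obtain ⟨T, hmem, hK, hm⟩ := exists_mem_lowestLandauBand_mass_eq hβ hlam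
  have hMT := mass_ne_top_of_kinetic hβ hK
  have hpT : parallel β T ≠ ∞ := fun h => hK (by rw [kinetic_eq_of_mem hβ.le hmem, h, add_top])
  have hs : ∀ n : ℕ, (0 : ℝ) < ((n : ℝ) + 1)⁻¹ := fun n => by positivity
  have key : ∀ n : ℕ, hartreeEnergy lam β ≤ (((n : ℝ) + 1)⁻¹) ^ 2 * (parallel β T).toReal
      + 2⁻¹ * (∫⁻ x, frameDensity T x
        * ∫⁻ y, frameDensity T y * ‖stretch ((n : ℝ) + 1) (x - y)‖ₑ⁻¹).toReal := by
    intro n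
    set S := dilate _ (hs n) ∘L T with hS
    have hmemS : ∀ ψ, S ψ ∈ lowestLandauBand β := fun ψ =>
      dilate_mem_lowestLandauBand (hs n) (hmem ψ)
    have hMS : mass S = mass T := mass_dilate (hs n) T
    have hpS := parallel_dilate_le β (hs n) T
    have hpS' : parallel β S ≠ ∞ := ne_top_of_le_ne_top (by finiteness) hpS
    have hKS : kinetic β S ≠ ∞ := by
      rw [kinetic_eq_of_mem hβ.le hmemS, hMS]
      finiteness
    refine (hartreeEnergy_le hβ hKS (by rw [hMS, hm])).trans ?_
    have h1 := ENNReal.toReal_mono (by finiteness) hpS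
    rw [ENNReal.toReal_mul, ENNReal.toReal_ofReal (by positivity)] at h1
    have h2 := coulombPair_dilate (hs n) T
    rw [inv_inv] at h2
    rw [frameEnergy_eq_of_mem hβ hmemS hKS, repulsion_eq (measurable_frameDensity S), hS, h2,
      ENNReal.toReal_mul, ENNReal.toReal_inv, ENNReal.toReal_ofNat]
    have h3 : 0 ≤ (attraction (frameDensity S)).toReal := ENNReal.toReal_nonneg
    linarith
  have l1 : Filter.Tendsto (fun n : ℕ => (((n : ℝ) + 1)⁻¹) ^ 2 * (parallel β T).toReal)
      Filter.atTop (nhds 0) := by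
    have := ((tendsto_one_div_add_atTop_nhds_zero_nat (𝕜 := ℝ)).pow 2).mul_const
      (parallel β T).toReal
    simpa using this
  have l2 := ((ENNReal.tendsto_toReal ENNReal.zero_ne_top).comp
    (tendsto_coulombPair_dilate hMT hK)).const_mul (2⁻¹ : ℝ)
  have l3 := l1.add l2
  simp only [ENNReal.toReal_zero, mul_zero, add_zero] at l3
  exact ge_of_tendsto' l3 key

theorem one_add_mul_confinedEnergy_le_hartreeEnergy {β lam δ ε : ℝ} (hβ : 0 < β) (hlam : 0 < lam)
    (hδ : 0 < δ) (hδβ : δ ^ 2 * β = 1) (hε : ε = 4 * (1 + lam) * δ) (hε1 : ε ≤ 1 / 10) :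
    (1 + 800 * ε) * confinedEnergy lam β ≤ hartreeEnergy lam β := by
  refine le_csInf ?_ ?_
  · obtain ⟨T, -, hK, hm⟩ := exists_mem_lowestLandauBand_mass_eq hβ hlam
    have hT := mass_ne_top_of_kinetic hβ hK
    exact ⟨_, T ∘L T.adjoint, isAdmissible_comp_adjoint hT hK,
      by rw [trace_comp_adjoint hT, hm], rfl⟩
  · rintro _ ⟨Γ, hΓ, htr, rfl⟩
    obtain ⟨S, rfl, hS, hSK⟩ := hΓ.exists_eq
    rw [trace_comp_adjoint hS, Complex.ofReal_inj] at htr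
    rw [energy_comp_adjoint β hS]
    exact one_add_mul_confinedEnergy_le hβ hlam hδ hδβ hε hε1 hSK htr.le

/-- Nonpositive energy gives `2β M(R) ≤ K - βM ≤ A`. The form bound with parameter `δ/2` yields `A ≤
(δ/2)(K - βM) + (5/2)δβM`; for `δ ≤ 1` at most half of `K - βM` is absorbed on the left. -/
theorem mass_projHigh_le {β lam δ : ℝ} (hβ : 0 < β) (hδ : 0 < δ) (hδβ : δ ^ 2 * β = 1)
    (hδ1 : δ ≤ 1) {T : L2 →L[ℂ] L2} (hK : kinetic β T ≠ ∞) (hm : (mass T).toReal ≤ lam)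
    (hE : frameEnergy β T ≤ 0) :
    (mass (projHigh β ∘L T)).toReal ≤ 5 / 2 * lam * δ := by
  have hMT := mass_ne_top_of_kinetic hβ hK
  have hKs := kinetic_eq_projLow_add_projHigh hβ.le hK
  have hMs := mass_eq_projLow_add_projHigh β T
  have hK0 := le_kinetic hβ.le (projLow β ∘L T)
  have hK1 := le_kinetic_projHigh hβ T
  have hA := toReal_attraction_frameDensity_le hMT hK (half_pos hδ)
  have hSK := kinetic_projLow_ne_top hβ.le hK
  have hRK : kinetic β (projHigh β ∘L T) ≠ ∞ := fun h => hK (by rw [hKs, h, add_top])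
  have hK0' := ENNReal.toReal_mono hSK hK0
  have hK1' := ENNReal.toReal_mono hRK hK1
  rw [ENNReal.toReal_mul, ENNReal.toReal_ofReal (by positivity)] at hK0' hK1'
  have hKs' : (kinetic β T).toReal = (kinetic β (projLow β ∘L T)).toReal
      + (kinetic β (projHigh β ∘L T)).toReal := by rw [hKs, ENNReal.toReal_add hSK hRK]
  have hMs' : (mass T).toReal = (mass (projLow β ∘L T)).toReal
      + (mass (projHigh β ∘L T)).toReal := by
    rw [hMs, ENNReal.toReal_add (mass_comp_ne_top _ hMT) (mass_comp_ne_top _ hMT)]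
  have n1 : 0 ≤ (repulsion (frameDensity T)).toReal := ENNReal.toReal_nonneg
  have n2 : 0 ≤ (mass T).toReal := ENNReal.toReal_nonneg
  have n3 : 0 ≤ (mass (projHigh β ∘L T)).toReal := ENNReal.toReal_nonneg
  rw [frameEnergy] at hE
  generalize (mass T).toReal = m at *
  generalize (mass (projHigh β ∘L T)).toReal = m1 at *
  generalize (mass (projLow β ∘L T)).toReal = m0 at *
  generalize (kinetic β T).toReal = k at *
  have e1 : (δ / 2)⁻¹ = 2 * δ * β := by
    field_simp
    linarith
  rw [e1] at hA
  have e2 : 2 * β * m1 ≤ k - β * m := by rw [hKs', hMs']; linarith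
  have e3 : k - β * m ≤ δ / 2 * (k - β * m) + 5 / 2 * (δ * β) * m := by linarith
  have e4 : 0 ≤ k - β * m := le_trans (by positivity) e2
  have e5 : δ / 2 * (k - β * m) ≤ 1 / 2 * (k - β * m) := by gcongr
  have e6 : 2 * β * m1 ≤ 5 * (δ * β) * m := by linarith
  have e7 : m1 ≤ 5 / 2 * m * δ := by
    by_contra! h
    nlinarith [mul_pos hβ (sub_pos.2 h)]
  exact e7.trans (by gcongr)

end MagneticHartree

end

/-! ### Conclusion of both estimates -/

theorem mainTheorem12 :
    (∃ C : ℝ, 0 < C ∧ ∀ lam β : ℝ, 0 < lam → 0 < β →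
      MagneticHartree.confinedEnergy lam β
        ≤ MagneticHartree.hartreeEnergy lam β
            * (1 - C * (1 + lam) ^ 2 * β ^ (-(1 / 2) : ℝ))) ∧
    (∃ C : ℝ, 0 < C ∧ ∀ lam β : ℝ, 0 < lam → 0 < β →
      ∀ Γ : MagneticHartree.L2 →L[ℂ] MagneticHartree.L2,
        MagneticHartree.IsHartreeMinimizer lam β Γ →
        (MagneticHartree.trace (MagneticHartree.projHigh β ∘L Γ)).re
          ≤ C * (1 + lam) ^ 3 * β ^ (-(1 / 2) : ℝ)) := by
  -- `δ = β^(-1/2)` enters only through `δ > 0` and `δ²β = 1`.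
  have hpow : ∀ β : ℝ, 0 < β → 0 < β ^ (-(1 / 2) : ℝ) ∧ (β ^ (-(1 / 2) : ℝ)) ^ 2 * β = 1 := by
    intro β hβ
    refine ⟨Real.rpow_pos_of_pos hβ _, ?_⟩
    rw [← Real.rpow_natCast, ← Real.rpow_mul hβ.le]
    norm_num [Real.rpow_neg_one, hβ.ne']
  -- `3200 = 800 · 4`, from `800 ε` with `ε = 4(1 + λ)δ`.
  refine ⟨⟨3200, by norm_num, ?_⟩, ⟨5 / 2, by norm_num, ?_⟩⟩
  · intro lam β hlam hβ
    obtain ⟨hδ, hδβ⟩ := hpow β hβ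
    generalize β ^ (-(1 / 2) : ℝ) = δ at *
    have hE := MagneticHartree.hartreeEnergy_nonpos hβ hlam
    have hC := MagneticHartree.confinedEnergy_nonpos hβ hlam
    have hle : (1 + lam) * δ ≤ (1 + lam) ^ 2 * δ := by
      gcongr
      nlinarith
    rcases le_or_gt (4 * (1 + lam) * δ) (1 / 10) with h | h
    · have key := MagneticHartree.one_add_mul_confinedEnergy_le_hartreeEnergy hβ hlam hδ hδβ rfl h
      generalize MagneticHartree.hartreeEnergy lam β = e at *
      have hu : 0 < 800 * (4 * (1 + lam) * δ) := by positivity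
      calc MagneticHartree.confinedEnergy lam β
          ≤ e / (1 + 800 * (4 * (1 + lam) * δ)) := by
            rw [le_div_iff₀ (by positivity), mul_comm]
            exact key
        -- `1/(1 + u) ≥ 1 - u`, reversed by multiplication with `e ≤ 0`.
        _ ≤ e * (1 - 800 * (4 * (1 + lam) * δ)) := by
            rw [div_le_iff₀ (by positivity)]
            nlinarith [mul_nonneg (neg_nonneg.2 hE) (sq_nonneg (800 * (4 * (1 + lam) * δ)))]
        _ ≤ _ := mul_le_mul_of_nonpos_left (by linarith) hE
    -- For `ε > 1/10` the factor `1 - 3200(1 + λ)²δ` is negative, so the right side is nonnegative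
    -- while `E_conf ≤ 0`.
    · exact hC.trans (mul_nonneg_of_nonpos_of_nonpos hE (by linarith))
  · intro lam β hlam hβ Γ hΓ
    obtain ⟨hδ, hδβ⟩ := hpow β hβ
    generalize β ^ (-(1 / 2) : ℝ) = δ at *
    obtain ⟨hadm, htr, hen⟩ := hΓ
    obtain ⟨T, rfl, hT, hK⟩ := hadm.exists_eq
    rw [MagneticHartree.trace_comp_adjoint hT, Complex.ofReal_re] at htr
    rw [MagneticHartree.energy_comp_adjoint β hT] at hen
    rw [MagneticHartree.re_trace_comp (MagneticHartree.projHigh_adjoint β)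
      (MagneticHartree.projHigh_comp_projHigh β) hT]
    have hle : lam ≤ (1 + lam) ^ 3 := by
      nlinarith [pow_pos hlam 3, pow_pos hlam 2]
    rcases le_or_gt δ 1 with h | h
    · refine (MagneticHartree.mass_projHigh_le hβ hδ hδβ h hK htr
        (hen.trans_le (MagneticHartree.hartreeEnergy_nonpos hβ hlam))).trans ?_
      gcongr
    -- For `δ > 1` the trivial bound by the total mass suffices.
    · have h1 : (MagneticHartree.mass (MagneticHartree.projHigh β ∘L T)).toReal ≤ lam := by
        refine (ENNReal.toReal_mono hT ?_).trans htr
        rw [MagneticHartree.mass_eq_projLow_add_projHigh β T]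
        exact le_add_self
      have h2 : lam * 1 ≤ (1 + lam) ^ 3 * δ := by gcongr
      linarith [mul_pos (pow_pos (show 0 < 1 + lam by linarith) 3) hδ]
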